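/- **Setting.** Let $\mathcal A\subset\mathbb R^d$ be a nonempty set of actions with $\|a\|_2\le 1$ for $a\in\mathcal A$, let $\theta_*\in\mathbb R^d$ with $\|\theta_*\|_2\le1$, let $T\ge2$, and let $\log$ be the natural logarithm. In round $t\in\{1,\dots,T\}$ a learner plays $a_t\in\mathcal A$ and receives $r_t=\langle\theta_*,a_t\rangle+\eta_t$ with $|r_t|\le1$, where, given the information available before the reward of round $t$ (the earlier rewards, the learner's internal randomness so far, hence also $a_1,\dots,a_t$), $\eta_t$ has mean zero and is $1$-sub-Gaussian. The regret is $R_T=T\sup_{a\in\mathcal A}\langle\theta_*,a\rangle-\sum_{t=1}^T\langle\theta_*,a_t\rangle$. **Core sets.** Fix a constant $B$. A core set of a finite nonempty set $A\subset\mathbb R^d$ with span of dimension $m$ is a subset $\mathcal C\subseteq A$ with $|\mathcal C|\le B\max(1,m)$ and the same span, together with a probability distribution $\pi$ on $\mathcal C$, such that $V(\pi)=\sum_{\alpha\in\mathcal C}\pi(\alpha)\alpha\alpha^\top$ is invertible on the span of $A$ and $a^\top V(\pi)^{-1}a\le2m$ for all $a\in A$. **Algorithm** (parameters $\epsilon>0$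 and $\Delta\in(0,2]$). Let $\mathcal A_1\subseteq\mathcal A$ be a finite $\frac1T$-net of $\mathcal A$ with the same span and at most $(3T)^d+d$ elements, and let $q=(2T)^{1/\log T}$. For each integer $i$ with $1\le i\le\log T-1$: * let $(\mathcal C_i,\pi_i)$ be a core set of $\mathcal A_i$, and pull each $a\in\mathcal C_i$ exactly $n_{ia}=\lceil\pi_i(a)q^i\rceil$ times, in some order; * let $\hat r_{ia}$ be the sum of the rewards of these pulls plus independent noise with distribution $\mathrm{Lap}(\Delta/\epsilon)$; * let $\hat\theta_i=V_i^{-1}\sum_{a\in\mathcal C_i}\hat r_{ia}a$ with $V_i=\sum_{a\in\mathcal C_i}n_{ia}aa^\top$ (inverse on the span of $\mathcal A_i$), and let $$\gamma_i=\sqrt{\tfrac{4d}{q^i}\log(4|\mathcal A_i|T^2)}+\frac{\Delta\,(2Bd^2+2d\log(4|\mathcal A_i|T^2))}{\epsilon q^i};$$ * let $\mathcal A_{i+1}=\{a\in\mathcal A_i:\langle a,\hat\theta_i\rangle\ge\max_{\alpha\in\mathcal A_i}\langle\alpha,\hat\theta_i\rangle-2\gamma_i\}$. After the last batch $L$, play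 a maximizer of $\langle\alpha,\hat\theta_L\rangle$ over $\alpha\in\mathcal A_L$ for the remaining time (any fixed element of $\mathcal A_1$ if there is no batch). The procedure stops after $T$ rounds, even inside a batch. **Theorem.** There is a constant $B_0$ such that for every $B\ge B_0$ the nets and core sets that the algorithm needs always exist. Moreover, for every $B$ there is a constant $C$, depending only on $B$ (not on $d,\mathcal A,\theta_*,T,\epsilon,\Delta$), such that for every choice of the net, the core sets, the order of the pulls and the rule for ties: 1. (Privacy.) The algorithm, as a randomized map from reward sequences in $[-1,1]^T$ to action sequences, is $\epsilon$-differentially private: for all $R,R'\in[-1,1]^T$ that differ in exactly one round, and there by at most $\Delta$, and every set $\mathcal O$ of action sequences, $\Pr[\mathcal M(R)\in\mathcal O]\le e^{\epsilon}\Pr[\mathcal M(R')\in\mathcal O]$. For $\Delta=2$ this is $\epsilon$-differential privacy for all neighboring reward sequences in $[-1,1]^T$; for $\Delta=1$ the noise is $\mathrm{Lap}(1/\epsilon)$, and the statement covers rewards in any interval of length $1$. 2. (Regret.) With probability at least $1-\frac1T$, $$R_T\le C\left(d\sqrt{T\log T}+\frac{d^2\log^2T}{\epsilon}\right).$$ In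 particular, for fixed $d$, $R_T\le C_d\left(\sqrt{T\log T}+\frac{\log^2T}{\epsilon}\right)$. -/

import Mathlib

open MeasureTheory ProbabilityTheory
open scoped RealInnerProductSpace

/-! ### Linear algebra: information operators, nets and core sets -/

/-- The space `ℝ^d` of actions and parameters, with the Euclidean norm. -/
abbrev Act (d : ℕ) : Type := EuclideanSpace ℝ (Fin d)

/-- The operator `∑_{a ∈ C} w(a) a aᵀ`. -/
noncomputable def infoOp {d : ℕ} (C : Finset (Act d)) (w : Act d → ℝ) : Act d →ₗ[ℝ] Act d :=
  ∑ a ∈ C, w a • (InnerProductSpace.rankOne ℝ a a : Act d →L[ℝ] Act d).toLinearMap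

open Classical in
/-- `V⁻¹ b`, for a symmetric operator `V` and `b` in the range of `V`: the solution `x` of `V x = b`
that lies in the range of `V`. A symmetric operator restricts to a bijection of its range, so `x` is
unique; if `V` is invertible then this is `V⁻¹ b` in the usual sense. -/
noncomputable def invApply {d : ℕ} (V : Act d →ₗ[ℝ] Act d) (b : Act d) : Act d :=
  if h : ∃ x ∈ LinearMap.range V, V x = b then h.choose else 0

/-- `N` is a `ζ`-net of `𝒜` with at most `(3/ζ)^d + d` elements, which spans the same subspace. -/
def IsNet {d : ℕ} (𝒜 : Set (Act d)) (ζ : ℝ) (N : Finset (Act d)) : Prop :=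
  (N : Set (Act d)) ⊆ 𝒜 ∧
  (∀ a ∈ 𝒜, ∃ a' ∈ N, ‖a' - a‖ ≤ ζ) ∧
  Submodule.span ℝ (N : Set (Act d)) = Submodule.span ℝ 𝒜 ∧
  (N.card : ℝ) ≤ (3 / ζ) ^ d + d

/-- The dimension `m` of the space that a finite set of actions spans. -/
noncomputable def spanDim {d : ℕ} (A : Finset (Act d)) : ℕ :=
  Module.finrank ℝ (Submodule.span ℝ (A : Set (Act d)))

/-- `C`, with the probability weights `π`, is a core set of `A`: it is a subset of size at most
`B m`, where `m` is the dimension of the span of `A`, it spans the same space, the operator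
`V(π) = ∑_{a ∈ C} π(a) a aᵀ` is invertible on that space, and `aᵀ V(π)⁻¹ a ≤ 2 m` for all `a ∈ A`.
(For `A = {0}`, where `m = 0`, the core set has to be `{0}`, hence the `max 1 m`.) -/
def IsCoreSet {d : ℕ} (B : ℝ) (A C : Finset (Act d)) (π : Act d → ℝ) : Prop :=
  C ⊆ A ∧
  (C.card : ℝ) ≤ B * (max 1 (spanDim A) : ℕ) ∧
  Submodule.span ℝ (C : Set (Act d)) = Submodule.span ℝ (A : Set (Act d)) ∧
  (∀ a ∈ C, 0 ≤ π a) ∧ ∑ a ∈ C, π a = 1 ∧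
  ∀ a ∈ A, a ∈ LinearMap.range (infoOp C π) ∧ ⟪a, invApply (infoOp C π) a⟫ ≤ 2 * (spanDim A : ℝ)

/-! ### The algorithm -/

/-- The ratio `q = (2T)^{1 / log T}` of the batch lengths. -/
noncomputable def growth (T : ℕ) : ℝ := (2 * (T : ℝ)) ^ (1 / Real.log T)

/-- The number of batches: the largest natural number that is at most `log T - 1`, or `0` if there is
none. -/
noncomputable def numBatches (T : ℕ) : ℕ := ⌊Real.log T - 1⌋₊

/-- The choices that the pseudocode leaves open: the initial net, for batch `i` with good set `A` the
core set, its weights and the order of the pulls, and the way to break ties between maximizers. -/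
structure Choices (d : ℕ) where
  net : Finset (Act d)
  core : ℕ → Finset (Act d) → Finset (Act d)
  weight : ℕ → Finset (Act d) → Act d → ℝ
  pulls : ℕ → Finset (Act d) → List (Act d)
  tie : Finset (Act d) → Act d

/-- The number of pulls `n_{ia} = ⌈π_i(a) q^i⌉` of the action `a` in batch `i`. -/
noncomputable def Choices.numPulls {d : ℕ} (S : Choices d) (T i : ℕ) (A : Finset (Act d))
    (a : Act d) : ℕ :=
  ⌈S.weight i A a * growth T ^ i⌉₊

open Classical in
/-- The choices follow the pseudocode. -/
structure Choices.Admissible {d : ℕ} (S : Choices d) (B : ℝ) (𝒜 : Set (Act d)) (T : ℕ) : Prop where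
  net_spec : IsNet 𝒜 (1 / (T : ℝ)) S.net
  core_spec : ∀ i, 1 ≤ i → ∀ A ⊆ S.net, A.Nonempty → IsCoreSet B A (S.core i A) (S.weight i A)
  pulls_spec : ∀ i, 1 ≤ i → ∀ A ⊆ S.net, A.Nonempty →
    ∀ a, (S.pulls i A).count a = if a ∈ S.core i A then S.numPulls T i A a else 0
  tie_spec : ∀ A ⊆ S.net, A.Nonempty → S.tie A ∈ A

/-- The confidence width `γ_i` of batch `i` with good set `A`, for Laplace noise of scale `b`. -/
noncomputable def confWidth (d T : ℕ) (B b : ℝ) (i : ℕ) (A : Finset (Act d)) : ℝ :=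
  Real.sqrt (4 * d / growth T ^ i * Real.log (4 * A.card * (T : ℝ) ^ 2)) +
    (2 * B * (d : ℝ) ^ 2 + 2 * d * Real.log (4 * A.card * (T : ℝ) ^ 2)) * b / growth T ^ i

/-- The state of the learner after some number of batches: the actions played so far, the good set
of the next batch, and the maximizers of the last estimated reward over the last good set. -/
structure LearnerState (d : ℕ) where
  played : List (Act d)
  good : Finset (Act d)
  best : Finset (Act d)

open Classical in
/-- The privatized sum of the rewards of the action `a` in a batch that makes the given `pulls` after
`t₀` rounds. Rounds are numbered from `0`, `rew t` is the reward of round `t`, and `z t a` is the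
noise that is drawn for the action `a` if a batch is complete after `t` rounds. -/
noncomputable def privSum {d : ℕ} (rew : ℕ → ℝ) (z : ℕ → Act d → ℝ) (t₀ : ℕ)
    (pulls : List (Act d)) (a : Act d) : ℝ :=
  (∑ k : Fin pulls.length, if pulls[k] = a then rew (t₀ + k) else 0) + z (t₀ + pulls.length) a

/-- The least squares estimate `θ̂ = V⁻¹ ∑_{a ∈ C} r̂_a a` with `V = ∑_{a ∈ C} n_a a aᵀ`. -/
noncomputable def leastSquares {d : ℕ} (C : Finset (Act d)) (n : Act d → ℕ) (rhat : Act d → ℝ) :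
    Act d :=
  invApply (infoOp C fun a => (n a : ℝ)) (∑ a ∈ C, rhat a • a)

open Classical in
/-- Batch `i` of the algorithm. -/
noncomputable def Choices.batch {d : ℕ} (S : Choices d) (T : ℕ) (B b : ℝ) (rew : ℕ → ℝ)
    (z : ℕ → Act d → ℝ) (i : ℕ) (s : LearnerState d) : LearnerState d :=
  let A := s.good
  let θhat := leastSquares (S.core i A) (S.numPulls T i A)
    (privSum rew z s.played.length (S.pulls i A))
  { played := s.played ++ S.pulls i A
    good := A.filter fun a => ∀ α ∈ A, ⟪α, θhat⟫ - 2 * confWidth d T B b i A ≤ ⟪a, θhat⟫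
    best := A.filter fun a => ∀ α ∈ A, ⟪α, θhat⟫ ≤ ⟪a, θhat⟫ }

/-- The state after the first `j` batches. -/
noncomputable def Choices.stateAfter {d : ℕ} (S : Choices d) (T : ℕ) (B b : ℝ) (rew : ℕ → ℝ)
    (z : ℕ → Act d → ℝ) : ℕ → LearnerState d
  | 0 => { played := [], good := S.net, best := S.net }
  | j + 1 => S.batch T B b rew z (j + 1) (S.stateAfter T B b rew z j)

/-- The algorithm as a map from the reward sequence `R` and the noise `z` to the `T` actions that are
played: those of the batches (cut off after `T` rounds), and then an action that maximizes the last
estimated reward over the last good set. The action of a round depends only on earlier rewards. -/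
noncomputable def Choices.play {d : ℕ} (S : Choices d) (T : ℕ) (B b : ℝ) (R : Fin T → ℝ)
    (z : ℕ → Act d → ℝ) : Fin T → Act d := fun t =>
  let s := S.stateAfter T B b (fun k => if h : k < T then R ⟨k, h⟩ else 0) z (numBatches T)
  s.played.getD t (S.tie s.best)

/-! ### Laplace noise and differential privacy -/

/-- The Laplace distribution `Lap(b)` on `ℝ`, with density `exp(-|x|/b) / (2b)`. -/
noncomputable def laplaceDist (b : ℝ) : Measure ℝ :=
  volume.withDensity fun x => ENNReal.ofReal (Real.exp (-|x| / b) / (2 * b))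

/-- The random variables `z t a` are independent with distribution `Lap(b)`. -/
def IsLaplaceNoise {Ω : Type*} [MeasurableSpace Ω] {d : ℕ} (P : Measure Ω) (b : ℝ)
    (z : ℕ → Act d → Ω → ℝ) : Prop :=
  (∀ t a, Measurable (z t a)) ∧ (∀ t a, P.map (z t a) = laplaceDist b) ∧
    iIndepFun (fun p : ℕ × Act d => z p.1 p.2) P

/-- `(ε, δ)`-differential privacy of a mechanism `M` that maps sequences of `T` rewards in `[-1, 1]`
to random sequences of `T` actions, for neighboring sequences whose entries differ in a single round,
there by at most `Δ`. For `Δ = 2` the bound by `Δ` is no restriction. -/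
def IsDP {Ω : Type*} [MeasurableSpace Ω] {d T : ℕ} (P : Measure Ω)
    (M : (Fin T → ℝ) → Ω → Fin T → Act d) (Δ ε δ : ℝ) : Prop :=
  ∀ R R' : Fin T → ℝ, (∀ t, |R t| ≤ 1) → (∀ t, |R' t| ≤ 1) →
    (∃ t, R t ≠ R' t ∧ |R t - R' t| ≤ Δ ∧ ∀ j, j ≠ t → R j = R' j) →
    ∀ O : Set (Fin T → Act d),
      P {ω | M R ω ∈ O} ≤ ENNReal.ofReal (Real.exp ε) * P {ω | M R' ω ∈ O} + ENNReal.ofReal δ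

/-! ### The bandit -/

/-- The `σ`-algebra generated by the rewards of the first `t` rounds and by the noise that is drawn
after `s` rounds, for `s` in the set `noiseTimes`. -/
abbrev history {Ω : Type*} {d T : ℕ} (r : Fin T → Ω → ℝ) (z : ℕ → Act d → Ω → ℝ) (t : ℕ)
    (noiseTimes : Set ℕ) : MeasurableSpace Ω :=
  (⨆ s : {s : Fin T // (s : ℕ) < t}, MeasurableSpace.comap (r s) inferInstance) ⊔
    ⨆ p : {p : ℕ × Act d // p.1 ∈ noiseTimes}, MeasurableSpace.comap (z p.1.1 p.1.2) inferInstance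

/-- The random rewards `r`, together with the noise `z` and the actions `act` that the learner plays,
form a stochastic linear bandit with parameter `θ`. The information before round `t` consists of the
earlier rewards and of the learner's noise so far, which determine the earlier actions and the action
of round `t`. Given this information, the reward noise `η = r - ⟪θ, act⟫` of round `t` is centered and
`1`-sub-Gaussian. The rewards are bounded by `1`. The noise drawn after `t` rounds is independent of
all that happened before. -/
structure IsLinearBandit {Ω : Type*} [MeasurableSpace Ω] {d T : ℕ} (P : Measure Ω) (θ : Act d)
    (r : Fin T → Ω → ℝ) (z : ℕ → Act d → Ω → ℝ) (act : Fin T → Ω → Act d) : Prop where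
  measurable : ∀ t, Measurable (r t)
  bounded : ∀ t, ∀ᵐ ω ∂P, |r t ω| ≤ 1
  noise_indep : ∀ t ≤ T,
    Indep (⨆ a, MeasurableSpace.comap (z t a) inferInstance) (history r z t (Set.Iio t)) P
  centered : ∀ t : Fin T,
    P[fun ω => r t ω - ⟪θ, act t ω⟫ | history r z t (Set.Iic (t : ℕ))] =ᵐ[P] 0
  subgaussian : ∀ (t : Fin T) (l : ℝ),
    P[fun ω => Real.exp (l * (r t ω - ⟪θ, act t ω⟫)) | history r z t (Set.Iic (t : ℕ))]
      ≤ᵐ[P] fun _ => Real.exp (l ^ 2 / 2)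

/-- The regret `R_T = T max_{a ∈ 𝒜} ⟪θ, a⟫ - ∑_t ⟪θ, a_t⟫`. -/
noncomputable def regret {d T : ℕ} (𝒜 : Set (Act d)) (θ : Act d) (act : Fin T → Act d) : ℝ :=
  T * sSup ((fun a => ⟪θ, a⟫) '' 𝒜) - ∑ t, ⟪θ, act t⟫

/-!
The batch elimination algorithm for linear bandits with Laplace noise: well-definedness,
differential privacy, and the bound on the regret.

**Core sets and nets.** By the Kiefer-Wolfowitz theorem (`exists_optimal_design`), a finite set that
spans a space of dimension `m` carries a distribution with `aᵀ V⁻¹ a ≤ m`. Its support may be large.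
After a change of variables the distribution is isotropic, and the lower half of the barrier method
of Batson, Spielman and Srivastava (`exists_isotropic_sparsifier`) selects `12 m` members whose
uniform distribution has `aᵀ V⁻¹ a ≤ 2 m`. So `B₀ = 12` works. Nets come from the volume bound for
separated sets, with a basis of the span added.

**Privacy.** Each reward enters at most one noisy sum, and the state of the learner depends on the
rewards only through these sums. If one reward changes by `c`, then a shift by `-c` of the Laplace
variable in its sum leaves the whole run unchanged (`Choices.Admissible.stateAfter_eq_of_shift`),
and such a shift costs a factor of at most `exp (|c| ε / Δ)` in probability. Which variable is
shifted depends on the run, but it can be read off from the run in the same way before and after the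
shift, so that the estimates on the parts of the event add up.

**Accuracy.** Given the state before a batch, the pulls of the batch are fixed, and the error of the
estimated reward of an action is a sum of reward noise and of privacy noise with fixed weights
(`Choices.Admissible.exists_error_weights`). The design bounds the sum of the squares of the
weights, and each weight, by `2 d / q ^ i`. The reward noise is handled by a Chernoff bound and a
union bound over the good set. For the privacy noise, a weighted sum of up to `B d` Laplace
variables, the same argument is too weak if the good set is large compared with `exp (B d)`. There
one can bound the sum of the absolute values of the Laplace variables instead, which needs no union
bound but ignores the cancellation of signs and is too weak if the good set is small. The geometric
mean of the two bounds is smaller than `1 / (2 T log T)` in all cases, if `T` is large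
(`laplace_uniform_tail`). So with probability at least `1 - 1 / T` all batches that end by round `T`
are accurate.

**Regret.** If all these batches are accurate, then an optimal action of the net is never
eliminated, and the gaps of the actions in batch `i + 1` are at most `4 γ_i`
(`Choices.Admissible.good_of_accurate`). Batch `i` has at most `q ^ i + B d` rounds, and `q ^ i`
grows geometrically up to order `T`. So the square root parts of the `γ_i` contribute a geometric
sum of order `d √(T log T)`, and the Laplace parts contribute order `d ^ 2 log T / ε` in each of the
at most `log T` batches (`sum_gapBound_le`). For bounded `T` the bound `2 T` on the regret is
enough.
-/

/-! ### Optimal design and sparsification of quadratic forms -/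

section QuadraticForms

open Matrix

/-- The spectral theorem, with the orthogonal matrix and the eigenvalues as plain data. -/
theorem exists_orthogonal_diagonal {n : Type*} [Fintype n] [DecidableEq n] {M : Matrix n n ℝ}
    (hM : M.PosDef) : ∃ (U : Matrix n n ℝ) (l : n → ℝ), U * Uᵀ = 1 ∧ Uᵀ * U = 1 ∧
      (∀ i, 0 < l i) ∧ M = U * diagonal l * Uᵀ := by
  refine ⟨hM.1.eigenvectorUnitary, hM.1.eigenvalues, ?_, ?_, hM.eigenvalues_pos, ?_⟩
  · exact Unitary.mul_star_self_of_mem hM.1.eigenvectorUnitary.2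
  · exact Unitary.star_mul_self_of_mem hM.1.eigenvectorUnitary.2
  · have := hM.1.spectral_theorem
    rw [Unitary.conjStarAlgAut_apply] at this
    simpa [star_eq_conjTranspose] using this

theorem posDef_orthogonal_diagonal {n : Type*} [Fintype n] [DecidableEq n] {U : Matrix n n ℝ}
    (hU : U * Uᵀ = 1) {l : n → ℝ} (hl : ∀ i, 0 < l i) : (U * diagonal l * Uᵀ).PosDef := by
  have h : (diagonal l).PosDef := posDef_diagonal_iff.2 hl
  have := h.mul_mul_conjTranspose_same (B := U) (by
    apply Matrix.vecMul_injective_of_isUnit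
    exact ⟨⟨U, Uᵀ, hU, mul_eq_one_comm.1 hU⟩, rfl⟩)
  simpa using this

theorem inv_orthogonal_diagonal {n : Type*} [Fintype n] [DecidableEq n] {U : Matrix n n ℝ}
    (hU : U * Uᵀ = 1) (hU' : Uᵀ * U = 1) {l : n → ℝ} (hl : ∀ i, l i ≠ 0) :
    (U * diagonal l * Uᵀ)⁻¹ = U * diagonal (fun i => (l i)⁻¹) * Uᵀ := by
  apply inv_eq_right_inv
  calc U * diagonal l * Uᵀ * (U * diagonal (fun i => (l i)⁻¹) * Uᵀ)
      = U * (diagonal l * (Uᵀ * U) * diagonal (fun i => (l i)⁻¹)) * Uᵀ := by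
        simp only [Matrix.mul_assoc]
    _ = 1 := by
        rw [hU', Matrix.mul_one, diagonal_mul_diagonal]
        simp [hl, hU]

theorem trace_orthogonal_diagonal {n : Type*} [Fintype n] [DecidableEq n] {U : Matrix n n ℝ}
    (hU' : Uᵀ * U = 1) (l : n → ℝ) : (U * diagonal l * Uᵀ).trace = ∑ i, l i := by
  rw [trace_mul_comm, ← Matrix.mul_assoc, hU', Matrix.one_mul, trace_diagonal]

/-- Moving the lower barrier by `1`, in terms of the potential `tr M⁻¹`, where `M` is the distance
of the current form to the barrier. The increase `δ` of the potential satisfies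
`δ (1 + δ) ≤ tr (M - 1)⁻²`, which `barrier_step` compares with the gain of a rank one update. -/
theorem barrier_shift {n : Type*} [Fintype n] [DecidableEq n] {M : Matrix n n ℝ}
    (hM : M.PosDef) (htr : M⁻¹.trace ≤ 1 / 4) :
    (M - 1).PosDef ∧ M⁻¹.trace ≤ (M - 1)⁻¹.trace ∧
      ((M - 1)⁻¹.trace - M⁻¹.trace) * (1 + ((M - 1)⁻¹.trace - M⁻¹.trace)) ≤
        ((M - 1)⁻¹ * (M - 1)⁻¹).trace := by
  obtain ⟨U, l, hU, hU', hl, rfl⟩ := exists_orthogonal_diagonal hM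
  rw [inv_orthogonal_diagonal hU hU' (fun i => (hl i).ne'), trace_orthogonal_diagonal hU'] at *
  have hl4 : ∀ i, 4 ≤ l i := fun i => by
    have := Finset.single_le_sum (f := fun i => (l i)⁻¹) (fun i _ => (inv_pos.2 (hl i)).le)
      (Finset.mem_univ i)
    have h2 : (l i)⁻¹ ≤ 4⁻¹ := by norm_num at *; linarith
    exact (inv_le_inv₀ (hl i) (by norm_num)).1 h2
  have hsub : U * Matrix.diagonal l * U.transpose - 1 =
      U * Matrix.diagonal (fun i => l i - 1) * U.transpose := by
    have : Matrix.diagonal (fun i => l i - 1) = Matrix.diagonal l - 1 := by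
      ext i j; by_cases h : i = j <;> simp [Matrix.diagonal, h]
    rw [this, Matrix.mul_sub, Matrix.sub_mul, Matrix.mul_one, hU]
  have hpos : ∀ i, 0 < l i - 1 := fun i => by linarith [hl4 i]
  rw [hsub, inv_orthogonal_diagonal hU hU' (fun i => (hpos i).ne')]
  have hsq : (U * Matrix.diagonal (fun i => (l i - 1)⁻¹) * U.transpose) *
      (U * Matrix.diagonal (fun i => (l i - 1)⁻¹) * U.transpose) =
      U * Matrix.diagonal (fun i => (l i - 1)⁻¹ ^ 2) * U.transpose := by
    calc _ = U * (Matrix.diagonal (fun i => (l i - 1)⁻¹) * (U.transpose * U) *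
        Matrix.diagonal (fun i => (l i - 1)⁻¹)) * U.transpose := by simp only [Matrix.mul_assoc]
      _ = _ := by
        rw [hU', Matrix.mul_one, Matrix.diagonal_mul_diagonal]
        simp only [sq]
  rw [hsq]
  simp only [trace_orthogonal_diagonal hU']
  set x := fun i => (l i)⁻¹ with hx
  set y := fun i => (l i - 1)⁻¹ with hy
  have hxy : ∀ i, y i - x i = x i * y i := fun i => by
    have := (hl i).ne'; have := (hpos i).ne'
    simp only [hx, hy]; field_simp; ring
  have hx0 : ∀ i, 0 ≤ x i := fun i => (inv_pos.2 (hl i)).le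
  have hy0 : ∀ i, 0 ≤ y i := fun i => (inv_pos.2 (hpos i)).le
  have hD : ∑ i, y i - ∑ i, x i = ∑ i, x i * y i := by
    rw [← Finset.sum_sub_distrib]; exact Finset.sum_congr rfl fun i _ => hxy i
  have hD0 : 0 ≤ ∑ i, x i * y i := Finset.sum_nonneg fun i _ => mul_nonneg (hx0 i) (hy0 i)
  refine ⟨posDef_orthogonal_diagonal hU hpos, by linarith, ?_⟩
  rw [hD]
  have hcs : (∑ i, x i * y i) ^ 2 ≤ (∑ i, x i) * ∑ i, x i * y i ^ 2 := by
    apply Finset.sum_sq_le_sum_mul_sum_of_sq_le_mul _ (fun i _ => hx0 i)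
      (fun i _ => mul_nonneg (hx0 i) (sq_nonneg _))
    intro i _; apply le_of_eq; ring
  have hS0 : 0 ≤ ∑ i, x i * y i ^ 2 := Finset.sum_nonneg fun i _ => mul_nonneg (hx0 i) (sq_nonneg _)
  have hsum : ∑ i, y i ^ 2 = ∑ i, x i * y i + ∑ i, x i * y i ^ 2 := by
    rw [← Finset.sum_add_distrib]
    refine Finset.sum_congr rfl fun i _ => ?_
    linear_combination y i * hxy i
  rw [hsum]
  have : ∑ i, x i ≤ 1 := by linarith
  nlinarith

/-- The effect of a rank one update on the potential `tr M⁻¹`. -/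
theorem sherman_morrison {n : Type*} [Fintype n] [DecidableEq n] {M : Matrix n n ℝ}
    (hM : M.PosDef) (v : n → ℝ) {t : ℝ} (ht : 0 ≤ t) :
    (M + t • vecMulVec v v).PosDef ∧ (M + t • vecMulVec v v)⁻¹.trace =
      M⁻¹.trace - t * (v ⬝ᵥ (M⁻¹ * M⁻¹) *ᵥ v) / (1 + t * (v ⬝ᵥ M⁻¹ *ᵥ v)) := by
  have hP : M⁻¹.PosDef := hM.inv
  have hg : 0 ≤ v ⬝ᵥ M⁻¹ *ᵥ v := by simpa using hP.posSemidef.dotProduct_mulVec_nonneg v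
  have hden : (1 + t * (v ⬝ᵥ M⁻¹ *ᵥ v)) ≠ 0 := by positivity
  have hvv : (vecMulVec v v).PosSemidef := by simpa using posSemidef_vecMulVec_self_star v
  have hsymm : M⁻¹ᵀ = M⁻¹ := by simpa using hP.1.eq
  have hdet : IsUnit M.det := hM.det_pos.ne'.isUnit
  refine ⟨hM.add_posSemidef (hvv.smul ht), ?_⟩
  have hinv : (M + t • vecMulVec v v)⁻¹ = M⁻¹ -
      (t / (1 + t * (v ⬝ᵥ M⁻¹ *ᵥ v))) • vecMulVec (M⁻¹ *ᵥ v) (M⁻¹ *ᵥ v) := by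
    apply inv_eq_right_inv
    have e1 : M * vecMulVec (M⁻¹ *ᵥ v) (M⁻¹ *ᵥ v) = vecMulVec v (M⁻¹ *ᵥ v) := by
      rw [mul_vecMulVec, mulVec_mulVec, mul_nonsing_inv _ hdet, one_mulVec]
    have e2 : vecMulVec v v * M⁻¹ = vecMulVec v (M⁻¹ *ᵥ v) := by
      rw [vecMulVec_mul, ← mulVec_transpose, hsymm]
    have e3 : vecMulVec v v * vecMulVec (M⁻¹ *ᵥ v) (M⁻¹ *ᵥ v) =
        (v ⬝ᵥ M⁻¹ *ᵥ v) • vecMulVec v (M⁻¹ *ᵥ v) := by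
      rw [vecMulVec_mul_vecMulVec]
      ext i j; simp [vecMulVec_apply]; ring
    rw [Matrix.add_mul, Matrix.mul_sub, Matrix.mul_sub, Matrix.mul_smul, Matrix.smul_mul,
      Matrix.smul_mul, Matrix.mul_smul, e1, e2, e3, mul_nonsing_inv _ hdet]
    have : t • vecMulVec v (M⁻¹ *ᵥ v) - t • (t / (1 + t * (v ⬝ᵥ M⁻¹ *ᵥ v))) •
        (v ⬝ᵥ M⁻¹ *ᵥ v) • vecMulVec v (M⁻¹ *ᵥ v) =
        (t / (1 + t * (v ⬝ᵥ M⁻¹ *ᵥ v))) • vecMulVec v (M⁻¹ *ᵥ v) := by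
      rw [smul_smul, smul_smul, ← sub_smul]; congr 1; field_simp; ring
    rw [this]; abel
  have htr : (vecMulVec (M⁻¹ *ᵥ v) (M⁻¹ *ᵥ v)).trace = v ⬝ᵥ (M⁻¹ * M⁻¹) *ᵥ v := by
    rw [trace_vecMulVec, ← mulVec_mulVec, dotProduct_mulVec, ← mulVec_transpose, hsymm,
      dotProduct_comm]
  rw [hinv, trace_sub, trace_smul, htr, smul_eq_mul]
  ring

theorem sum_dotProduct_mulVec_isotropic {n ι : Type*} [Fintype n] [DecidableEq n] [Fintype ι]
    {p : ι → ℝ} {v : ι → n → ℝ} (hI : ∑ j, p j • vecMulVec (v j) (v j) = 1) (Q : Matrix n n ℝ) :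
    ∑ j, p j * (v j ⬝ᵥ Q *ᵥ v j) = Q.trace := by
  calc ∑ j, p j * (v j ⬝ᵥ Q *ᵥ v j) = (Q * ∑ j, p j • vecMulVec (v j) (v j)).trace := by
        rw [Matrix.mul_sum, trace_sum]
        refine Finset.sum_congr rfl fun j _ => ?_
        rw [Matrix.mul_smul, trace_smul, mul_vecMulVec, trace_vecMulVec, smul_eq_mul, dotProduct_comm]
    _ = _ := by rw [hI, Matrix.mul_one]

/-- The barrier can be moved by `1` without an increase of the potential `tr M⁻¹`, if a suitable
vector of the isotropic family is added with weight `4 / 3`. If every vector failed, then the average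
over the family would contradict `barrier_shift`. -/
theorem barrier_step {n ι : Type*} [Fintype n] [DecidableEq n] [Fintype ι]
    {p : ι → ℝ} {v : ι → n → ℝ} (hp : ∀ j, 0 ≤ p j) (hp1 : ∑ j, p j = 1)
    (hI : ∑ j, p j • vecMulVec (v j) (v j) = 1) {M : Matrix n n ℝ}
    (hM : M.PosDef) (htr : M⁻¹.trace ≤ 1 / 4) :
    ∃ j, (M - 1 + (4 / 3 : ℝ) • vecMulVec (v j) (v j)).PosDef ∧
      (M - 1 + (4 / 3 : ℝ) • vecMulVec (v j) (v j))⁻¹.trace ≤ 1 / 4 := by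
  obtain ⟨hM', hle, hkey⟩ := barrier_shift hM htr
  by_contra! hcon
  have hlt : ∀ j, 4 / 3 * (v j ⬝ᵥ ((M - 1)⁻¹ * (M - 1)⁻¹) *ᵥ v j) <
      ((M - 1)⁻¹.trace - M⁻¹.trace) * (1 + 4 / 3 * (v j ⬝ᵥ (M - 1)⁻¹ *ᵥ v j)) := fun j => by
    obtain ⟨h1, h2⟩ := sherman_morrison hM' (v j) (t := 4 / 3) (by norm_num)
    have h3 := hcon j h1
    rw [h2] at h3
    have hg : 0 ≤ v j ⬝ᵥ (M - 1)⁻¹ *ᵥ v j := by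
      simpa using hM'.inv.posSemidef.dotProduct_mulVec_nonneg (v j)
    rw [← div_lt_iff₀ (by positivity)]
    linarith
  have hex : ∃ j, 0 < p j := by
    by_contra! h
    have : ∑ j, p j ≤ 0 := Finset.sum_nonpos fun j _ => h j
    linarith
  have hsum : ∑ j, p j * (4 / 3 * (v j ⬝ᵥ ((M - 1)⁻¹ * (M - 1)⁻¹) *ᵥ v j)) <
      ∑ j, p j * (((M - 1)⁻¹.trace - M⁻¹.trace) * (1 + 4 / 3 * (v j ⬝ᵥ (M - 1)⁻¹ *ᵥ v j))) := by
    apply Finset.sum_lt_sum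
    · exact fun j _ => mul_le_mul_of_nonneg_left (hlt j).le (hp j)
    · obtain ⟨j, hj⟩ := hex
      exact ⟨j, Finset.mem_univ _, mul_lt_mul_of_pos_left (hlt j) hj⟩
  have e1 : ∑ j, p j * (4 / 3 * (v j ⬝ᵥ ((M - 1)⁻¹ * (M - 1)⁻¹) *ᵥ v j)) =
      4 / 3 * ((M - 1)⁻¹ * (M - 1)⁻¹).trace := by
    rw [← sum_dotProduct_mulVec_isotropic hI, Finset.mul_sum]
    exact Finset.sum_congr rfl fun j _ => by ring
  have e2 : ∑ j, p j * (((M - 1)⁻¹.trace - M⁻¹.trace) * (1 + 4 / 3 * (v j ⬝ᵥ (M - 1)⁻¹ *ᵥ v j))) =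
      ((M - 1)⁻¹.trace - M⁻¹.trace) * (1 + 4 / 3 * (M - 1)⁻¹.trace) := by
    rw [← sum_dotProduct_mulVec_isotropic hI (M - 1)⁻¹]
    rw [← hp1, Finset.mul_sum, ← Finset.sum_add_distrib, Finset.mul_sum]
    exact Finset.sum_congr rfl fun j _ => by rw [hp1]; ring
  rw [e1, e2] at hsum
  nlinarith

/-- One-sided spectral sparsification of an isotropic distribution, by the barrier method of Batson,
Spielman and Srivastava: the sum of `N` suitable members, with repetition and all with the same
weight, dominates the multiple `(3 / 4) (N - 4 n)` of the Euclidean form. -/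
theorem exists_isotropic_sparsifier {n ι : Type*} [Fintype n] [DecidableEq n] [Nonempty n]
    [Fintype ι]
    {p : ι → ℝ} {v : ι → n → ℝ} (hp : ∀ j, 0 ≤ p j) (hp1 : ∑ j, p j = 1)
    (hI : ∑ j, p j • vecMulVec (v j) (v j) = 1) (N : ℕ) :
    ∃ k : Fin N → ι, ∀ y : n → ℝ,
      ((N : ℝ) - 4 * Fintype.card n) * (y ⬝ᵥ y) ≤ 4 / 3 * ∑ i, (v (k i) ⬝ᵥ y) ^ 2 := by
  have hn : (0 : ℝ) < Fintype.card n := by exact_mod_cast Fintype.card_pos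
  -- the barrier starts at `-4 n` and moves by `1` with each vector that is added
  have key : ∀ N : ℕ, ∃ k : Fin N → ι,
      ((4 * Fintype.card n - N : ℝ) • (1 : Matrix n n ℝ) +
        (4 / 3 : ℝ) • ∑ i, vecMulVec (v (k i)) (v (k i))).PosDef ∧
      ((4 * Fintype.card n - N : ℝ) • (1 : Matrix n n ℝ) +
        (4 / 3 : ℝ) • ∑ i, vecMulVec (v (k i)) (v (k i)))⁻¹.trace ≤ 1 / 4 := by
    intro N
    induction N with
    | zero =>
      refine ⟨Fin.elim0, ?_, ?_⟩
      · simpa using (PosDef.one (n := n) (R := ℝ)).smul (by positivity : (0 : ℝ) < 4 * Fintype.card n)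
      · have : ((4 * Fintype.card n : ℝ) • (1 : Matrix n n ℝ))⁻¹ =
            (4 * Fintype.card n : ℝ)⁻¹ • (1 : Matrix n n ℝ) := by
          apply inv_eq_right_inv
          rw [Matrix.smul_mul, Matrix.mul_smul, smul_smul, mul_inv_cancel₀ (by positivity)]
          simp
        simp only [Finset.univ_eq_empty, Finset.sum_empty, smul_zero, add_zero, Nat.cast_zero,
          sub_zero]
        rw [this, trace_smul, trace_one, smul_eq_mul]
        apply le_of_eq
        field_simp
    | succ N ih =>
      obtain ⟨k, h1, h2⟩ := ih
      obtain ⟨j, h3, h4⟩ := barrier_step hp hp1 hI h1 h2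
      refine ⟨Fin.snoc k j, ?_⟩
      have : ((4 * Fintype.card n - (N + 1 : ℕ) : ℝ) • (1 : Matrix n n ℝ) +
        (4 / 3 : ℝ) • ∑ i, vecMulVec (v ((Fin.snoc k j : Fin (N + 1) → ι) i))
          (v ((Fin.snoc k j : Fin (N + 1) → ι) i))) =
        (4 * Fintype.card n - N : ℝ) • (1 : Matrix n n ℝ) +
        (4 / 3 : ℝ) • ∑ i, vecMulVec (v (k i)) (v (k i)) - 1 +
          (4 / 3 : ℝ) • vecMulVec (v j) (v j) := by
        rw [Fin.sum_univ_castSucc]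
        simp only [Fin.snoc_castSucc, Fin.snoc_last]
        push_cast
        module
      rw [this]
      exact ⟨h3, h4⟩
  obtain ⟨k, hk, -⟩ := key N
  refine ⟨k, fun y => ?_⟩
  have := hk.posSemidef.dotProduct_mulVec_nonneg y
  have e : star y ⬝ᵥ ((4 * Fintype.card n - N : ℝ) • (1 : Matrix n n ℝ) +
        (4 / 3 : ℝ) • ∑ i, vecMulVec (v (k i)) (v (k i))) *ᵥ y =
      (4 * Fintype.card n - N) * (y ⬝ᵥ y) + 4 / 3 * ∑ i, (v (k i) ⬝ᵥ y) ^ 2 := by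
    rw [add_mulVec, dotProduct_add, smul_mulVec, smul_mulVec, one_mulVec, dotProduct_smul,
      dotProduct_smul, sum_mulVec, dotProduct_sum]
    simp only [smul_eq_mul, star_trivial]
    congr 2
    refine Finset.sum_congr rfl fun i _ => ?_
    rw [vecMulVec_mulVec, dotProduct_smul, op_smul_eq_smul, smul_eq_mul, dotProduct_comm y]
    ring
  rw [e] at this
  linarith

theorem dotProduct_sum_vecMulVec_mulVec {n ι : Type*} [Fintype n] [Fintype ι]
    (p : ι → ℝ) (v : ι → n → ℝ) (y : n → ℝ) :
    y ⬝ᵥ (∑ j, p j • vecMulVec (v j) (v j)) *ᵥ y = ∑ j, p j * (v j ⬝ᵥ y) ^ 2 := by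
  rw [sum_mulVec, dotProduct_sum]
  refine Finset.sum_congr rfl fun i _ => ?_
  rw [smul_mulVec, dotProduct_smul, vecMulVec_mulVec, dotProduct_smul, op_smul_eq_smul, smul_eq_mul,
    smul_eq_mul, dotProduct_comm y]
  ring

theorem det_convex_vecMulVec {n : Type*} [Fintype n] [DecidableEq n] {V : Matrix n n ℝ}
    (hV : V.PosDef) (v : n → ℝ) {s : ℝ} (hs : s < 1) :
    ((1 - s) • V + s • vecMulVec v v).det =
      (1 - s) ^ Fintype.card n * V.det * (1 + s / (1 - s) * (v ⬝ᵥ V⁻¹ *ᵥ v)) := by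
  have h1 : (1 - s) ≠ 0 := by linarith
  have e : (1 - s) • V + s • vecMulVec v v =
      (1 - s) • (V + replicateCol Unit ((s / (1 - s)) • v) * replicateRow Unit v) := by
    rw [smul_add]
    congr 1
    ext i j
    simp [vecMulVec_apply, Matrix.mul_apply]
    field_simp
  rw [e, det_smul, det_add_replicateCol_mul_replicateRow hV.det_pos.ne'.isUnit]
  have : ((1 : Matrix Unit Unit ℝ) + replicateRow Unit v * V⁻¹ *
      replicateCol Unit ((s / (1 - s)) • v)).det = 1 + s / (1 - s) * (v ⬝ᵥ V⁻¹ *ᵥ v) := by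
    rw [Matrix.mul_assoc, det_unique]
    simp [Matrix.mul_apply, dotProduct, mulVec, Finset.mul_sum]
  rw [this]; ring

/-- The Kiefer-Wolfowitz theorem: a distribution `p` that maximizes `det (∑ j, p j • v j (v j)ᵀ)` has
leverages at most the dimension. -/
theorem exists_optimal_design {n ι : Type*} [Fintype n] [DecidableEq n] [Fintype ι] [Nonempty n]
    [DecidableEq ι] [Nonempty ι] (v : ι → n → ℝ) (hv : ∀ y, (∀ j, v j ⬝ᵥ y = 0) → y = 0) :
    ∃ p : ι → ℝ, (∀ j, 0 ≤ p j) ∧ ∑ j, p j = 1 ∧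
      (∑ j, p j • vecMulVec (v j) (v j)).PosDef ∧
      ∀ j, v j ⬝ᵥ (∑ j, p j • vecMulVec (v j) (v j))⁻¹ *ᵥ v j ≤ Fintype.card n := by
  set F : (ι → ℝ) → Matrix n n ℝ := fun p => ∑ j, p j • vecMulVec (v j) (v j) with hF
  have hcont : Continuous fun p => (F p).det := by
    apply Continuous.matrix_det
    simp only [hF]
    fun_prop
  have hpsd : ∀ p : ι → ℝ, (∀ j, 0 ≤ p j) → (F p).PosSemidef := fun p hp =>
    posSemidef_sum _ fun j _ => by
      have : (vecMulVec (v j) (v j)).PosSemidef := by simpa using posSemidef_vecMulVec_self_star (v j)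
      exact this.smul (hp j)
  have hcard : (0 : ℝ) < Fintype.card ι := by exact_mod_cast Fintype.card_pos
  have hne : (stdSimplex ℝ ι).Nonempty := ⟨_, single_mem_stdSimplex ℝ (Classical.arbitrary ι)⟩
  obtain ⟨p, hp, hmax⟩ := (isCompact_stdSimplex ℝ ι).exists_isMaxOn hne hcont.continuousOn
  have hunif : (fun _ => (Fintype.card ι : ℝ)⁻¹) ∈ stdSimplex ℝ ι :=
    ⟨fun _ => by positivity, by simp⟩
  have hupd : (F fun _ => (Fintype.card ι : ℝ)⁻¹).PosDef := by
    refine PosDef.of_dotProduct_mulVec_pos (hpsd _ fun _ => by positivity).1 fun y hy => ?_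
    rw [star_trivial, hF, dotProduct_sum_vecMulVec_mulVec]
    refine lt_of_le_of_ne (Finset.sum_nonneg fun j _ => by positivity) fun h0 => hy (hv y fun j => ?_)
    have := (Finset.sum_eq_zero_iff_of_nonneg (fun j _ => by positivity)).1 h0.symm j (Finset.mem_univ _)
    have h2 : (Fintype.card ι : ℝ)⁻¹ ≠ 0 := by positivity
    simpa [h2] using this
  have hdet : 0 < (F p).det := lt_of_lt_of_le hupd.det_pos (hmax hunif)
  have hpd : (F p).PosDef := (hpsd p hp.1).posDef_iff_isUnit.2
    ((Matrix.isUnit_iff_isUnit_det _).2 hdet.ne'.isUnit)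
  refine ⟨p, hp.1, hp.2, hpd, fun j => ?_⟩
  set g := v j ⬝ᵥ (F p)⁻¹ *ᵥ v j with hg
  have hg0 : 0 ≤ g := by simpa using hpd.inv.posSemidef.dotProduct_mulVec_nonneg (v j)
  obtain ⟨m, hm⟩ : ∃ m, Fintype.card n = m + 1 := Nat.exists_eq_succ_of_ne_zero Fintype.card_ne_zero
  -- moving mass `s` to `v j` does not increase the determinant; then let `s → 0`
  have hineq : ∀ s : ℝ, 0 < s → s < 1 → g - (m + 1) ≤ s * (m * (g - 1)) := by
    intro s hs0 hs1
    have hmem : ((1 - s) • p + s • Pi.single j (1 : ℝ)) ∈ stdSimplex ℝ ι :=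
      convex_stdSimplex ℝ ι hp (single_mem_stdSimplex ℝ j) (by linarith) hs0.le (by ring)
    have hFs : F ((1 - s) • p + s • Pi.single j (1 : ℝ)) =
        (1 - s) • F p + s • vecMulVec (v j) (v j) := by
      simp only [hF, Pi.add_apply, Pi.smul_apply, add_smul, Finset.sum_add_distrib, smul_assoc,
        ← Finset.smul_sum]
      congr 2
      simp [Pi.single_apply]
    have h1 : (F ((1 - s) • p + s • Pi.single j (1 : ℝ))).det ≤ (F p).det := hmax hmem
    rw [hFs, det_convex_vecMulVec hpd _ hs1, hm] at h1
    have hs2 : 0 < 1 - s := by linarith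
    have h2 : (1 - s) ^ m * ((1 - s) + s * g) ≤ 1 := by
      have : (1 - s) ^ (m + 1) * (F p).det * (1 + s / (1 - s) * g) =
          (1 - s) ^ m * ((1 - s) + s * g) * (F p).det := by
        field_simp
        ring
      rw [this] at h1
      exact le_of_mul_le_mul_right (by linarith) hdet
    have h3 : 1 + m * (-s) ≤ (1 - s) ^ m := by
      have := one_add_mul_le_pow (a := -s) (by linarith) m
      rwa [← sub_eq_add_neg] at this
    have h4 : (1 + m * (-s)) * ((1 - s) + s * g) ≤ 1 :=
      (mul_le_mul_of_nonneg_right h3 (by positivity)).trans h2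
    have h5 : s * (g - (m + 1)) ≤ s * (s * (m * (g - 1))) := by nlinarith
    exact le_of_mul_le_mul_left h5 hs0
  rw [hm]; push_cast
  have hlim : Filter.Tendsto (fun s : ℝ => s * (m * (g - 1))) (nhdsWithin 0 (Set.Ioi 0)) (nhds 0) := by
    have : Continuous fun s : ℝ => s * (m * (g - 1)) := by fun_prop
    have h := this.tendsto 0
    rw [zero_mul] at h
    exact h.mono_left nhdsWithin_le_nhds
  have : g - (m + 1) ≤ 0 := by
    apply ge_of_tendsto hlim
    filter_upwards [Ioo_mem_nhdsGT (zero_lt_one' ℝ)] with s hs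
    exact hineq s hs.1 hs.2
  linarith

/-- A finite spanning family in dimension `m` has `12 m` members, counted with multiplicity, whose sum
of squares dominates `6 ⟨v, ·⟩ ^ 2` for each vector `v` of the family: the optimal design, made
isotropic by a linear change of variables, and then sparsified. As
`(3 / 4) (12 m - 4 m) = 6 m`, the uniform distribution on these `12 m` members has leverages at
most `2 m`. -/
theorem exists_core_family {n ι : Type*} [Fintype n] [DecidableEq n] [Fintype ι] [Nonempty n]
    [Nonempty ι] (v : ι → n → ℝ) (hv : ∀ y, (∀ j, v j ⬝ᵥ y = 0) → y = 0) :
    ∃ k : Fin (12 * Fintype.card n) → ι, ∀ j y,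
      6 * (v j ⬝ᵥ y) ^ 2 ≤ ∑ i, (v (k i) ⬝ᵥ y) ^ 2 := by
  classical
  obtain ⟨p, hp0, hp1, hpd, hg⟩ := exists_optimal_design v hv
  set V := ∑ j, p j • vecMulVec (v j) (v j) with hV
  obtain ⟨U, l, hU, hU', hl, hUl⟩ := exists_orthogonal_diagonal hpd
  -- `S = V ^ (-1/2)` up to a rotation
  set S := diagonal (fun i => (Real.sqrt (l i))⁻¹) * Uᵀ with hS
  set R := diagonal (fun i => Real.sqrt (l i)) * Uᵀ with hR
  have hsq : ∀ i, Real.sqrt (l i) ≠ 0 := fun i => (Real.sqrt_pos.2 (hl i)).ne'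
  have hRV : Rᵀ * R = V := by
    rw [hR, transpose_mul, transpose_transpose, diagonal_transpose, hUl]
    rw [← Matrix.mul_assoc, Matrix.mul_assoc U, diagonal_mul_diagonal]
    congr 3; ext i; exact Real.mul_self_sqrt (hl i).le
  have hRS : R * Sᵀ = 1 := by
    rw [hR, hS, transpose_mul, transpose_transpose, diagonal_transpose, Matrix.mul_assoc,
      ← Matrix.mul_assoc Uᵀ, hU', Matrix.one_mul, diagonal_mul_diagonal]
    simp [hsq]
  have hSR : Sᵀ * R = 1 := mul_eq_one_comm.1 hRS
  have hSinv : Sᵀ * S = V⁻¹ := by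
    symm
    apply inv_eq_right_inv
    have h1 : Rᵀ * S = 1 := by
      have := congrArg transpose hSR
      rwa [transpose_mul, transpose_transpose, transpose_one] at this
    rw [← hRV, Matrix.mul_assoc, ← Matrix.mul_assoc R, hRS, Matrix.one_mul, h1]
  have hI : ∑ j, p j • vecMulVec (S *ᵥ v j) (S *ᵥ v j) = 1 := by
    have : ∑ j, p j • vecMulVec (S *ᵥ v j) (S *ᵥ v j) = S * V * Sᵀ := by
      rw [hV, Matrix.mul_sum, Matrix.sum_mul]
      refine Finset.sum_congr rfl fun j _ => ?_
      rw [Matrix.mul_smul, Matrix.smul_mul, mul_vecMulVec, vecMulVec_mul, vecMul_transpose]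
    rw [this, ← hRV, ← Matrix.mul_assoc, Matrix.mul_assoc, hRS, Matrix.mul_one]
    have := congrArg transpose hRS
    rwa [transpose_mul, transpose_transpose, transpose_one] at this
  obtain ⟨k, hk⟩ := exists_isotropic_sparsifier hp0 hp1 hI (12 * Fintype.card n)
  refine ⟨k, fun j y => ?_⟩
  have hdot : ∀ j, (S *ᵥ v j) ⬝ᵥ (R *ᵥ y) = v j ⬝ᵥ y := fun j => by
    rw [← vecMul_transpose, ← dotProduct_mulVec, mulVec_mulVec, hSR, one_mulVec]
  have h1 := hk (R *ᵥ y)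
  simp only [hdot] at h1
  have hcs : (v j ⬝ᵥ y) ^ 2 ≤ Fintype.card n * ((R *ᵥ y) ⬝ᵥ (R *ᵥ y)) := by
    have hn : (S *ᵥ v j) ⬝ᵥ (S *ᵥ v j) ≤ Fintype.card n := by
      have := hg j
      rw [← hSinv, ← mulVec_mulVec, dotProduct_mulVec, vecMul_transpose] at this
      exact this
    have h0 : 0 ≤ (R *ᵥ y) ⬝ᵥ (R *ᵥ y) := by
      simpa using dotProduct_star_self_nonneg (R *ᵥ y)
    have hc : ((S *ᵥ v j) ⬝ᵥ (R *ᵥ y)) ^ 2 ≤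
        ((S *ᵥ v j) ⬝ᵥ (S *ᵥ v j)) * ((R *ᵥ y) ⬝ᵥ (R *ᵥ y)) := by
      simp only [dotProduct, ← sq]
      exact Finset.sum_mul_sq_le_sq_mul_sq _ _ _
    rw [hdot] at hc
    exact hc.trans (mul_le_mul_of_nonneg_right hn h0)
  push_cast at h1
  linarith

end QuadraticForms

/-! ### Inverses of information operators and least squares -/

theorem infoOp_apply {d : ℕ} (C : Finset (Act d)) (w : Act d → ℝ) (y : Act d) :
    infoOp C w y = ∑ a ∈ C, (w a * ⟪a, y⟫) • a := by
  simp [infoOp, LinearMap.sum_apply, InnerProductSpace.rankOne_apply, smul_smul]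

theorem inner_infoOp {d : ℕ} (C : Finset (Act d)) (w : Act d → ℝ) (x y : Act d) :
    ⟪x, infoOp C w y⟫ = ∑ a ∈ C, w a * (⟪a, x⟫ * ⟪a, y⟫) := by
  rw [infoOp_apply, inner_sum]
  refine Finset.sum_congr rfl fun a _ => ?_
  rw [real_inner_smul_right, real_inner_comm a x]; ring

theorem infoOp_symm {d : ℕ} (C : Finset (Act d)) (w : Act d → ℝ) (x y : Act d) :
    ⟪infoOp C w x, y⟫ = ⟪x, infoOp C w y⟫ := by
  rw [real_inner_comm, inner_infoOp, inner_infoOp]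
  exact Finset.sum_congr rfl fun a _ => by ring

/-- The range of a symmetric operator contains the vectors that are orthogonal to its kernel, and the
operator restricts to a bijection of its range. -/
theorem exists_range_infoOp_eq {d : ℕ} {C : Finset (Act d)} {w : Act d → ℝ} {b : Act d}
    (hb : ∀ y, infoOp C w y = 0 → ⟪b, y⟫ = 0) :
    ∃ x ∈ LinearMap.range (infoOp C w), infoOp C w x = b := by
  set V := infoOp C w with hV
  have hsymm : V.IsSymmetric := infoOp_symm C w
  have hrange : ∀ b : Act d, (∀ y, V y = 0 → ⟪b, y⟫ = 0) → b ∈ LinearMap.range V := by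
    intro b hb
    rw [← Submodule.orthogonal_orthogonal (LinearMap.range V), Submodule.mem_orthogonal']
    intro y hy
    refine hb y ?_
    rw [← inner_self_eq_zero (𝕜 := ℝ), hsymm]
    exact Submodule.inner_left_of_mem_orthogonal (LinearMap.mem_range_self V (V y)) hy
  obtain ⟨x, hx⟩ := hrange b hb
  -- subtract from `x` its component in the kernel
  obtain ⟨k, hk, r, hr, hkr⟩ := Submodule.exists_add_mem_mem_orthogonal (K := LinearMap.ker V) x
  refine ⟨r, hrange r fun y hy => ?_, ?_⟩
  · exact Submodule.inner_left_of_mem_orthogonal (K := LinearMap.ker V) hy hr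
  · have : V k = 0 := hk
    rw [← hx, hkr, map_add, this, zero_add]

theorem invApply_spec {d : ℕ} {V : Act d →ₗ[ℝ] Act d} {b : Act d}
    (h : ∃ x ∈ LinearMap.range V, V x = b) :
    invApply V b ∈ LinearMap.range V ∧ V (invApply V b) = b := by
  rw [invApply, dif_pos h]
  exact h.choose_spec

/-- The Cauchy-Schwarz inequality for the form of a nonnegative combination of `a aᵀ`. -/
theorem inner_infoOp_sq_le {d : ℕ} {C : Finset (Act d)} {w : Act d → ℝ}
    (hw : ∀ a ∈ C, 0 ≤ w a) (x y : Act d) :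
    ⟪infoOp C w x, y⟫ ^ 2 ≤ ⟪x, infoOp C w x⟫ * ∑ a ∈ C, w a * ⟪a, y⟫ ^ 2 := by
  rw [infoOp_symm, inner_infoOp, inner_infoOp]
  apply Finset.sum_sq_le_sum_mul_sum_of_sq_le_mul
  · exact fun a ha => mul_nonneg (hw a ha) (mul_self_nonneg _)
  · exact fun a ha => mul_nonneg (hw a ha) (sq_nonneg _)
  · intro a _; apply le_of_eq; ring

/-- A bound on the form `⟪α, ·⟫ ^ 2` by the form of `V` bounds `αᵀ V⁻¹ α`. -/
theorem invApply_spec_of_form_le {d : ℕ} {C : Finset (Act d)} {w : Act d → ℝ} {α : Act d}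
    {K : ℝ} (hK : 0 ≤ K) (h : ∀ y, ⟪α, y⟫ ^ 2 ≤ K * ∑ a ∈ C, w a * ⟪a, y⟫ ^ 2) :
    (∃ x ∈ LinearMap.range (infoOp C w), infoOp C w x = α) ∧
      ⟪α, invApply (infoOp C w) α⟫ ≤ K := by
  have hform : ∀ y, ∑ a ∈ C, w a * ⟪a, y⟫ ^ 2 = ⟪y, infoOp C w y⟫ := fun y => by
    rw [inner_infoOp]; exact Finset.sum_congr rfl fun a _ => by ring
  have hex : ∃ x ∈ LinearMap.range (infoOp C w), infoOp C w x = α := by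
    apply exists_range_infoOp_eq
    intro y hy
    have := h y
    rw [hform, hy, inner_zero_right, mul_zero] at this
    exact pow_eq_zero_iff two_ne_zero |>.1 (le_antisymm this (sq_nonneg _))
  refine ⟨hex, ?_⟩
  have h1 := h (invApply (infoOp C w) α)
  rw [hform, (invApply_spec hex).2, real_inner_comm α] at h1
  by_contra! hlt
  nlinarith

/-- The design bound of a core set as a bound of quadratic forms. -/
theorem IsCoreSet.inner_sq_le {d : ℕ} {B : ℝ} {A C : Finset (Act d)} {p : Act d → ℝ}
    (h : IsCoreSet B A C p) {α : Act d} (hα : α ∈ A) (y : Act d) :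
    ⟪α, y⟫ ^ 2 ≤ 2 * spanDim A * ∑ a ∈ C, p a * ⟪a, y⟫ ^ 2 := by
  obtain ⟨-, -, -, hp, -, hg⟩ := h
  obtain ⟨hr, hle⟩ := hg α hα
  have hrange : ∃ x ∈ LinearMap.range (infoOp C p), infoOp C p x = α := by
    apply exists_range_infoOp_eq
    rintro y hy
    obtain ⟨x, rfl⟩ := hr
    rw [infoOp_symm, hy, inner_zero_right]
  obtain ⟨-, hx⟩ := invApply_spec hrange
  have := inner_infoOp_sq_le hp (invApply (infoOp C p) α) y
  rw [hx, real_inner_comm α (invApply _ _)] at this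
  refine this.trans (mul_le_mul_of_nonneg_right hle ?_)
  exact Finset.sum_nonneg fun a ha => mul_nonneg (hp a ha) (sq_nonneg _)

/-- The least squares estimate at an action `α` is linear in the data, with weights
`c a = ⟪a, V⁻¹ α⟫`. A bound `αᵀ V⁻¹ α ≤ K` on `A ⊇ C` bounds the sum of squares of the weights, and,
applied to the actions of `C`, each single weight. The estimate is exact for noiseless data. -/
theorem leastSquares_weights {d : ℕ} {C : Finset (Act d)} {n : Act d → ℕ} {A : Finset (Act d)}
    {K : ℝ} (hK : 0 ≤ K) (hCA : C ⊆ A)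
    (h : ∀ α ∈ A, ∀ y, ⟪α, y⟫ ^ 2 ≤ K * ∑ a ∈ C, (n a : ℝ) * ⟪a, y⟫ ^ 2) {α : Act d} (hα : α ∈ A) :
    ∃ c : Act d → ℝ, (∀ a ∈ C, |c a| ≤ K) ∧ ∑ a ∈ C, (n a : ℝ) * c a ^ 2 ≤ K ∧
      (∀ rhat, ⟪α, leastSquares C n rhat⟫ = ∑ a ∈ C, rhat a * c a) ∧
      ∀ θ, ⟪α, θ⟫ = ∑ a ∈ C, (n a : ℝ) * c a * ⟪a, θ⟫ := by
  set V := infoOp C fun a => (n a : ℝ) with hV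
  obtain ⟨hex, hle⟩ := invApply_spec_of_form_le hK (h α hα)
  obtain ⟨-, hx⟩ := invApply_spec hex
  set x := invApply V α with hxdef
  have hq : ∑ a ∈ C, (n a : ℝ) * ⟪a, x⟫ ^ 2 ≤ K := by
    have : ∑ a ∈ C, (n a : ℝ) * ⟪a, x⟫ ^ 2 = ⟪x, V x⟫ := by
      rw [inner_infoOp]; exact Finset.sum_congr rfl fun a _ => by ring
    rw [this, hx, real_inner_comm]; exact hle
  refine ⟨fun a => ⟪a, x⟫, fun a ha => ?_, hq, fun rhat => ?_, fun θ => ?_⟩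
  · apply abs_le_of_sq_le_sq _ hK
    calc ⟪a, x⟫ ^ 2 ≤ K * ∑ a ∈ C, (n a : ℝ) * ⟪a, x⟫ ^ 2 := h a (hCA ha) x
      _ ≤ K * K := mul_le_mul_of_nonneg_left hq hK
      _ = K ^ 2 := by ring
  · have hex' : ∃ x ∈ LinearMap.range V, V x = ∑ a ∈ C, rhat a • a := by
      apply exists_range_infoOp_eq
      intro y hy
      rw [sum_inner]
      refine Finset.sum_eq_zero fun a ha => ?_
      have h1 := h a (hCA ha) y
      have : ∑ a ∈ C, (n a : ℝ) * ⟪a, y⟫ ^ 2 = ⟪y, V y⟫ := by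
        rw [inner_infoOp]; exact Finset.sum_congr rfl fun a _ => by ring
      rw [this, hV, hy, inner_zero_right, mul_zero] at h1
      rw [real_inner_smul_left, pow_eq_zero_iff two_ne_zero |>.1 (le_antisymm h1 (sq_nonneg _)),
        mul_zero]
    rw [leastSquares]
    conv_lhs => rw [← hx]
    rw [infoOp_symm, ← hV, (invApply_spec hex').2, inner_sum]
    refine Finset.sum_congr rfl fun a _ => ?_
    rw [real_inner_smul_right, real_inner_comm]
  · conv_lhs => rw [← hx]
    rw [infoOp_symm, inner_infoOp]
    exact Finset.sum_congr rfl fun a _ => by ring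

/-! ### Existence of core sets and nets -/

theorem isCoreSet_of_spanDim_eq_zero {d : ℕ} {B : ℝ} (hB : 1 ≤ B) {A : Finset (Act d)}
    (hA : A.Nonempty) (h0 : spanDim A = 0) : IsCoreSet B A A fun _ => 1 := by
  have hsub : ∀ a ∈ A, a = 0 := by
    rw [spanDim, Submodule.finrank_eq_zero, Submodule.span_eq_bot] at h0
    exact h0
  have hA1 : A = {0} := Finset.eq_singleton_iff_nonempty_unique_mem.2 ⟨hA, hsub⟩
  refine ⟨subset_rfl, ?_, rfl, fun _ _ => zero_le_one, ?_, fun a ha => ?_⟩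
  · rw [h0, hA1]; simpa using hB
  · rw [hA1]; simp
  · rw [hsub a ha, inner_zero_left]
    exact ⟨zero_mem _, by positivity⟩

/-- Every finite nonempty set of actions has a core set with at most `12 m` elements. -/
theorem exists_isCoreSet {d : ℕ} {B : ℝ} (hB : 12 ≤ B) {A : Finset (Act d)}
    (hA : A.Nonempty) : ∃ C p, IsCoreSet B A C p := by
  classical
  by_cases h0 : spanDim A = 0
  · exact ⟨A, _, isCoreSet_of_spanDim_eq_zero (by linarith) hA h0⟩
  set W := Submodule.span ℝ (A : Set (Act d)) with hW
  set b := Module.finBasis ℝ W with hb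
  have hmem : ∀ a : A, (a : Act d) ∈ W := fun a => Submodule.subset_span a.2
  -- coordinates of the actions with respect to a basis of the span
  set v : A → Fin (Module.finrank ℝ W) → ℝ := fun a => b.repr ⟨a, hmem a⟩ with hv
  have hm : spanDim A = Module.finrank ℝ W := rfl
  have : Nonempty (Fin (Module.finrank ℝ W)) := ⟨⟨0, Nat.pos_of_ne_zero h0⟩⟩
  have : Nonempty A := ⟨⟨hA.choose, hA.choose_spec⟩⟩
  have hspan : ∀ y, (∀ a, v a ⬝ᵥ y = 0) → y = 0 := by
    intro y hy
    have hz : ∀ (w : Act d) (hw : w ∈ W), (fun i => b.repr ⟨w, hw⟩ i) ⬝ᵥ y = 0 := by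
      intro w hw
      induction hw using Submodule.span_induction with
      | mem x hx => exact hy ⟨x, hx⟩
      | zero =>
        have : (⟨0, Submodule.zero_mem _⟩ : W) = 0 := rfl
        simp [this, dotProduct]
      | add x z hx hz h1 h2 =>
        have : (⟨x + z, Submodule.add_mem _ hx hz⟩ : W) = ⟨x, hx⟩ + ⟨z, hz⟩ := rfl
        simp only [dotProduct] at h1 h2 ⊢
        simp only [this, map_add, Finsupp.add_apply, add_mul, Finset.sum_add_distrib]
        rw [h1, h2, add_zero]
      | smul c x hx h1 =>
        have : (⟨c • x, Submodule.smul_mem _ c hx⟩ : W) = c • ⟨x, hx⟩ := rfl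
        simp only [dotProduct] at h1 ⊢
        simp only [this, map_smul, Finsupp.smul_apply, smul_eq_mul, mul_assoc, ← Finset.mul_sum]
        rw [h1, mul_zero]
    funext i
    have := hz (b i) (b i).2
    simpa [dotProduct, Finsupp.single_apply] using this
  obtain ⟨N, hN⟩ : ∃ N, N = 12 * Module.finrank ℝ W := ⟨_, rfl⟩
  obtain ⟨k, hk⟩ : ∃ k : Fin N → A, ∀ a y,
      6 * (v a ⬝ᵥ y) ^ 2 ≤ ∑ i, (v (k i) ⬝ᵥ y) ^ 2 := by
    have := exists_core_family v hspan
    rwa [Fintype.card_fin, ← hN] at this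
  have hdot : ∀ (a : A) (y : Act d), v a ⬝ᵥ (fun i => ⟪(b i : Act d), y⟫) = ⟪(a : Act d), y⟫ := by
    intro a y
    have h1 : (a : Act d) = ∑ i, v a i • (b i : Act d) := by
      have := congrArg (Subtype.val) (b.sum_repr ⟨a, hmem a⟩)
      rw [AddSubmonoidClass.coe_finsetSum] at this
      exact this.symm
    conv_rhs => rw [h1]
    rw [sum_inner]
    simp only [real_inner_smul_left, dotProduct]
  have hNpos : (0 : ℝ) < N := by
    have : 0 < N := by have := Nat.pos_of_ne_zero h0; omega
    exact_mod_cast this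
  set C : Finset (Act d) := Finset.univ.image fun i => ((k i : A) : Act d) with hC
  -- the uniform distribution on the `N` members, with multiplicity
  set p : Act d → ℝ := fun a => (Finset.univ.filter fun i => ((k i : A) : Act d) = a).card / N with hp
  have hsum : ∀ f : Act d → ℝ, ∑ a ∈ C, p a * f a = (∑ i, f (k i)) / N := fun f => by
    rw [Finset.sum_comp f (fun i => ((k i : A) : Act d)), Finset.sum_div]
    refine Finset.sum_congr rfl fun a _ => ?_
    simp only [hp, nsmul_eq_mul]; ring
  have hp0 : ∀ a ∈ C, 0 ≤ p a := fun a _ => by positivity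
  have hCA : C ⊆ A := by
    intro a ha
    obtain ⟨i, -, rfl⟩ := Finset.mem_image.1 ha
    exact (k i).2
  have hform : ∀ a ∈ A, ∀ y, ⟪a, y⟫ ^ 2 ≤ 2 * spanDim A * ∑ c ∈ C, p c * ⟪c, y⟫ ^ 2 := by
    intro a ha y
    have h1 := hk ⟨a, ha⟩ (fun i => ⟪(b i : Act d), y⟫)
    simp only [hdot] at h1
    rw [hsum fun c => ⟪c, y⟫ ^ 2, mul_div_assoc', le_div_iff₀ hNpos, hm]
    have hN' : (N : ℝ) = 12 * Module.finrank ℝ W := by rw [hN]; push_cast; ring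
    rw [hN']
    have : (0 : ℝ) ≤ Module.finrank ℝ W := by positivity
    nlinarith
  have hdes : ∀ a ∈ A, a ∈ LinearMap.range (infoOp C p) ∧
      ⟪a, invApply (infoOp C p) a⟫ ≤ 2 * (spanDim A : ℝ) := by
    intro a ha
    obtain ⟨⟨x, -, hx⟩, h2⟩ := invApply_spec_of_form_le (by positivity) (hform a ha)
    exact ⟨⟨x, hx⟩, h2⟩
  refine ⟨C, p, hCA, ?_, ?_, hp0, ?_, hdes⟩
  · have h1 : C.card ≤ N := by
      simpa using Finset.card_image_le (s := Finset.univ) (f := fun i => ((k i : A) : Act d))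
    have h2 : max 1 (spanDim A) = Module.finrank ℝ W := by rw [hm]; omega
    rw [h2]
    calc (C.card : ℝ) ≤ N := by exact_mod_cast h1
      _ = 12 * Module.finrank ℝ W := by rw [hN]; push_cast; ring
      _ ≤ _ := by gcongr
  · apply le_antisymm (Submodule.span_mono hCA)
    rw [Submodule.span_le]
    intro a ha
    obtain ⟨x, hx⟩ := (hdes a ha).1
    rw [← hx, infoOp_apply]
    exact Submodule.sum_mem _ fun c hc => Submodule.smul_mem _ _ (Submodule.subset_span hc)
  · have := hsum fun _ => 1
    simp only [mul_one, Finset.sum_const, Finset.card_univ, Fintype.card_fin, nsmul_eq_mul] at this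
    rw [this, div_self hNpos.ne']

/-- A `ζ`-separated subset of the unit ball has at most `(3 / ζ) ^ d` elements: the balls of radius
`ζ / 2` around them are disjoint subsets of the ball of radius `1 + ζ / 2 ≤ 3 / 2`. -/
theorem card_le_of_pairwise_dist {d : ℕ} {s : Finset (Act d)} {ζ : ℝ} (hζ : 0 < ζ) (hζ1 : ζ ≤ 1)
    (hs : ∀ a ∈ s, ‖a‖ ≤ 1) (hsep : ∀ a ∈ s, ∀ b ∈ s, a ≠ b → ζ < dist a b) :
    (s.card : ℝ) ≤ (3 / ζ) ^ d := by
  set μ : Measure (Act d) := volume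
  have hdisj : (s : Set (Act d)).Pairwise (Function.onFun Disjoint fun a => Metric.ball a (ζ / 2)) := by
    intro a ha b hb hab
    apply Metric.ball_disjoint_ball
    linarith [hsep a ha b hb hab]
  have hsub : (⋃ a ∈ s, Metric.ball a (ζ / 2)) ⊆ Metric.ball (0 : Act d) (1 + ζ / 2) := by
    refine Set.iUnion₂_subset fun a ha x hx => ?_
    rw [mem_ball_zero_iff]
    rw [Metric.mem_ball, dist_eq_norm] at hx
    calc ‖x‖ = ‖(x - a) + a‖ := by simp
      _ ≤ ‖x - a‖ + ‖a‖ := norm_add_le _ _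
      _ < _ := by linarith [hs a ha]
  have h1 : μ (⋃ a ∈ s, Metric.ball a (ζ / 2)) ≤ μ (Metric.ball (0 : Act d) (1 + ζ / 2)) :=
    measure_mono hsub
  rw [measure_biUnion_finset hdisj fun a _ => Metric.isOpen_ball.measurableSet] at h1
  simp only [Measure.addHaar_ball_of_pos μ _ (half_pos hζ),
    Measure.addHaar_ball_of_pos μ _ (by positivity : 0 < 1 + ζ / 2), Finset.sum_const,
    nsmul_eq_mul, ← mul_assoc] at h1
  have hb0 : μ (Metric.ball 0 1) ≠ 0 := (Metric.measure_ball_pos μ _ one_pos).ne'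
  have hb1 : μ (Metric.ball 0 1) ≠ ⊤ := measure_ball_lt_top.ne
  rw [ENNReal.mul_le_mul_iff_left hb0 hb1, finrank_euclideanSpace_fin, ← ENNReal.ofReal_natCast,
    ← ENNReal.ofReal_mul (by positivity), ENNReal.ofReal_le_ofReal_iff (by positivity)] at h1
  have h2 : (1 + ζ / 2) ^ d ≤ ((3 / ζ) * (ζ / 2)) ^ d := by
    apply pow_le_pow_left₀ (by positivity)
    field_simp; linarith
  rw [mul_pow] at h2
  exact le_of_mul_le_mul_right (h1.trans h2) (by positivity)

/-- Nets exist: a maximal separated subset, completed by a basis of the span. -/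
theorem exists_isNet {d : ℕ} {𝒜 : Set (Act d)} (h𝒜 : ∀ a ∈ 𝒜, ‖a‖ ≤ 1) {ζ : ℝ} (hζ : 0 < ζ)
    (hζ1 : ζ ≤ 1) : ∃ N : Finset (Act d), IsNet 𝒜 ζ N := by
  classical
  let S : Set ℕ := {n | ∃ s : Finset (Act d), (s : Set (Act d)) ⊆ 𝒜 ∧
    (∀ a ∈ s, ∀ b ∈ s, a ≠ b → ζ < dist a b) ∧ s.card = n}
  have hbd : BddAbove S := by
    refine ⟨⌊(3 / ζ) ^ d⌋₊, ?_⟩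
    rintro n ⟨s, h1, h2, rfl⟩
    exact Nat.le_floor (card_le_of_pairwise_dist hζ hζ1 (fun a ha => h𝒜 a (h1 ha)) h2)
  obtain ⟨s, hs1, hs2, hs3⟩ : sSup S ∈ S := Nat.sSup_mem ⟨0, ∅, by simp⟩ hbd
  obtain ⟨t, ht1, ht2, ht3⟩ := exists_linearIndependent ℝ 𝒜
  have htf : t.Finite := ht3.setFinite
  have htc : htf.toFinset.card ≤ d := by
    have := htf.fintype
    have := ht3.fintype_card_le_finrank
    rwa [finrank_euclideanSpace_fin, ← Set.toFinset_card, ← htf.toFinset_eq_toFinset] at this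
  refine ⟨s ∪ htf.toFinset, ?_, ?_, ?_, ?_⟩
  · intro a ha
    rcases Finset.mem_union.1 ha with h | h
    · exact hs1 h
    · exact ht1 (htf.mem_toFinset.1 h)
  · intro a ha
    -- a point far from the net could be added to the maximal separated set
    by_contra! hcon
    have hnot : a ∉ s := fun has => by
      have := hcon a (Finset.mem_union_left _ has)
      simp at this; linarith
    have hfar : ∀ b ∈ s, ζ < dist b a := fun b hb => by
      rw [dist_eq_norm]; exact hcon b (Finset.mem_union_left _ hb)
    have hmem : s.card + 1 ∈ S := by
      refine ⟨insert a s, ?_, ?_, Finset.card_insert_of_notMem hnot⟩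
      · rw [Finset.coe_insert]; exact Set.insert_subset ha hs1
      · intro x hx y hy hxy
        rcases Finset.mem_insert.1 hx with rfl | hx' <;> rcases Finset.mem_insert.1 hy with rfl | hy'
        · exact absurd rfl hxy
        · rw [dist_comm]; exact hfar y hy'
        · exact hfar x hx'
        · exact hs2 x hx' y hy' hxy
    have := le_csSup hbd hmem
    omega
  · apply le_antisymm
    · apply Submodule.span_mono
      intro a ha
      rcases Finset.mem_union.1 ha with h | h
      · exact hs1 h
      · exact ht1 (htf.mem_toFinset.1 h)
    · rw [← ht2]
      apply Submodule.span_mono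
      intro a ha
      exact Finset.mem_union_right _ (htf.mem_toFinset.2 ha)
  · have h1 : (s.card : ℝ) ≤ (3 / ζ) ^ d :=
      card_le_of_pairwise_dist hζ hζ1 (fun a ha => h𝒜 a (hs1 ha)) hs2
    have h2 : ((s ∪ htf.toFinset).card : ℝ) ≤ s.card + htf.toFinset.card := by
      exact_mod_cast Finset.card_union_le _ _
    have h3 : (htf.toFinset.card : ℝ) ≤ d := by exact_mod_cast htc
    linarith

theorem exists_list_count {α : Type*} [DecidableEq α] (C : Finset α) (n : α → ℕ) :
    ∃ l : List α, ∀ a, l.count a = if a ∈ C then n a else 0 := by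
  refine ⟨(∑ a ∈ C, Multiset.replicate (n a) a).toList, fun a => ?_⟩
  rw [← Multiset.coe_count, Multiset.coe_toList, Multiset.count_sum']
  simp [Multiset.count_replicate]

theorem exists_admissible {d : ℕ} {B : ℝ} (hB : 12 ≤ B) {𝒜 : Set (Act d)}
    (h𝒜 : ∀ a ∈ 𝒜, ‖a‖ ≤ 1) {T : ℕ} (hT : 2 ≤ T) : ∃ S : Choices d, S.Admissible B 𝒜 T := by
  classical
  have hT' : (2 : ℝ) ≤ T := by exact_mod_cast hT
  obtain ⟨N, hN⟩ := exists_isNet h𝒜 (ζ := 1 / (T : ℝ)) (by positivity)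
    (by rw [div_le_one (by linarith)]; linarith)
  have hcore : ∀ A : Finset (Act d), ∃ Cp : Finset (Act d) × (Act d → ℝ), A.Nonempty →
      IsCoreSet B A Cp.1 Cp.2 := fun A => by
    by_cases hA : A.Nonempty
    · obtain ⟨C, p, h⟩ := exists_isCoreSet hB hA
      exact ⟨(C, p), fun _ => h⟩
    · exact ⟨(∅, 0), fun h => absurd h hA⟩
  choose F hF using hcore
  have hlist : ∀ (i : ℕ) (A : Finset (Act d)), ∃ l : List (Act d), ∀ a,
      l.count a = if a ∈ (F A).1 then ⌈(F A).2 a * growth T ^ i⌉₊ else 0 := fun i A =>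
    exists_list_count _ _
  choose G hG using hlist
  refine ⟨⟨N, fun _ A => (F A).1, fun _ A => (F A).2, G,
    fun A => if h : A.Nonempty then h.choose else 0⟩, hN, fun i _ A _ hA => hF A hA, ?_, ?_⟩
  · intro i _ A _ _ a
    convert hG i A a
    rfl
  · intro A _ hA
    simp only [dif_pos hA]
    exact hA.choose_spec

/-! ### Batches and the states of the learner -/

theorem growth_pos {T : ℕ} (hT : 2 ≤ T) : 0 < growth T :=
  Real.rpow_pos_of_pos (by have : (2 : ℝ) ≤ T := by exact_mod_cast hT
                           linarith) _

section Batches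

variable {d T : ℕ} {B : ℝ} {𝒜 : Set (Act d)} {S : Choices d}

theorem Choices.Admissible.net_nonempty (hS : S.Admissible B 𝒜 T) (h𝒜 : 𝒜.Nonempty) :
    S.net.Nonempty := by
  obtain ⟨a, ha⟩ := h𝒜
  obtain ⟨a', ha', -⟩ := hS.net_spec.2.1 a ha
  exact ⟨a', ha'⟩

theorem IsCoreSet.nonempty {A C : Finset (Act d)} {p : Act d → ℝ} (h : IsCoreSet B A C p) :
    C.Nonempty := by
  rw [Finset.nonempty_iff_ne_empty]
  rintro rfl
  simpa using h.2.2.2.2.1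

/-- A core set spans, so it has at least `max 1 m` elements; hence admissible choices exist only for
`1 ≤ B`. -/
theorem Choices.Admissible.one_le (hS : S.Admissible B 𝒜 T) (h𝒜 : 𝒜.Nonempty) : 1 ≤ B := by
  have h := hS.core_spec 1 le_rfl S.net subset_rfl (hS.net_nonempty h𝒜)
  have h1 : max 1 (spanDim S.net) ≤ (S.core 1 S.net).card := by
    refine max_le h.nonempty.card_pos ?_
    rw [spanDim, ← h.2.2.1]
    exact finrank_span_finset_le_card _
  have h2 : ((max 1 (spanDim S.net) : ℕ) : ℝ) ≤ B * (max 1 (spanDim S.net) : ℕ) :=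
    (Nat.cast_le.2 h1).trans h.2.1
  have h3 : (1 : ℝ) ≤ ((max 1 (spanDim S.net) : ℕ) : ℝ) := by exact_mod_cast le_max_left _ _
  by_contra! hB
  nlinarith

theorem spanDim_le (A : Finset (Act d)) : spanDim A ≤ d := by
  have := Submodule.finrank_le (Submodule.span ℝ (A : Set (Act d)))
  rwa [finrank_euclideanSpace_fin] at this

variable {i : ℕ} {A : Finset (Act d)}

theorem Choices.Admissible.mem_core_of_mem_pulls (hS : S.Admissible B 𝒜 T) (hi : 1 ≤ i)
    (hA : A ⊆ S.net) (hA' : A.Nonempty) {a : Act d} (ha : a ∈ S.pulls i A) : a ∈ S.core i A := by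
  classical
  have := hS.pulls_spec i hi A hA hA' a
  by_contra hcon
  rw [if_neg hcon, List.count_eq_zero] at this
  exact this ha

theorem Choices.Admissible.core_subset (hS : S.Admissible B 𝒜 T) (hi : 1 ≤ i)
    (hA : A ⊆ S.net) (hA' : A.Nonempty) : S.core i A ⊆ A :=
  (hS.core_spec i hi A hA hA').1

open Classical in
theorem Choices.Admissible.count_pulls (hS : S.Admissible B 𝒜 T) (hi : 1 ≤ i)
    (hA : A ⊆ S.net) (hA' : A.Nonempty) {a : Act d} (ha : a ∈ S.core i A) :
    (S.pulls i A).count a = S.numPulls T i A a := by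
  have := hS.pulls_spec i hi A hA hA' a
  rw [if_pos ha] at this
  exact this

theorem Choices.Admissible.length_pulls (hS : S.Admissible B 𝒜 T) (hi : 1 ≤ i)
    (hA : A ⊆ S.net) (hA' : A.Nonempty) :
    (S.pulls i A).length = ∑ a ∈ S.core i A, S.numPulls T i A a := by
  classical
  rw [← Multiset.coe_card, ← Multiset.sum_count_eq_card (s := S.core i A)]
  · refine Finset.sum_congr rfl fun a ha => ?_
    rw [Multiset.coe_count]
    convert hS.count_pulls hi hA hA' ha
  · exact fun a ha => hS.mem_core_of_mem_pulls hi hA hA' ha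

theorem Choices.weight_mul_growth_le (S : Choices d) (a : Act d) :
    S.weight i A a * growth T ^ i ≤ S.numPulls T i A a := Nat.le_ceil _

theorem Choices.Admissible.growth_pow_le_length_pulls (hS : S.Admissible B 𝒜 T) (hi : 1 ≤ i)
    (hA : A ⊆ S.net) (hA' : A.Nonempty) : growth T ^ i ≤ (S.pulls i A).length := by
  rw [hS.length_pulls hi hA hA']
  have h := (hS.core_spec i hi A hA hA').2.2.2.2.1
  push_cast
  calc growth T ^ i = ∑ a ∈ S.core i A, S.weight i A a * growth T ^ i := by
        rw [← Finset.sum_mul, h, one_mul]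
    _ ≤ _ := Finset.sum_le_sum fun a _ => S.weight_mul_growth_le a

theorem Choices.Admissible.length_pulls_le (hS : S.Admissible B 𝒜 T) (hT : 2 ≤ T) (hi : 1 ≤ i)
    (hA : A ⊆ S.net) (hA' : A.Nonempty) :
    ((S.pulls i A).length : ℝ) ≤ growth T ^ i + B * (max 1 (spanDim A) : ℕ) := by
  have h := hS.core_spec i hi A hA hA'
  rw [hS.length_pulls hi hA hA']
  push_cast
  calc ∑ a ∈ S.core i A, (S.numPulls T i A a : ℝ)
      ≤ ∑ a ∈ S.core i A, (S.weight i A a * growth T ^ i + 1) :=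
        Finset.sum_le_sum fun a ha => (Nat.ceil_lt_add_one (mul_nonneg (h.2.2.2.1 a ha)
          (pow_nonneg (growth_pos hT).le _))).le
    _ = growth T ^ i + (S.core i A).card := by
        rw [Finset.sum_add_distrib, ← Finset.sum_mul, h.2.2.2.2.1]; simp
    _ ≤ _ := by
      have := h.2.1
      push_cast at this
      gcongr

theorem Choices.Admissible.length_pulls_pos (hS : S.Admissible B 𝒜 T) (hT : 2 ≤ T) (hi : 1 ≤ i)
    (hA : A ⊆ S.net) (hA' : A.Nonempty) : 0 < (S.pulls i A).length := by
  have := hS.growth_pow_le_length_pulls hi hA hA'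
  have h2 := pow_pos (growth_pos hT) i
  have : (0 : ℝ) < (S.pulls i A).length := by linarith
  exact_mod_cast this

/-- The design of a batch: `αᵀ V_i⁻¹ α ≤ 2 d / q ^ i` for all actions `α` of the good set, stated as a
bound of quadratic forms. -/
theorem Choices.Admissible.inner_sq_le (hS : S.Admissible B 𝒜 T) (hT : 2 ≤ T) (hi : 1 ≤ i)
    (hA : A ⊆ S.net) (hA' : A.Nonempty) {α : Act d} (hα : α ∈ A) (y : Act d) :
    ⟪α, y⟫ ^ 2 ≤ 2 * d / growth T ^ i *
      ∑ a ∈ S.core i A, (S.numPulls T i A a : ℝ) * ⟪a, y⟫ ^ 2 := by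
  have hq := pow_pos (growth_pos hT) i
  have h := hS.core_spec i hi A hA hA'
  have hsum0 : 0 ≤ ∑ a ∈ S.core i A, S.weight i A a * ⟪a, y⟫ ^ 2 :=
    Finset.sum_nonneg fun a ha => mul_nonneg (h.2.2.2.1 a ha) (sq_nonneg _)
  calc ⟪α, y⟫ ^ 2 ≤ 2 * spanDim A * ∑ a ∈ S.core i A, S.weight i A a * ⟪a, y⟫ ^ 2 :=
        h.inner_sq_le hα y
    _ ≤ 2 * d * ∑ a ∈ S.core i A, S.weight i A a * ⟪a, y⟫ ^ 2 := by
        have : (spanDim A : ℝ) ≤ d := by exact_mod_cast spanDim_le A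
        gcongr
    _ = 2 * d / growth T ^ i *
        ∑ a ∈ S.core i A, S.weight i A a * growth T ^ i * ⟪a, y⟫ ^ 2 := by
        rw [div_mul_eq_mul_div, mul_div_assoc, Finset.sum_div]
        congr 1
        refine Finset.sum_congr rfl fun a _ => ?_
        field_simp
    _ ≤ _ := by
        gcongr with a ha
        exact S.weight_mul_growth_le a

theorem confWidth_nonneg {b : ℝ} (hT : 2 ≤ T) (hB : 0 ≤ B) (hb : 0 ≤ b) (hA' : A.Nonempty) :
    0 ≤ confWidth d T B b i A := by
  have hq := pow_pos (growth_pos hT) i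
  have hc : (1 : ℝ) ≤ A.card := by exact_mod_cast hA'.card_pos
  have hT' : (2 : ℝ) ≤ T := by exact_mod_cast hT
  have hL : 0 ≤ Real.log (4 * A.card * (T : ℝ) ^ 2) := by
    apply Real.log_nonneg
    nlinarith [sq_nonneg (T : ℝ)]
  unfold confWidth
  positivity

end Batches

/-- The estimate `θ̂` of the batch `i` that starts in the state `s`. -/
noncomputable def Choices.estimate {d : ℕ} (S : Choices d) (T : ℕ) (rew : ℕ → ℝ)
    (z : ℕ → Act d → ℝ) (i : ℕ) (s : LearnerState d) : Act d :=
  leastSquares (S.core i s.good) (S.numPulls T i s.good)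
    (privSum rew z s.played.length (S.pulls i s.good))

/-- An invariant of the states of the learner: all actions come from the net, and the good set and the
set of maximizers are not empty. The states with this property are countably many. -/
structure Choices.Reachable {d : ℕ} (S : Choices d) (s : LearnerState d) : Prop where
  good_subset : s.good ⊆ S.net
  good_nonempty : s.good.Nonempty
  best_subset : s.best ⊆ S.net
  best_nonempty : s.best.Nonempty
  played_mem : ∀ a ∈ s.played, a ∈ S.net

section States

variable {d T : ℕ} {B b : ℝ} {𝒜 : Set (Act d)} {S : Choices d}

theorem Choices.Admissible.reachable_stateAfter (hS : S.Admissible B 𝒜 T) (h𝒜 : 𝒜.Nonempty)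
    (hT : 2 ≤ T) (hb : 0 ≤ b) (rew : ℕ → ℝ) (z : ℕ → Act d → ℝ) (j : ℕ) :
    S.Reachable (S.stateAfter T B b rew z j) := by
  classical
  induction j with
  | zero =>
    have := hS.net_nonempty h𝒜
    exact ⟨subset_rfl, this, subset_rfl, this, by simp [Choices.stateAfter]⟩
  | succ j ih =>
    set s := S.stateAfter T B b rew z j with hs
    have e : S.stateAfter T B b rew z (j + 1) = S.batch T B b rew z (j + 1) s := rfl
    rw [e]
    obtain ⟨a₀, ha₀, hmax⟩ := s.good.exists_max_image
      (fun a => ⟪a, S.estimate T rew z (j + 1) s⟫) ih.good_nonempty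
    have hγ := confWidth_nonneg (d := d) (i := j + 1) hT (zero_le_one.trans (hS.one_le h𝒜)) hb
      ih.good_nonempty
    refine ⟨(Finset.filter_subset _ _).trans ih.good_subset, ⟨a₀, ?_⟩,
      (Finset.filter_subset _ _).trans ih.good_subset, ⟨a₀, ?_⟩, ?_⟩
    · refine Finset.mem_filter.2 ⟨ha₀, fun α hα => ?_⟩
      have := hmax α hα
      simp only [Choices.estimate] at this
      linarith
    · exact Finset.mem_filter.2 ⟨ha₀, hmax⟩
    · intro a ha
      rcases List.mem_append.1 ha with h | h
      · exact ih.played_mem a h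
      · exact ih.good_subset (hS.core_subset (by omega) ih.good_subset ih.good_nonempty
          (hS.mem_core_of_mem_pulls (by omega) ih.good_subset ih.good_nonempty h))

theorem Choices.Admissible.strictMono_length_played (hS : S.Admissible B 𝒜 T) (h𝒜 : 𝒜.Nonempty)
    (hT : 2 ≤ T) (hb : 0 ≤ b) (rew : ℕ → ℝ) (z : ℕ → Act d → ℝ) :
    StrictMono fun j => (S.stateAfter T B b rew z j).played.length := by
  refine strictMono_nat_of_lt_succ fun j => ?_
  have h := hS.reachable_stateAfter h𝒜 hT hb rew z j
  have := hS.length_pulls_pos hT (i := j + 1) (by omega) h.good_subset h.good_nonempty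
  show _ < ((S.stateAfter T B b rew z j).played ++ S.pulls (j + 1) _).length
  rw [List.length_append]
  omega

theorem Choices.countable_reachable (S : Choices d) : {s | S.Reachable s}.Countable := by
  classical
  let f : List S.net × Finset S.net × Finset S.net → LearnerState d := fun x =>
    ⟨x.1.map Subtype.val, x.2.1.map (Function.Embedding.subtype _),
      x.2.2.map (Function.Embedding.subtype _)⟩
  refine (Set.countable_range f).mono fun s hs => ?_
  refine ⟨(s.played.attach.map fun a => ⟨a.1, hs.played_mem a.1 a.2⟩,
    s.good.subtype (· ∈ S.net), s.best.subtype (· ∈ S.net)), ?_⟩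
  rcases s with ⟨p, g, e⟩
  simp only [f, LearnerState.mk.injEq]
  refine ⟨?_, Finset.subtype_map_of_mem fun a ha => hs.good_subset ha,
    Finset.subtype_map_of_mem fun a ha => hs.best_subset ha⟩
  rw [List.map_map]
  exact List.attach_map_subtype_val p

theorem measurableSet_filter_eq {Ω α : Type*} [MeasurableSpace Ω] [DecidableEq α] (A G : Finset α)
    {p : Ω → α → Prop} [∀ ω, DecidablePred (p ω)] (hp : ∀ a ∈ A, MeasurableSet {ω | p ω a}) :
    MeasurableSet {ω | A.filter (p ω) = G} := by
  by_cases hG : G ⊆ A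
  · have : {ω | A.filter (p ω) = G} = ⋂ a ∈ A, {ω | p ω a ↔ a ∈ G} := by
      ext ω
      simp only [Set.mem_ofPred_eq, Set.mem_iInter, Finset.ext_iff, Finset.mem_filter]
      refine ⟨fun h a ha => by rw [← h a]; simp [ha], fun h a => ?_⟩
      by_cases ha : a ∈ A
      · rw [← h a ha]; simp [ha]
      · simp only [ha, false_and, false_iff]; exact fun h => ha (hG h)
    rw [this]
    refine Finset.measurableSet_biInter _ fun a ha => ?_
    by_cases haG : a ∈ G
    · simpa [haG] using hp a ha
    · have : {ω | p ω a ↔ a ∈ G} = {ω | p ω a}ᶜ := by ext ω; simp [haG]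
      rw [this]; exact (hp a ha).compl
  · convert MeasurableSet.empty
    ext ω
    simp only [Set.mem_ofPred_eq, Set.mem_empty_iff_false, iff_false]
    rintro rfl
    exact hG (Finset.filter_subset _ _)

theorem measurable_privSum {Ω : Type*} [MeasurableSpace Ω] {rew : ℕ → Ω → ℝ}
    {z : ℕ → Act d → Ω → ℝ} {t t₀ : ℕ} {pulls : List (Act d)} (ht : t₀ + pulls.length ≤ t)
    (hr : ∀ k < t, Measurable (rew k)) (hz : ∀ s ≤ t, ∀ a, Measurable (z s a)) (a : Act d) :
    Measurable fun ω => privSum (fun k => rew k ω) (fun s a => z s a ω) t₀ pulls a := by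
  classical
  unfold privSum
  refine Measurable.add (Finset.measurable_sum _ fun k _ => ?_) (hz _ ht a)
  split_ifs
  · exact hr _ (by have := k.2; omega)
  · exact measurable_const

theorem Choices.Admissible.measurable_inner_estimate (hS : S.Admissible B 𝒜 T) (hT : 2 ≤ T)
    {Ω : Type*} [MeasurableSpace Ω] {rew : ℕ → Ω → ℝ}
    {z : ℕ → Act d → Ω → ℝ} {t i : ℕ} (hi : 1 ≤ i) {s : LearnerState d} (hs : S.Reachable s)
    (ht : s.played.length + (S.pulls i s.good).length ≤ t)
    (hr : ∀ k < t, Measurable (rew k)) (hz : ∀ s ≤ t, ∀ a, Measurable (z s a))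
    {α : Act d} (hα : α ∈ s.good) :
    Measurable fun ω => ⟪α, S.estimate T (fun k => rew k ω) (fun s a => z s a ω) i s⟫ := by
  obtain ⟨c, -, -, hc, -⟩ := leastSquares_weights
    (div_nonneg (by positivity) (pow_nonneg (growth_pos hT).le i))
    (hS.core_subset hi hs.good_subset hs.good_nonempty)
    (fun α hα y => hS.inner_sq_le hT hi hs.good_subset hs.good_nonempty hα y) hα
  simp only [Choices.estimate, hc]
  exact Finset.measurable_sum _ fun a _ => (measurable_privSum ht hr hz a).mul_const _

theorem Choices.Admissible.measurableSet_batch_eq (hS : S.Admissible B 𝒜 T) (hT : 2 ≤ T)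
    {Ω : Type*} [MeasurableSpace Ω] {rew : ℕ → Ω → ℝ}
    {z : ℕ → Act d → Ω → ℝ} {t i : ℕ} (hi : 1 ≤ i) {s : LearnerState d} (hs : S.Reachable s)
    (ht : s.played.length + (S.pulls i s.good).length ≤ t)
    (hr : ∀ k < t, Measurable (rew k)) (hz : ∀ s ≤ t, ∀ a, Measurable (z s a))
    (s' : LearnerState d) :
    MeasurableSet {ω | S.batch T B b (fun k => rew k ω) (fun s a => z s a ω) i s = s'} := by
  classical
  have hm := fun α (hα : α ∈ s.good) => hS.measurable_inner_estimate hT hi hs ht hr hz hα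
  rcases s' with ⟨p, g, e⟩
  simp only [Choices.batch, LearnerState.mk.injEq]
  refine (MeasurableSet.const _).inter (MeasurableSet.inter ?_ ?_)
  · refine measurableSet_filter_eq _ _ fun a ha => ?_
    simp only [Set.ofPred_forall]
    exact Finset.measurableSet_biInter _ fun α hα =>
      measurableSet_le ((hm α hα).sub_const _) (hm a ha)
  · refine measurableSet_filter_eq _ _ fun a ha => ?_
    simp only [Set.ofPred_forall]
    exact Finset.measurableSet_biInter _ fun α hα => measurableSet_le (hm α hα) (hm a ha)

/-- Whether the learner is in a given state that is reached by round `t` is determined by the rewards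
before round `t` and the noise drawn by then. -/
theorem Choices.Admissible.measurableSet_stateAfter_eq (hS : S.Admissible B 𝒜 T)
    (h𝒜 : 𝒜.Nonempty) (hT : 2 ≤ T) (hb : 0 ≤ b)
    {Ω : Type*} [MeasurableSpace Ω] {rew : ℕ → Ω → ℝ} {z : ℕ → Act d → Ω → ℝ} {t : ℕ}
    (hr : ∀ k < t, Measurable (rew k)) (hz : ∀ s ≤ t, ∀ a, Measurable (z s a)) (j : ℕ)
    {s : LearnerState d} (hs : s.played.length ≤ t) :
    MeasurableSet {ω | S.stateAfter T B b (fun k => rew k ω) (fun s a => z s a ω) j = s} := by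
  induction j generalizing s with
  | zero => exact MeasurableSet.const ((⟨[], S.net, S.net⟩ : LearnerState d) = s)
  | succ j ih =>
    have : {ω | S.stateAfter T B b (fun k => rew k ω) (fun s a => z s a ω) (j + 1) = s} =
        ⋃ s' ∈ {s' | S.Reachable s' ∧ s'.played.length + (S.pulls (j + 1) s'.good).length ≤ t},
          {ω | S.stateAfter T B b (fun k => rew k ω) (fun s a => z s a ω) j = s'} ∩
          {ω | S.batch T B b (fun k => rew k ω) (fun s a => z s a ω) (j + 1) s' = s} := by
      ext ω
      simp only [Set.mem_ofPred_eq, Set.mem_iUnion, Set.mem_inter_iff, exists_prop]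
      constructor
      · rintro rfl
        refine ⟨_, ⟨hS.reachable_stateAfter h𝒜 hT hb _ _ j, ?_⟩, rfl, rfl⟩
        rw [← List.length_append]
        exact hs
      · rintro ⟨s', -, rfl, h⟩
        exact h
    rw [this]
    refine MeasurableSet.biUnion (S.countable_reachable.mono fun s' h => h.1) fun s' h => ?_
    exact (ih (by have := h.2; omega)).inter
      (hS.measurableSet_batch_eq hT (by omega) h.1 h.2 hr hz s)

theorem Choices.Admissible.measurableSet_stateAfter_mem (hS : S.Admissible B 𝒜 T)
    (h𝒜 : 𝒜.Nonempty) (hT : 2 ≤ T) (hb : 0 ≤ b)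
    {Ω : Type*} [MeasurableSpace Ω] {rew : ℕ → Ω → ℝ} {z : ℕ → Act d → Ω → ℝ}
    (hr : ∀ k, Measurable (rew k)) (hz : ∀ s a, Measurable (z s a)) (j : ℕ)
    (X : Set (LearnerState d)) :
    MeasurableSet {ω | S.stateAfter T B b (fun k => rew k ω) (fun s a => z s a ω) j ∈ X} := by
  have : {ω | S.stateAfter T B b (fun k => rew k ω) (fun s a => z s a ω) j ∈ X} =
      ⋃ s ∈ {s | S.Reachable s ∧ s ∈ X},
        {ω | S.stateAfter T B b (fun k => rew k ω) (fun s a => z s a ω) j = s} := by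
    ext ω
    simp only [Set.mem_ofPred_eq, Set.mem_iUnion, exists_prop]
    constructor
    · intro h
      exact ⟨_, ⟨hS.reachable_stateAfter h𝒜 hT hb _ _ _, h⟩, rfl⟩
    · rintro ⟨s, ⟨-, h⟩, rfl⟩
      exact h
  rw [this]
  exact MeasurableSet.biUnion (S.countable_reachable.mono fun s' h => h.1) fun s _ =>
    hS.measurableSet_stateAfter_eq h𝒜 hT hb (t := s.played.length) (fun k _ => hr k)
      (fun s _ a => hz s a) _ le_rfl

theorem Choices.Admissible.tie_mem (hS : S.Admissible B 𝒜 T) (h𝒜 : 𝒜.Nonempty)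
    (hT : 2 ≤ T) (hb : 0 ≤ b) (rew : ℕ → ℝ) (z : ℕ → Act d → ℝ) (j : ℕ) :
    S.tie (S.stateAfter T B b rew z j).best ∈ (S.stateAfter T B b rew z j).best := by
  have h := hS.reachable_stateAfter h𝒜 hT hb rew z j
  exact hS.tie_spec _ h.best_subset h.best_nonempty

theorem Choices.Admissible.play_mem_net (hS : S.Admissible B 𝒜 T) (h𝒜 : 𝒜.Nonempty)
    (hT : 2 ≤ T) (hb : 0 ≤ b) (R : Fin T → ℝ) (z : ℕ → Act d → ℝ) (t : Fin T) :
    S.play T B b R z t ∈ S.net := by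
  simp only [Choices.play]
  set rew : ℕ → ℝ := fun k => if h : k < T then R ⟨k, h⟩ else 0
  have h := hS.reachable_stateAfter h𝒜 hT hb rew z (numBatches T)
  by_cases ht : (t : ℕ) < (S.stateAfter T B b rew z (numBatches T)).played.length
  · rw [List.getD_eq_getElem _ _ ht]
    exact h.played_mem _ (List.getElem_mem ht)
  · rw [List.getD_eq_default _ _ (not_lt.1 ht)]
    exact h.best_subset (hS.tie_mem h𝒜 hT hb rew z _)

theorem measurable_extend {Ω : Type*} {r : Fin T → Ω → ℝ} {m : MeasurableSpace Ω} {k : ℕ}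
    (hr : ∀ h : k < T, Measurable (r ⟨k, h⟩)) :
    Measurable fun ω => if h : k < T then r ⟨k, h⟩ ω else 0 := by
  split_ifs with h
  · exact hr h
  · exact measurable_const

theorem Choices.Admissible.measurableSet_play (hS : S.Admissible B 𝒜 T) (h𝒜 : 𝒜.Nonempty)
    (hT : 2 ≤ T) (hb : 0 ≤ b)
    {Ω : Type*} [MeasurableSpace Ω] {R : Fin T → Ω → ℝ} {z : ℕ → Act d → Ω → ℝ}
    (hr : ∀ k, Measurable (R k)) (hz : ∀ s a, Measurable (z s a)) (O : Set (Fin T → Act d)) :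
    MeasurableSet {ω | S.play T B b (fun k => R k ω) (fun s a => z s a ω) ∈ O} :=
  hS.measurableSet_stateAfter_mem h𝒜 hT hb
    (rew := fun k ω => if h : k < T then R ⟨k, h⟩ ω else 0)
    (fun _ => measurable_extend fun _ => hr _) hz (numBatches T)
    {s | (fun t : Fin T => s.played.getD t (S.tie s.best)) ∈ O}

end States

/-! ### Privacy -/

section Determinism

variable {d T : ℕ} {B b : ℝ} {𝒜 : Set (Act d)} {S : Choices d}

theorem Choices.batch_congr {rew rew' : ℕ → ℝ} {z z' : ℕ → Act d → ℝ} {i : ℕ} {s : LearnerState d}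
    (h : ∀ a, privSum rew' z' s.played.length (S.pulls i s.good) a =
      privSum rew z s.played.length (S.pulls i s.good) a) :
    S.batch T B b rew' z' i s = S.batch T B b rew z i s := by
  have : privSum rew' z' s.played.length (S.pulls i s.good) =
      privSum rew z s.played.length (S.pulls i s.good) := funext h
  simp only [Choices.batch, this]

theorem privSum_congr {rew rew' : ℕ → ℝ} {z z' : ℕ → Act d → ℝ} {t₀ : ℕ} {l : List (Act d)}
    (hr : ∀ k, t₀ ≤ k → k < t₀ + l.length → rew' k = rew k)
    (hz : ∀ a, z' (t₀ + l.length) a = z (t₀ + l.length) a) (a : Act d) :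
    privSum rew' z' t₀ l a = privSum rew z t₀ l a := by
  unfold privSum
  rw [hz]
  congr 1
  refine Finset.sum_congr rfl fun k _ => ?_
  rw [hr _ (by omega) (by have := k.2; omega)]

theorem Choices.length_played_le_succ (rew : ℕ → ℝ) (z : ℕ → Act d → ℝ) (j : ℕ) :
    (S.stateAfter T B b rew z j).played.length ≤ (S.stateAfter T B b rew z (j + 1)).played.length := by
  show _ ≤ ((S.stateAfter T B b rew z j).played ++ S.pulls (j + 1) _).length
  rw [List.length_append]; omega

theorem Choices.length_played_succ (rew : ℕ → ℝ) (z : ℕ → Act d → ℝ) (j : ℕ) :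
    (S.stateAfter T B b rew z (j + 1)).played.length = (S.stateAfter T B b rew z j).played.length +
      (S.pulls (j + 1) (S.stateAfter T B b rew z j).good).length :=
  List.length_append

/-- The state after `j` batches depends only on the rewards and on the noise before the end of these
batches. -/
theorem Choices.stateAfter_congr {rew rew' : ℕ → ℝ} {z z' : ℕ → Act d → ℝ} {t : ℕ}
    (hr : ∀ k < t, rew' k = rew k) (hz : ∀ s ≤ t, ∀ a, z' s a = z s a) (j : ℕ)
    (hj : (S.stateAfter T B b rew z j).played.length ≤ t) :
    S.stateAfter T B b rew' z' j = S.stateAfter T B b rew z j := by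
  induction j with
  | zero => rfl
  | succ j ih =>
    have h1 := ih ((S.length_played_le_succ rew z j).trans hj)
    rw [S.length_played_succ] at hj
    show S.batch T B b rew' z' (j + 1) (S.stateAfter T B b rew' z' j) =
      S.batch T B b rew z (j + 1) _
    rw [h1]
    exact Choices.batch_congr (privSum_congr (fun k _ hk => hr k (by omega)) fun a => hz _ hj a)

/-- The batch of the run that contains round `τ`: `some (t, a)` if it ends after `t` rounds and plays
`a` in round `τ`, and `none` if round `τ` comes after all batches. -/
def Choices.Contains (S : Choices d) (T : ℕ) (B b : ℝ) (rew : ℕ → ℝ) (z : ℕ → Act d → ℝ) (τ : ℕ) :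
    Option (ℕ × Act d) → Prop
  | none => (S.stateAfter T B b rew z (numBatches T)).played.length ≤ τ
  | some (t, a) => ∃ j < numBatches T, (S.stateAfter T B b rew z j).played.length ≤ τ ∧ τ < t ∧
      (S.stateAfter T B b rew z (j + 1)).played.length = t ∧
      (S.stateAfter T B b rew z (j + 1)).played[τ]? = some a

/-- A change of the reward of round `τ` is compensated by the opposite change of the noise variable
that is added to the sum in which this reward appears. -/
theorem Choices.Admissible.stateAfter_eq_of_shift (hS : S.Admissible B 𝒜 T)
    (h𝒜 : 𝒜.Nonempty) (hT : 2 ≤ T) (hb : 0 ≤ b) {rew rew' : ℕ → ℝ} {z z' : ℕ → Act d → ℝ}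
    {τ t : ℕ} {a : Act d} (hr : ∀ k, k ≠ τ → rew' k = rew k)
    (hz : ∀ s x, (s, x) ≠ (t, a) → z' s x = z s x)
    (hz' : z' t a = z t a + (rew τ - rew' τ))
    (hk : S.Contains T B b rew z τ (some (t, a))) (j : ℕ) :
    S.stateAfter T B b rew' z' j = S.stateAfter T B b rew z j := by
  obtain ⟨j₀, -, h1, h2, h3, h4⟩ := hk
  have hmono := hS.strictMono_length_played h𝒜 hT hb rew z
  have hlow : ∀ j ≤ j₀, S.stateAfter T B b rew' z' j = S.stateAfter T B b rew z j := fun j hj =>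
    Choices.stateAfter_congr (t := τ) (fun k hk => hr k hk.ne)
      (fun s hs x => hz s x fun h => by simp only [Prod.mk.injEq] at h; omega) j
      ((hmono.monotone hj).trans h1)
  have hhigh : ∀ i, S.stateAfter T B b rew' z' (j₀ + 1 + i) =
      S.stateAfter T B b rew z (j₀ + 1 + i) := by
    intro i
    induction i with
    | zero =>
      show S.batch T B b rew' z' (j₀ + 1) (S.stateAfter T B b rew' z' j₀) =
        S.batch T B b rew z (j₀ + 1) _
      rw [hlow j₀ le_rfl]
      refine Choices.batch_congr fun x => ?_
      set s := S.stateAfter T B b rew z j₀ with hs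
      have ht : s.played.length + (S.pulls (j₀ + 1) s.good).length = t := by
        rw [← S.length_played_succ, h3]
      have hplayed : (S.stateAfter T B b rew z (j₀ + 1)).played =
        s.played ++ S.pulls (j₀ + 1) s.good := rfl
      rw [hplayed, List.getElem?_append_right h1] at h4
      obtain ⟨hlt, h4⟩ := List.getElem?_eq_some_iff.1 h4
      set κ : Fin (S.pulls (j₀ + 1) s.good).length := ⟨τ - s.played.length, hlt⟩ with hκ
      have hκa : (S.pulls (j₀ + 1) s.good)[κ] = a := h4
      have hκτ : s.played.length + κ = τ := by simp only [hκ]; omega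
      unfold privSum
      rw [ht]
      by_cases hx : x = a
      · subst hx
        rw [hz', ← Finset.add_sum_erase _ _ (Finset.mem_univ κ),
          ← Finset.add_sum_erase _ (fun k : Fin (S.pulls (j₀ + 1) s.good).length =>
            if (S.pulls (j₀ + 1) s.good)[k] = x then rew (s.played.length + k) else 0)
            (Finset.mem_univ κ), if_pos hκa, if_pos hκa, hκτ]
        have : ∀ k ∈ Finset.univ.erase κ,
            (if (S.pulls (j₀ + 1) s.good)[k] = x then rew' (s.played.length + k) else 0) =
            if (S.pulls (j₀ + 1) s.good)[k] = x then rew (s.played.length + k) else 0 := by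
          intro k hk
          rw [hr]
          intro heq
          exact Finset.ne_of_mem_erase hk (Fin.ext (by omega))
        rw [Finset.sum_congr rfl this]
        ring
      · rw [hz _ _ fun h => hx (by simpa using h)]
        congr 1
        refine Finset.sum_congr rfl fun k _ => ?_
        by_cases hkx : (S.pulls (j₀ + 1) s.good)[k] = x
        · rw [if_pos hkx, if_pos hkx, hr]
          intro heq
          have : k = κ := Fin.ext (by omega)
          rw [this, hκa] at hkx
          exact hx hkx.symm
        · rw [if_neg hkx, if_neg hkx]
    | succ i ih =>
      show S.batch T B b rew' z' (j₀ + 1 + i + 1) (S.stateAfter T B b rew' z' (j₀ + 1 + i)) =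
        S.batch T B b rew z (j₀ + 1 + i + 1) _
      rw [ih]
      have hlen : t ≤ (S.stateAfter T B b rew z (j₀ + 1 + i)).played.length :=
        h3.symm.le.trans (hmono.monotone (by omega : j₀ + 1 ≤ j₀ + 1 + i))
      have hlen2 := hmono (by omega : j₀ + 1 + i < j₀ + 1 + i + 1)
      simp only [S.length_played_succ _ _ (j₀ + 1 + i)] at hlen2
      refine Choices.batch_congr (privSum_congr (fun k hk _ => hr k (by omega)) fun x =>
        hz _ _ fun h => by simp only [Prod.mk.injEq] at h; omega)
  rcases le_or_gt j j₀ with h | h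
  · exact hlow j h
  · obtain ⟨i, rfl⟩ := Nat.exists_eq_add_of_le h
    exact hhigh i

end Determinism

section Laplace

/-- A shift by `c` changes the density of `Lap(b)` by a factor of at most `exp (|c| / b)`. -/
theorem laplaceDist_shift {b : ℝ} (hb : 0 < b) (c : ℝ) {A : Set ℝ} (hA : MeasurableSet A) :
    laplaceDist b {x | x + c ∈ A} ≤ ENNReal.ofReal (Real.exp (|c| / b)) * laplaceDist b A := by
  have hA' : MeasurableSet {x : ℝ | x + c ∈ A} := (measurable_id.add_const c) hA
  set f : ℝ → ENNReal := fun x => ENNReal.ofReal (Real.exp (-|x| / b) / (2 * b)) with hf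
  have hfm : Measurable f := by fun_prop
  rw [laplaceDist, withDensity_apply _ hA', withDensity_apply _ hA, ← lintegral_indicator hA',
    ← lintegral_indicator hA, ← lintegral_const_mul _ (hfm.indicator hA)]
  have e : ∀ x, {x : ℝ | x + c ∈ A}.indicator f x =
      (fun y => A.indicator (fun y => f (y - c)) y) (x + c) := fun x => by
    simp [Set.indicator]
  rw [lintegral_congr e, lintegral_add_right_eq_self (fun y => A.indicator (fun y => f (y - c)) y) c]
  refine lintegral_mono fun y => ?_
  by_cases hy : y ∈ A
  · simp only [Set.indicator_of_mem hy, hf]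
    rw [← ENNReal.ofReal_mul (Real.exp_pos _).le]
    apply ENNReal.ofReal_le_ofReal
    rw [mul_div_assoc', ← Real.exp_add]
    gcongr
    rw [← add_div]
    gcongr
    have := abs_sub_abs_le_abs_sub y (y - c)
    simp only [sub_sub_cancel] at this
    linarith
  · simp [Set.indicator_of_notMem hy]

/-- In a family of independent variables, a shift of a single one that has a Laplace distribution
changes the probability of an event by a bounded factor. -/
theorem measure_update_le {Ω ι : Type*} [MeasurableSpace Ω] [DecidableEq ι] {P : Measure Ω}
    [IsProbabilityMeasure P] {z : ι → Ω → ℝ} (hz : ∀ i, Measurable (z i)) (hind : iIndepFun z P)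
    {b : ℝ} (hb : 0 < b) {k : ι} (hk : P.map (z k) = laplaceDist b) (c : ℝ) {A : Set (ι → ℝ)}
    (hA : MeasurableSet A) :
    P {ω | Function.update (fun i => z i ω) k (z k ω + c) ∈ A} ≤
      ENNReal.ofReal (Real.exp (|c| / b)) * P {ω | (fun i => z i ω) ∈ A} := by
  set W : Ω → ι → ℝ := fun ω => Function.update (fun i => z i ω) k 0 with hW
  have hWm : Measurable W := by
    rw [measurable_pi_iff]
    intro i
    by_cases hi : i = k
    · subst hi; simp [hW]
    · simpa [hW, Function.update_of_ne hi] using hz i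
  have hindep : IndepFun (z k) W P := by
    have h := indep_iSup_of_disjoint (m := fun i => MeasurableSpace.comap (z i) inferInstance)
      (fun i => (hz i).comap_le) hind (S := {k}) (T := {k}ᶜ) (by simp)
    rw [IndepFun_iff_Indep]
    refine indep_of_indep_of_le_left (indep_of_indep_of_le_right h ?_) ?_
    · rw [← measurable_iff_comap_le]
      refine @measurable_pi_lambda _ _ _ (_) _ W fun i => ?_
      by_cases hi : i = k
      · subst hi; simp [hW]
      · simp only [hW, Function.update_of_ne hi]
        refine (comap_measurable (z i)).mono ?_ le_rfl
        exact le_iSup₂_of_le (f := fun i (_ : i ∈ ({k}ᶜ : Set ι)) =>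
          MeasurableSpace.comap (z i) inferInstance) i hi le_rfl
    · exact le_iSup₂_of_le (f := fun i (_ : i ∈ ({k} : Set ι)) =>
          MeasurableSpace.comap (z i) inferInstance) k rfl le_rfl
  have hprod := (indepFun_iff_map_prod_eq_prod_map_map (hz k).aemeasurable hWm.aemeasurable).1 hindep
  have : IsProbabilityMeasure (P.map W) := Measure.isProbabilityMeasure_map hWm.aemeasurable
  have : IsProbabilityMeasure (laplaceDist b) := hk ▸
    Measure.isProbabilityMeasure_map (hz k).aemeasurable
  have hup : Measurable fun p : ℝ × (ι → ℝ) => Function.update p.2 k p.1 := by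
    rw [measurable_pi_iff]
    intro i
    by_cases hi : i = k
    · subst hi; simpa using measurable_fst
    · simp only [Function.update_of_ne hi]; fun_prop
  have hA' : ∀ c : ℝ, MeasurableSet {p : ℝ × (ι → ℝ) | Function.update p.2 k (p.1 + c) ∈ A} :=
    fun c => (hup.comp ((measurable_fst.add_const c).prodMk measurable_snd)) hA
  have hP : ∀ c : ℝ, P {ω | Function.update (fun i => z i ω) k (z k ω + c) ∈ A} =
      ∫⁻ w, laplaceDist b {x | x + c ∈ {x | Function.update w k x ∈ A}} ∂(P.map W) := fun c => by
    have : {ω | Function.update (fun i => z i ω) k (z k ω + c) ∈ A} =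
        (fun ω => (z k ω, W ω)) ⁻¹' {p : ℝ × (ι → ℝ) | Function.update p.2 k (p.1 + c) ∈ A} := by
      ext ω; simp [hW]
    rw [this, ← Measure.map_apply ((hz k).prodMk hWm) (hA' c), hprod, hk,
      Measure.prod_apply_symm (hA' c)]
    rfl
  have h0 := hP 0
  simp only [add_zero, Function.update_eq_self] at h0
  rw [hP c, h0, ← lintegral_const_mul']
  · refine lintegral_mono fun w => ?_
    exact laplaceDist_shift hb c ((hup.comp measurable_prodMk_right) hA)
  · exact ENNReal.ofReal_ne_top

end Laplace

section Privacy

variable {d T : ℕ} {B b : ℝ} {𝒜 : Set (Act d)} {S : Choices d}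

theorem Choices.Admissible.exists_contains (hS : S.Admissible B 𝒜 T)
    (h𝒜 : 𝒜.Nonempty) (hT : 2 ≤ T) (hb : 0 ≤ b) (rew : ℕ → ℝ) (z : ℕ → Act d → ℝ) (τ : ℕ) :
    ∃ k : Option (ℕ × S.net), S.Contains T B b rew z τ (k.map fun p => (p.1, (p.2 : Act d))) := by
  by_cases hn : (S.stateAfter T B b rew z (numBatches T)).played.length ≤ τ
  · exact ⟨none, hn⟩
  · have hex : ∃ j, τ < (S.stateAfter T B b rew z j).played.length := ⟨_, not_le.1 hn⟩
    classical
    obtain ⟨j, hj⟩ : ∃ j, Nat.find hex = j + 1 := Nat.exists_eq_succ_of_ne_zero (by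
      intro h0
      have := Nat.find_spec hex
      rw [h0] at this
      simp [Choices.stateAfter] at this)
    have h1 := Nat.find_spec hex
    rw [hj] at h1
    have h2 : ¬ _ := Nat.find_min hex (m := j) (by omega)
    have h3 : Nat.find hex ≤ numBatches T := Nat.find_min' hex (not_le.1 hn)
    refine ⟨some (_, ⟨(S.stateAfter T B b rew z (j + 1)).played[τ],
      (hS.reachable_stateAfter h𝒜 hT hb rew z (j + 1)).played_mem _ (List.getElem_mem h1)⟩),
      j, by omega, not_lt.1 h2, h1, rfl, List.getElem?_eq_getElem h1⟩

theorem Choices.Admissible.contains_unique (hS : S.Admissible B 𝒜 T)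
    (h𝒜 : 𝒜.Nonempty) (hT : 2 ≤ T) (hb : 0 ≤ b) {rew : ℕ → ℝ} {z : ℕ → Act d → ℝ} {τ : ℕ}
    {k k' : Option (ℕ × Act d)} (hk : S.Contains T B b rew z τ k)
    (hk' : S.Contains T B b rew z τ k') : k = k' := by
  have hmono := hS.strictMono_length_played h𝒜 hT hb rew z
  rcases k with _ | ⟨t, a⟩ <;> rcases k' with _ | ⟨t', a'⟩
  · rfl
  · obtain ⟨j, h0, h1, h2, h3, h4⟩ := hk'
    have := hmono.monotone (by omega : j + 1 ≤ numBatches T)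
    simp only [Choices.Contains] at hk this
    omega
  · obtain ⟨j, h0, h1, h2, h3, h4⟩ := hk
    have := hmono.monotone (by omega : j + 1 ≤ numBatches T)
    simp only [Choices.Contains] at hk' this
    omega
  · obtain ⟨j, h0, h1, h2, h3, h4⟩ := hk
    obtain ⟨j', h0', h1', h2', h3', h4'⟩ := hk'
    have : j = j' := by
      rcases lt_trichotomy j j' with h | h | h
      · have := hmono.monotone (by omega : j + 1 ≤ j')
        omega
      · exact h
      · have := hmono.monotone (by omega : j' + 1 ≤ j)
        omega
    subst this
    rw [h4] at h4'
    rw [h3] at h3'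
    simp_all

theorem Choices.Admissible.measurableSet_contains (hS : S.Admissible B 𝒜 T)
    (h𝒜 : 𝒜.Nonempty) (hT : 2 ≤ T) (hb : 0 ≤ b) {Ω : Type*} [MeasurableSpace Ω]
    (rew : ℕ → ℝ) {z : ℕ → Act d → Ω → ℝ} (hz : ∀ s a, Measurable (z s a)) (τ : ℕ)
    (k : Option (ℕ × Act d)) :
    MeasurableSet {ω | S.Contains T B b rew (fun s a => z s a ω) τ k} := by
  have h := fun j X => hS.measurableSet_stateAfter_mem h𝒜 hT hb (Ω := Ω) (rew := fun k _ => rew k)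
    (fun _ => measurable_const) hz j X
  rcases k with _ | ⟨t, a⟩
  · exact h _ {s | s.played.length ≤ τ}
  · have : {ω | S.Contains T B b rew (fun s a => z s a ω) τ (some (t, a))} =
        ⋃ j ∈ {j | j < numBatches T},
          {ω | S.stateAfter T B b rew (fun s a => z s a ω) j ∈ {s | s.played.length ≤ τ}} ∩
          {ω | S.stateAfter T B b rew (fun s a => z s a ω) (j + 1) ∈
            {s | τ < t ∧ s.played.length = t ∧ s.played[τ]? = some a}} := by
      ext ω
      simp only [Choices.Contains, Set.mem_ofPred_eq, Set.mem_iUnion, exists_prop, Set.mem_inter_iff]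
    rw [this]
    exact MeasurableSet.biUnion (Set.to_countable _) fun j _ => (h j _).inter (h (j + 1) _)

/-- The algorithm is differentially private. The event is split according to the batch that contains
the changed round and the action played there, that is, according to the noise variable `z t a` that
protects the changed reward. On each part, `z t a` is shifted by the change of this reward: by
`Choices.Admissible.stateAfter_eq_of_shift` the run on the other reward sequence is then the same. -/
theorem Choices.Admissible.isDP (hS : S.Admissible B 𝒜 T)
    (h𝒜 : 𝒜.Nonempty) (hT : 2 ≤ T) {ε Δ : ℝ} (hε : 0 < ε) (hΔ : 0 < Δ)
    {Ω : Type*} [MeasurableSpace Ω] (P : Measure Ω) [IsProbabilityMeasure P]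
    {z : ℕ → Act d → Ω → ℝ} (hz : IsLaplaceNoise P (Δ / ε) z) :
    IsDP P (fun R ω => S.play T B (Δ / ε) R (fun t a => z t a ω)) Δ ε 0 := by
  classical
  rintro R R' - - ⟨τ, -, hτ, hne⟩ O
  set b := Δ / ε with hbdef
  have hb : 0 < b := by positivity
  obtain ⟨hzm, hzl, hzi⟩ := hz
  set rew : (Fin T → ℝ) → ℕ → ℝ := fun R k => if h : k < T then R ⟨k, h⟩ else 0 with hrew
  have hr : ∀ k : ℕ, k ≠ τ → rew R' k = rew R k := by
    intro k hk
    simp only [hrew]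
    split_ifs with h
    · exact (hne ⟨k, h⟩ fun h' => hk (by rw [← h'])).symm
    · rfl
  have hrτ : |rew R τ - rew R' τ| ≤ Δ := by simpa [hrew] using hτ
  set F : (Fin T → ℝ) → Option (ℕ × S.net) → Set (ℕ × Act d → ℝ) := fun R k =>
    {y | S.Contains T B b (rew R) (fun s a => y (s, a)) τ (k.map fun p => (p.1, (p.2 : Act d))) ∧
      S.play T B b R (fun s a => y (s, a)) ∈ O} with hF
  have hFm : ∀ R k, MeasurableSet (F R k) := fun R k =>
    (hS.measurableSet_contains h𝒜 hT hb.le _ (fun s a => measurable_pi_apply (s, a)) τ _).inter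
      (hS.measurableSet_play h𝒜 hT hb.le (R := fun t _ => R t) (fun _ => measurable_const)
        (fun s a => measurable_pi_apply (s, a)) O)
  set Y : Ω → (ℕ × Act d → ℝ) := fun ω p => z p.1 p.2 ω with hY
  have hYm : Measurable Y := measurable_pi_iff.2 fun p => hzm p.1 p.2
  have hunion : ∀ R, {ω | S.play T B b R (fun t a => z t a ω) ∈ O} = ⋃ k, Y ⁻¹' F R k := by
    intro R
    ext ω
    simp only [Set.mem_ofPred_eq, Set.mem_iUnion, Set.mem_preimage, hF]
    constructor
    · intro h
      obtain ⟨k, hk⟩ := hS.exists_contains h𝒜 hT hb.le (rew R) (fun t a => z t a ω) τ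
      exact ⟨k, hk, h⟩
    · rintro ⟨k, -, h⟩
      exact h
  have hdisj : Pairwise (Function.onFun Disjoint fun k => Y ⁻¹' F R' k) := by
    intro k k' hkk
    rw [Function.onFun, Set.disjoint_left]
    rintro ω ⟨h1, -⟩ ⟨h2, -⟩
    refine hkk (Option.map_injective ?_ (hS.contains_unique h𝒜 hT hb.le h1 h2))
    rintro ⟨t, a⟩ ⟨t', a'⟩ h
    simp only [Prod.mk.injEq] at h
    exact Prod.ext h.1 (Subtype.ext h.2)
  have hone : ∀ k, P (Y ⁻¹' F R k) ≤ ENNReal.ofReal (Real.exp ε) * P (Y ⁻¹' F R' k) := by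
    have hexp : 1 ≤ ENNReal.ofReal (Real.exp ε) := by
      rw [← ENNReal.ofReal_one]
      exact ENNReal.ofReal_le_ofReal (Real.one_le_exp hε.le)
    rintro (_ | ⟨t, a⟩)
    · -- the changed reward is never used
      have : Y ⁻¹' F R none ⊆ Y ⁻¹' F R' none := by
        rintro ω ⟨h1, h2⟩
        have hst : S.stateAfter T B b (rew R') (fun s a => Y ω (s, a)) (numBatches T) =
            S.stateAfter T B b (rew R) (fun s a => Y ω (s, a)) (numBatches T) :=
          Choices.stateAfter_congr (t := τ) (fun k hk => hr k hk.ne) (fun _ _ _ => rfl) _ h1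
        have hplay : S.play T B b R' (fun s a => Y ω (s, a)) =
            S.play T B b R (fun s a => Y ω (s, a)) := by
          funext t
          show (S.stateAfter T B b (rew R') _ _).played.getD t
            (S.tie (S.stateAfter T B b (rew R') _ _).best) = _
          rw [hst]
          rfl
        refine ⟨?_, by rw [hplay]; exact h2⟩
        simp only [Option.map_none, Choices.Contains] at h1 ⊢
        rw [hst]; exact h1
      exact (measure_mono this).trans (le_mul_of_one_le_left (zero_le) hexp)
    · set c := rew R τ - rew R' τ with hc
      have hsub : Y ⁻¹' F R (some (t, a)) ⊆
          {ω | Function.update (Y ω) (t, (a : Act d)) (z t a ω + c) ∈ F R' (some (t, a))} := by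
        rintro ω ⟨h1, h2⟩
        set y' := Function.update (Y ω) (t, (a : Act d)) (z t a ω + c) with hy'
        have hst : ∀ j, S.stateAfter T B b (rew R') (fun s a => y' (s, a)) j =
            S.stateAfter T B b (rew R) (fun s a => Y ω (s, a)) j :=
          hS.stateAfter_eq_of_shift h𝒜 hT hb.le hr
            (fun s x hsx => Function.update_of_ne hsx _ _) (by simp [hy', hY, hc]) h1
        have hplay : S.play T B b R' (fun s a => y' (s, a)) =
            S.play T B b R (fun s a => Y ω (s, a)) := by
          funext t
          show (S.stateAfter T B b (rew R') _ _).played.getD t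
            (S.tie (S.stateAfter T B b (rew R') _ _).best) = _
          rw [hst]
          rfl
        refine ⟨?_, by rw [hplay]; exact h2⟩
        show S.Contains T B b (rew R') (fun s a => y' (s, a)) τ _
        simp only [Option.map_some, Choices.Contains, hst] at h1 ⊢
        exact h1
      refine (measure_mono hsub).trans ((measure_update_le (fun p : ℕ × Act d => hzm p.1 p.2) hzi hb
        (hzl t a) c (hFm R' _)).trans ?_)
      refine mul_le_mul_left (ENNReal.ofReal_le_ofReal (Real.exp_le_exp.2 ?_)) _
      rw [div_le_iff₀ hb, hbdef]
      calc |c| ≤ Δ := hrτ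
        _ = ε * (Δ / ε) := by field_simp
  simp only [ENNReal.ofReal_zero, add_zero]
  rw [hunion R, hunion R', measure_iUnion hdisj fun k => hYm (hFm R' k), ← ENNReal.tsum_mul_left]
  exact (measure_iUnion_le _).trans (ENNReal.tsum_le_tsum hone)

end Privacy

/-! ### Concentration of sums of Laplace variables -/

theorem integrable_exp_neg_mul_abs {c : ℝ} (hc : 0 < c) :
    Integrable fun x : ℝ => Real.exp (-c * |x|) := by
  rw [← integrableOn_univ, ← Set.Iic_union_Ioi (a := (0 : ℝ))]
  refine IntegrableOn.union ?_ ?_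
  · refine (integrableOn_exp_mul_Iic hc 0).congr_fun (fun x hx => ?_) measurableSet_Iic
    simp only [abs_of_nonpos (Set.mem_Iic.1 hx)]; ring_nf
  · refine (integrableOn_exp_mul_Ioi (a := -c) (by linarith) 0).congr_fun (fun x hx => ?_)
      measurableSet_Ioi
    simp only [abs_of_pos (Set.mem_Ioi.1 hx)]

theorem integral_exp_neg_mul_abs {c : ℝ} (hc : 0 < c) :
    ∫ x : ℝ, Real.exp (-c * |x|) = 2 / c := by
  rw [integral_comp_abs (f := fun x => Real.exp (-c * x)), integral_exp_mul_Ioi (by linarith)]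
  simp; ring

theorem integral_laplaceDist {b : ℝ} (hb : 0 < b) (g : ℝ → ℝ) :
    ∫ x, g x ∂laplaceDist b = ∫ x, g x * (Real.exp (-|x| / b) / (2 * b)) := by
  rw [laplaceDist, integral_withDensity_eq_integral_toReal_smul (by fun_prop) (by simp)]
  refine integral_congr_ae (Filter.Eventually.of_forall fun x => ?_)
  simp only [smul_eq_mul]
  rw [ENNReal.toReal_ofReal (by positivity), mul_comm]

theorem integrable_laplaceDist_iff {b : ℝ} (hb : 0 < b) (g : ℝ → ℝ) :
    Integrable g (laplaceDist b) ↔ Integrable fun x => g x * (Real.exp (-|x| / b) / (2 * b)) := by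
  rw [laplaceDist, integrable_withDensity_iff (by fun_prop) (by simp)]
  refine integrable_congr (Filter.Eventually.of_forall fun x => ?_)
  simp only
  rw [ENNReal.toReal_ofReal (by positivity)]

theorem exp_abs_mul_laplace_density {b : ℝ} (hb : 0 < b) (s x : ℝ) :
    Real.exp (s * |x|) * (Real.exp (-|x| / b) / (2 * b)) =
      (2 * b)⁻¹ * Real.exp (-(1 / b - s) * |x|) := by
  rw [mul_div_assoc', ← Real.exp_add, div_eq_inv_mul]
  congr 2; field_simp; ring

theorem integrable_exp_abs_laplaceDist {b s : ℝ} (hb : 0 < b) (hs : s * b < 1) :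
    Integrable (fun x => Real.exp (s * |x|)) (laplaceDist b) := by
  rw [integrable_laplaceDist_iff hb]
  simp only [exp_abs_mul_laplace_density hb]
  have : 0 < 1 / b - s := by rw [sub_pos, lt_div_iff₀ hb]; exact hs
  exact (integrable_exp_neg_mul_abs this).const_mul _

theorem integral_exp_abs_laplaceDist {b s : ℝ} (hb : 0 < b) (hs : s * b < 1) :
    ∫ x, Real.exp (s * |x|) ∂laplaceDist b = 1 / (1 - s * b) := by
  rw [integral_laplaceDist hb]
  simp only [exp_abs_mul_laplace_density hb]
  have : 0 < 1 / b - s := by rw [sub_pos, lt_div_iff₀ hb]; exact hs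
  have h2 : 0 < 1 - s * b := by linarith
  rw [integral_const_mul, integral_exp_neg_mul_abs this]
  field_simp

theorem integrable_exp_laplaceDist {b s : ℝ} (hb : 0 < b) (hs : |s| * b < 1) :
    Integrable (fun x => Real.exp (s * x)) (laplaceDist b) := by
  refine (integrable_exp_abs_laplaceDist hb hs).mono' (by fun_prop)
    (Filter.Eventually.of_forall fun x => ?_)
  rw [Real.norm_of_nonneg (Real.exp_pos _).le, ← abs_mul]
  exact Real.exp_le_exp.2 (le_abs_self _)

/-- The moment generating function of the Laplace distribution, by symmetrization. -/
theorem integral_exp_laplaceDist {b s : ℝ} (hb : 0 < b) (hs : |s| * b < 1) :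
    ∫ x, Real.exp (s * x) ∂laplaceDist b = 1 / (1 - (s * b) ^ 2) := by
  have hneg : ∫ x, Real.exp (-s * x) ∂laplaceDist b = ∫ x, Real.exp (s * x) ∂laplaceDist b := by
    rw [integral_laplaceDist hb, integral_laplaceDist hb, ← integral_neg_eq_self]
    simp
  have hs1 : s * b < 1 := (mul_le_mul_of_nonneg_right (le_abs_self s) hb.le).trans_lt hs
  have hs2 : -s * b < 1 := (mul_le_mul_of_nonneg_right (neg_le_abs s) hb.le).trans_lt hs
  have hsum : ∫ x, (Real.exp (s * x) + Real.exp (-s * x)) ∂laplaceDist b =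
      ∫ x, (Real.exp (s * |x|) + Real.exp (-s * |x|)) ∂laplaceDist b := by
    refine integral_congr_ae (Filter.Eventually.of_forall fun x => ?_)
    rcases abs_choice x with h | h
    · simp only [h]
    · simp only [h]; rw [add_comm]; ring_nf
  rw [integral_add (integrable_exp_laplaceDist hb hs)
    (integrable_exp_laplaceDist hb (by rwa [abs_neg])), integral_add
    (integrable_exp_abs_laplaceDist hb hs1) (integrable_exp_abs_laplaceDist hb hs2), hneg,
    integral_exp_abs_laplaceDist hb hs1, integral_exp_abs_laplaceDist hb hs2] at hsum
  have h1 : 1 - s * b ≠ 0 := by linarith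
  have h2 : 1 - -s * b ≠ 0 := by linarith
  have h3 : 1 - (s * b) ^ 2 ≠ 0 := by
    have : 1 - (s * b) ^ 2 = (1 - s * b) * (1 - -s * b) := by ring
    rw [this]; exact mul_ne_zero h1 h2
  have h4 : 1 / (1 - s * b) + 1 / (1 - -s * b) = 2 * (1 / (1 - (s * b) ^ 2)) := by
    rw [div_add_div _ _ h1 h2, mul_one_div, div_eq_div_iff (mul_ne_zero h1 h2) h3]; ring
  linarith

section Tails

variable {Ω κ : Type*} [MeasurableSpace Ω] {P : Measure Ω} [IsProbabilityMeasure P]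
  {X : κ → Ω → ℝ} {b : ℝ}

/-- The Chernoff bound for a weighted sum of Laplace variables, with exponent `m / (K b)`. It uses the
cancellation of signs. -/
theorem laplace_sum_tail (hb : 0 < b) (hX : ∀ a, Measurable (X a))
    (hlaw : ∀ a, P.map (X a) = laplaceDist b) (hind : iIndepFun X P) (C : Finset κ) {w : κ → ℝ}
    {K : ℝ} (hK : 0 < K) (hw : ∀ a ∈ C, |w a| ≤ K) {m : ℝ} (hm : 0 ≤ m) (hm1 : m < 1) (x : ℝ) :
    P.real {ω | K * b * x ≤ ∑ a ∈ C, w a * X a ω} ≤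
      (1 / (1 - m ^ 2)) ^ C.card * Real.exp (-m * x) := by
  set s := m / (K * b) with hs
  have hs0 : 0 ≤ s := by positivity
  have hY : ∀ a, Measurable fun ω => w a * X a ω := fun a => (hX a).const_mul _
  have hYi : iIndepFun (fun a ω => w a * X a ω) P :=
    hind.comp (fun a x => w a * x) fun a => measurable_const_mul _
  have hsw : ∀ a ∈ C, |s * w a| * b ≤ m := fun a ha => by
    rw [abs_mul, abs_of_nonneg hs0, hs]
    calc m / (K * b) * |w a| * b ≤ m / (K * b) * K * b := by gcongr; exact hw a ha
      _ = m := by field_simp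
  have hint : ∀ a ∈ C, Integrable (fun ω => Real.exp (s * (w a * X a ω))) P := fun a ha => by
    have h := integrable_exp_laplaceDist hb ((hsw a ha).trans_lt hm1)
    rw [← hlaw a] at h
    have := h.comp_measurable (hX a)
    simpa [Function.comp_def, mul_assoc] using this
  have hmgf : ∀ a ∈ C, mgf (fun ω => w a * X a ω) P s ≤ 1 / (1 - m ^ 2) := fun a ha => by
    have h := integral_exp_laplaceDist hb ((hsw a ha).trans_lt hm1)
    rw [← hlaw a, integral_map (hX a).aemeasurable (by fun_prop)] at h
    have h2 : mgf (fun ω => w a * X a ω) P s = 1 / (1 - (s * w a * b) ^ 2) := by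
      rw [← h]; simp [mgf, mul_assoc]
    rw [h2]
    apply one_div_le_one_div_of_le (by nlinarith)
    have := hsw a ha
    have h3 : (s * w a * b) ^ 2 ≤ m ^ 2 := by
      rw [← sq_abs, abs_mul, abs_of_pos hb]
      exact pow_le_pow_left₀ (by positivity) this 2
    linarith
  have hsumeq : (fun ω => ∑ a ∈ C, w a * X a ω) = ∑ a ∈ C, fun ω => w a * X a ω := by
    ext ω; simp
  have h1 := measure_ge_le_exp_mul_mgf (μ := P) (X := fun ω => ∑ a ∈ C, w a * X a ω) (K * b * x)
    hs0 (by
    have := hYi.integrable_exp_mul_sum hY hint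
    rw [← hsumeq] at this
    exact this)
  refine h1.trans ?_
  rw [hsumeq, hYi.mgf_sum hY, mul_comm]
  have e : -s * (K * b * x) = -m * x := by rw [hs]; field_simp
  rw [e]
  gcongr
  rw [← Finset.prod_const]
  exact Finset.prod_le_prod (fun a _ => mgf_nonneg) hmgf

/-- The Chernoff bound, with exponent `m / b`, for the sum of the absolute values of Laplace
variables. -/
theorem laplace_abs_sum_tail (hb : 0 < b) (hX : ∀ a, Measurable (X a))
    (hlaw : ∀ a, P.map (X a) = laplaceDist b) (hind : iIndepFun X P) (C : Finset κ)
    {m : ℝ} (hm : 0 ≤ m) (hm1 : m < 1) (x : ℝ) :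
    P.real {ω | b * x ≤ ∑ a ∈ C, |X a ω|} ≤ (1 / (1 - m)) ^ C.card * Real.exp (-m * x) := by
  set s := m / b with hs
  have hs0 : 0 ≤ s := by positivity
  have hsb : s * b = m := by rw [hs]; field_simp
  have hY : ∀ a, Measurable fun ω => |X a ω| := fun a => (hX a).abs
  have hYi : iIndepFun (fun a ω => |X a ω|) P := hind.comp (fun _ x => |x|) fun _ => measurable_abs
  have hint : ∀ a ∈ C, Integrable (fun ω => Real.exp (s * |X a ω|)) P := fun a _ => by
    have h := integrable_exp_abs_laplaceDist hb (hsb.trans_lt hm1)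
    rw [← hlaw a] at h
    exact h.comp_measurable (hX a)
  have hmgf : ∀ a, mgf (fun ω => |X a ω|) P s = 1 / (1 - m) := fun a => by
    have h := integral_exp_abs_laplaceDist hb (hsb.trans_lt hm1)
    rw [← hlaw a, integral_map (hX a).aemeasurable (by fun_prop), hsb] at h
    rw [← h]; rfl
  have hsumeq : (fun ω => ∑ a ∈ C, |X a ω|) = ∑ a ∈ C, fun ω => |X a ω| := by
    ext ω; simp
  have h1 := measure_ge_le_exp_mul_mgf (μ := P) (X := fun ω => ∑ a ∈ C, |X a ω|) (b * x) hs0 (by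
    have := hYi.integrable_exp_mul_sum hY hint
    rw [← hsumeq] at this
    exact this)
  refine h1.trans ?_
  rw [hsumeq, hYi.mgf_sum hY, mul_comm]
  have e : -s * (b * x) = -m * x := by rw [hs]; field_simp
  rw [e]
  simp only [hmgf, Finset.prod_const]
  exact le_rfl

/-- The numerical inequality behind `laplace_uniform_tail`, where `0.58` is the exponent in the bound
with cancellation of signs. It leaves the margin `0.025 y`, which pays for the factor `log T` of the
union bound over the batches. -/
theorem log_add_log_le {y : ℝ} (hy : 0 < y) :
    Real.log y + Real.log (1 / (1 - 0.58 ^ 2)) - 0.58 * y ≤ - (0.025 * y) := by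
  have h1 := Real.log_le_sub_one_of_pos (x := 0.555 * y) (by positivity)
  rw [Real.log_mul (by norm_num) hy.ne'] at h1
  have h2 : -1 ≤ Real.log (0.555 * (1 - 0.58 ^ 2)) := by
    rw [Real.le_log_iff_exp_le (by norm_num), Real.exp_neg]
    have := Real.exp_one_gt_d9
    rw [inv_le_comm₀ (Real.exp_pos 1) (by norm_num)]
    refine le_trans ?_ this.le
    norm_num
  rw [Real.log_mul (by norm_num) (by norm_num)] at h2
  rw [one_div, Real.log_inv]
  linarith

/-- A uniform tail bound for the noise of a batch. The union bound over `A` with cancellation of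
signs is good if `A` is small compared with `exp n`, the bound on the sum of the absolute values, which
needs no union bound, is good if `A` is large, and the geometric mean of the two bounds is always good
enough. -/
theorem laplace_uniform_tail (hb : 0 < b) (hX : ∀ a, Measurable (X a))
    (hlaw : ∀ a, P.map (X a) = laplaceDist b) (hind : iIndepFun X P) (C A : Finset κ)
    (hA : A.Nonempty) {w : κ → κ → ℝ}
    {K : ℝ} (hK : 0 < K) (hw : ∀ α ∈ A, ∀ a ∈ C, |w α a| ≤ K) {n : ℝ} (hn : 0 < n)
    (hC : (C.card : ℝ) ≤ n) {T : ℕ} (hT : 2 ≤ T) (hlog : 2 * Real.log T ≤ (T : ℝ) ^ (0.025 : ℝ)) :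
    P.real {ω | ∃ α ∈ A, K * b * (n + Real.log (4 * A.card * (T : ℝ) ^ 2)) ≤
      |∑ a ∈ C, w α a * X a ω|} ≤ 1 / (2 * T * Real.log T) := by
  set L := Real.log (4 * A.card * (T : ℝ) ^ 2) with hL
  set x := n + L with hx
  have hT' : (2 : ℝ) ≤ T := by exact_mod_cast hT
  have hcA : (1 : ℝ) ≤ A.card := by exact_mod_cast hA.card_pos
  have hlT : 0 < Real.log T := Real.log_pos (by linarith)
  have hexpL : Real.exp L = 4 * A.card * (T : ℝ) ^ 2 := Real.exp_log (by positivity)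
  have hLT : 2 * Real.log T ≤ L := by
    have : 2 * Real.log T = Real.log ((T : ℝ) ^ 2) := by rw [Real.log_pow]; norm_num
    rw [this]
    apply Real.log_le_log (by positivity)
    nlinarith [sq_nonneg (T : ℝ)]
  have hxn : n < x := by rw [hx]; linarith
  set y := x / n with hy
  have hy1 : 1 < y := by rw [hy, lt_div_iff₀ hn]; linarith
  have hyx : n * y = x := by rw [hy]; field_simp
  set p := P.real {ω | ∃ α ∈ A, K * b * x ≤ |∑ a ∈ C, w α a * X a ω|} with hp
  set l := Real.log (1 / (1 - 0.58 ^ 2)) with hl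
  have hl0 : 0 ≤ l := Real.log_nonneg (by norm_num)
  -- the union bound with cancellation of signs
  have hp1 : p ≤ 2 * A.card * Real.exp (n * l - 0.58 * x) := by
    have hpow : (1 / (1 - (0.58 : ℝ) ^ 2)) ^ C.card * Real.exp (-0.58 * x) ≤
        Real.exp (n * l - 0.58 * x) := by
      rw [← Real.exp_log (x := (1 / (1 - (0.58 : ℝ) ^ 2)) ^ C.card) (by norm_num),
        Real.log_pow, ← Real.exp_add]
      apply Real.exp_le_exp.2
      have := mul_le_mul_of_nonneg_right hC hl0
      rw [← hl]
      linarith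
    have hsub : {ω | ∃ α ∈ A, K * b * x ≤ |∑ a ∈ C, w α a * X a ω|} ⊆
        ⋃ α ∈ A, ({ω | K * b * x ≤ ∑ a ∈ C, w α a * X a ω} ∪
          {ω | K * b * x ≤ ∑ a ∈ C, -w α a * X a ω}) := by
      rintro ω ⟨α, hα, h⟩
      simp only [Set.mem_iUnion]
      refine ⟨α, hα, ?_⟩
      rcases le_abs.1 h with h | h
      · exact Or.inl h
      · right
        simpa only [Set.mem_ofPred_eq, neg_mul, Finset.sum_neg_distrib] using h
    calc p ≤ P.real (⋃ α ∈ A, ({ω | K * b * x ≤ ∑ a ∈ C, w α a * X a ω} ∪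
          {ω | K * b * x ≤ ∑ a ∈ C, -w α a * X a ω})) := measureReal_mono hsub (measure_ne_top _ _)
      _ ≤ ∑ α ∈ A, P.real ({ω | K * b * x ≤ ∑ a ∈ C, w α a * X a ω} ∪
          {ω | K * b * x ≤ ∑ a ∈ C, -w α a * X a ω}) := measureReal_biUnion_finset_le _ _
      _ ≤ ∑ α ∈ A, 2 * Real.exp (n * l - 0.58 * x) := by
        refine Finset.sum_le_sum fun α hα => ?_
        refine (measureReal_union_le _ _).trans ?_
        have h1 := laplace_sum_tail hb hX hlaw hind C hK (hw α hα) (m := 0.58) (by norm_num)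
          (by norm_num) x
        have h2 := laplace_sum_tail hb hX hlaw hind C hK (w := fun a => -w α a)
          (fun a ha => by rw [abs_neg]; exact hw α hα a ha) (m := 0.58) (by norm_num)
          (by norm_num) x
        linarith
      _ = _ := by rw [Finset.sum_const, nsmul_eq_mul]; ring
  -- the bound by the sum of the absolute values, with the optimal exponent
  have hp2 : p ≤ Real.exp (n * Real.log y - L) := by
    have hsub : {ω | ∃ α ∈ A, K * b * x ≤ |∑ a ∈ C, w α a * X a ω|} ⊆
        {ω | b * x ≤ ∑ a ∈ C, |X a ω|} := by
      rintro ω ⟨α, hα, h⟩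
      have h1 : |∑ a ∈ C, w α a * X a ω| ≤ K * ∑ a ∈ C, |X a ω| := by
        refine (Finset.abs_sum_le_sum_abs _ _).trans ?_
        rw [Finset.mul_sum]
        refine Finset.sum_le_sum fun a ha => ?_
        rw [abs_mul]
        exact mul_le_mul_of_nonneg_right (hw α hα a ha) (abs_nonneg _)
      have h2 := h.trans h1
      rw [mul_assoc] at h2
      exact le_of_mul_le_mul_left h2 hK
    have hy0 : 0 < y := by linarith
    have h1 := laplace_abs_sum_tail hb hX hlaw hind C (m := 1 - 1 / y)
      (by rw [sub_nonneg, div_le_one hy0]; exact hy1.le) (by have := one_div_pos.2 hy0; linarith) x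
    refine (measureReal_mono hsub).trans (h1.trans ?_)
    have e1 : 1 / (1 - (1 - 1 / y)) = y := by field_simp; ring
    have e2 : -(1 - 1 / y) * x = -L := by
      have : 1 / y * x = n := by rw [← hyx]; field_simp
      linarith
    rw [e1, e2, ← Real.exp_log (x := y ^ C.card) (by positivity), Real.log_pow, ← Real.exp_add]
    apply Real.exp_le_exp.2
    have := mul_le_mul_of_nonneg_right hC (Real.log_pos hy1).le
    linarith
  have hp0 : 0 ≤ p := measureReal_nonneg
  have hprod : p ^ 2 ≤ Real.exp (-0.025 * (2 * Real.log T)) / (2 * (T : ℝ) ^ 2) := by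
    calc p ^ 2 = p * p := sq p
      _ ≤ 2 * A.card * Real.exp (n * l - 0.58 * x) * Real.exp (n * Real.log y - L) :=
        mul_le_mul hp1 hp2 hp0 (by positivity)
      _ = 2 * A.card / Real.exp L * Real.exp (n * (Real.log y + l - 0.58 * y)) := by
        rw [mul_assoc, ← Real.exp_add, div_mul_eq_mul_div, mul_div_assoc, ← Real.exp_sub]
        congr 2; rw [← hyx]; ring
      _ ≤ 2 * A.card / Real.exp L * Real.exp (-0.025 * (2 * Real.log T)) := by
        refine mul_le_mul_of_nonneg_left (Real.exp_le_exp.2 ?_) (by positivity)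
        have h1 := mul_le_mul_of_nonneg_left (log_add_log_le (y := y) (by linarith)) hn.le
        have h2 : n * -(0.025 * y) = -0.025 * x := by rw [← hyx]; ring
        rw [h2] at h1
        refine h1.trans ?_
        rw [hx]
        nlinarith
      _ = _ := by rw [hexpL]; field_simp; ring
  have hTpow : (T : ℝ) ^ (0.025 : ℝ) = Real.exp (0.025 * Real.log T) := by
    rw [Real.rpow_def_of_pos (by linarith), mul_comm]
  have hfin : p ^ 2 ≤ (1 / (2 * T * Real.log T)) ^ 2 := by
    refine hprod.trans ?_
    have e : Real.exp (-0.025 * (2 * Real.log T)) = ((T : ℝ) ^ (0.025 : ℝ))⁻¹ ^ 2 := by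
      rw [hTpow, ← Real.exp_neg, ← Real.exp_nat_mul]; congr 1; push_cast; ring
    have h3 : ((T : ℝ) ^ (0.025 : ℝ))⁻¹ ≤ (2 * Real.log T)⁻¹ :=
      inv_anti₀ (by positivity) hlog
    have h4 : ((T : ℝ) ^ (0.025 : ℝ))⁻¹ ^ 2 ≤ (2 * Real.log T)⁻¹ ^ 2 :=
      pow_le_pow_left₀ (by positivity) h3 2
    rw [e]
    calc ((T : ℝ) ^ (0.025 : ℝ))⁻¹ ^ 2 / (2 * (T : ℝ) ^ 2) ≤
        (2 * Real.log T)⁻¹ ^ 2 / (2 * (T : ℝ) ^ 2) := by gcongr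
      _ ≤ (2 * Real.log T)⁻¹ ^ 2 / (1 * (T : ℝ) ^ 2) := by gcongr; norm_num
      _ = _ := by field_simp
  exact le_of_sq_le_sq hfin (by positivity)

end Tails

/-! ### The error of the estimate of one batch -/

section SubGaussian

variable {Ω : Type*} {mΩ : MeasurableSpace Ω} {P : Measure Ω} [IsProbabilityMeasure P]

/-- The exponential moments of a weighted sum of conditionally sub-Gaussian variables `η k`, on an
event `E` that is known in advance. The variables need not be adapted to the filtration `m`; it is
enough that they agree on `E` with variables `X k` that are. -/
theorem integral_indicator_exp_sum_le {m : ℕ → MeasurableSpace Ω} (hm : ∀ k, m k ≤ mΩ) {E : Set Ω}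
    {X η : ℕ → Ω → ℝ} {N : ℕ} (hE : ∀ k, MeasurableSet[m k] E)
    (hX : ∀ k, ∀ j < k, Measurable[m k] (X j)) (hXη : ∀ k < N, ∀ ω ∈ E, X k ω = η k ω)
    (hηm : ∀ k < N, Measurable (η k)) (hbd : ∀ k < N, ∀ᵐ ω ∂P, |η k ω| ≤ 2)
    (hsub : ∀ k < N, ∀ l : ℝ, P[fun ω => Real.exp (l * η k ω) | m k] ≤ᵐ[P]
      fun _ => Real.exp (l ^ 2 / 2)) (w : ℕ → ℝ) (l : ℝ) {k : ℕ} (hk : k ≤ N) :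
    Integrable (E.indicator fun ω => Real.exp (l * ∑ j ∈ Finset.range k, w j * X j ω)) P ∧
    ∫ ω, E.indicator (fun ω => Real.exp (l * ∑ j ∈ Finset.range k, w j * X j ω)) ω ∂P ≤
      P.real E * Real.exp (l ^ 2 * (∑ j ∈ Finset.range k, w j ^ 2) / 2) := by
  have hE' : MeasurableSet E := hm 0 _ (hE 0)
  induction k with
  | zero =>
    simp only [Finset.range_zero, Finset.sum_empty, mul_zero, Real.exp_zero, zero_div, mul_one]
    refine ⟨(integrable_const 1).indicator hE', ?_⟩
    rw [integral_indicator_const _ hE']; simp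
  | succ k ih =>
    obtain ⟨hint, hle⟩ := ih (by omega)
    have hkN : k < N := by omega
    set G : Ω → ℝ := E.indicator fun ω => Real.exp (l * ∑ j ∈ Finset.range k, w j * X j ω) with hG
    set g : Ω → ℝ := fun ω => Real.exp (l * w k * η k ω) with hg
    have hG0 : ∀ ω, 0 ≤ G ω := fun ω => Set.indicator_nonneg (fun _ _ => (Real.exp_pos _).le) ω
    have hstep : (E.indicator fun ω => Real.exp (l * ∑ j ∈ Finset.range (k + 1), w j * X j ω)) =
        G * g := by
      ext ω
      by_cases hω : ω ∈ E
      · simp only [hG, hg, Pi.mul_apply, Set.indicator_of_mem hω]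
        rw [Finset.sum_range_succ, hXη k hkN ω hω, ← Real.exp_add]
        congr 1; ring
      · simp [hG, Set.indicator_of_notMem hω]
    have hgm : Measurable g := ((hηm k hkN).const_mul _).exp
    have hgb : ∀ᵐ ω ∂P, ‖g ω‖ ≤ Real.exp (|l * w k| * 2) := by
      filter_upwards [hbd k hkN] with ω hω
      rw [Real.norm_of_nonneg (Real.exp_pos _).le]
      apply Real.exp_le_exp.2
      calc l * w k * η k ω ≤ |l * w k * η k ω| := le_abs_self _
        _ = |l * w k| * |η k ω| := abs_mul _ _
        _ ≤ _ := by gcongr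
    have hgi : Integrable g P := (integrable_const _).mono' hgm.aestronglyMeasurable hgb
    have hGg : Integrable (G * g) P := hint.mul_bdd hgm.aestronglyMeasurable hgb
    have hGm : StronglyMeasurable[m k] G := by
      refine (Measurable.indicator (m := m k) ?_ (hE k)).stronglyMeasurable
      refine Measurable.exp ?_
      refine Measurable.const_mul (m := m k) ?_ _
      exact Finset.measurable_sum (m := m k) _ fun j hj =>
        (hX k j (Finset.mem_range.1 hj)).const_mul _
    rw [hstep]
    refine ⟨hGg, ?_⟩
    have hpull := condExp_mul_of_stronglyMeasurable_left (μ := P) hGm hGg hgi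
    rw [← integral_condExp (hm k), integral_congr_ae hpull]
    calc ∫ ω, (G * P[g | m k]) ω ∂P ≤ ∫ ω, G ω * Real.exp ((l * w k) ^ 2 / 2) ∂P := by
          refine integral_mono_ae (integrable_condExp.congr hpull) (hint.mul_const _) ?_
          filter_upwards [hsub k hkN (l * w k)] with ω hω
          exact mul_le_mul_of_nonneg_left hω (hG0 ω)
      _ = (∫ ω, G ω ∂P) * Real.exp ((l * w k) ^ 2 / 2) := integral_mul_const _ _
      _ ≤ P.real E * Real.exp (l ^ 2 * (∑ j ∈ Finset.range k, w j ^ 2) / 2) *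
          Real.exp ((l * w k) ^ 2 / 2) := by gcongr
      _ = _ := by
          rw [mul_assoc, ← Real.exp_add, Finset.sum_range_succ]
          congr 2; ring

/-- The Chernoff bound for `integral_indicator_exp_sum_le`. -/
theorem measure_inter_sum_ge_le {m : ℕ → MeasurableSpace Ω} (hm : ∀ k, m k ≤ mΩ) {E : Set Ω}
    {X η : ℕ → Ω → ℝ} {N : ℕ} (hE : ∀ k, MeasurableSet[m k] E)
    (hX : ∀ k, ∀ j < k, Measurable[m k] (X j)) (hXη : ∀ k < N, ∀ ω ∈ E, X k ω = η k ω)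
    (hηm : ∀ k < N, Measurable (η k)) (hbd : ∀ k < N, ∀ᵐ ω ∂P, |η k ω| ≤ 2)
    (hsub : ∀ k < N, ∀ l : ℝ, P[fun ω => Real.exp (l * η k ω) | m k] ≤ᵐ[P]
      fun _ => Real.exp (l ^ 2 / 2)) (w : ℕ → ℝ) {v β : ℝ} (hv : 0 < v) (hβ : 0 ≤ β)
    (hw : ∑ j ∈ Finset.range N, w j ^ 2 ≤ v) :
    P.real (E ∩ {ω | β ≤ ∑ j ∈ Finset.range N, w j * X j ω}) ≤
      P.real E * Real.exp (-(β ^ 2 / (2 * v))) := by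
  set l := β / v with hl
  have hl0 : 0 ≤ l := by positivity
  obtain ⟨hint, hle⟩ := integral_indicator_exp_sum_le (P := P) hm hE hX hXη hηm hbd hsub w l le_rfl
  set G : Ω → ℝ := E.indicator fun ω => Real.exp (l * ∑ j ∈ Finset.range N, w j * X j ω) with hG
  have hG0 : ∀ ω, 0 ≤ G ω := fun ω => Set.indicator_nonneg (fun _ _ => (Real.exp_pos _).le) ω
  have hmarkov := mul_meas_ge_le_integral_of_nonneg (Filter.Eventually.of_forall hG0) hint
    (Real.exp (l * β))
  have hsubset : E ∩ {ω | β ≤ ∑ j ∈ Finset.range N, w j * X j ω} ⊆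
      {ω | Real.exp (l * β) ≤ G ω} := by
    rintro ω ⟨h1, h2⟩
    simp only [Set.mem_ofPred_eq, hG, Set.indicator_of_mem h1]
    exact Real.exp_le_exp.2 (mul_le_mul_of_nonneg_left h2 hl0)
  have h1 : Real.exp (l * β) * P.real (E ∩ {ω | β ≤ ∑ j ∈ Finset.range N, w j * X j ω}) ≤
      P.real E * Real.exp (l ^ 2 * v / 2) := by
    calc _ ≤ Real.exp (l * β) * P.real {ω | Real.exp (l * β) ≤ G ω} := by
          exact mul_le_mul_of_nonneg_left (measureReal_mono hsubset (measure_ne_top _ _))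
            (Real.exp_pos _).le
      _ ≤ _ := hmarkov.trans (hle.trans (by gcongr))
  have e : P.real E * Real.exp (-(β ^ 2 / (2 * v))) =
      (Real.exp (l * β))⁻¹ * (P.real E * Real.exp (l ^ 2 * v / 2)) := by
    rw [← Real.exp_neg, mul_left_comm, ← Real.exp_add]
    congr 2
    rw [hl]; field_simp; ring
  rw [e, le_inv_mul_iff₀ (Real.exp_pos _)]
  exact h1

end SubGaussian

section BatchEstimate

variable {d T : ℕ} {B b : ℝ} {𝒜 : Set (Act d)} {S : Choices d}

theorem sum_getElem_eq_sum_count {α : Type*} [DecidableEq α] {l : List α} {C : Finset α} {n : α → ℕ}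
    (hl : ∀ a ∈ l, a ∈ C) (hn : ∀ a ∈ C, l.count a = n a) (f : α → ℝ) :
    ∑ k : Fin l.length, f l[k] = ∑ a ∈ C, (n a : ℝ) * f a := by
  have h1 : ∑ k : Fin l.length, f l[k] = (l.map f).sum := Fin.sum_univ_fun_getElem l f
  rw [h1, Finset.sum_list_map_count]
  simp only [nsmul_eq_mul]
  rw [Finset.sum_subset (s₂ := C) (fun a ha => hl a (List.mem_toFinset.1 ha))]
  · exact Finset.sum_congr rfl fun a ha => by rw [hn a ha]
  · intro a _ ha
    rw [List.count_eq_zero_of_not_mem (fun h => ha (List.mem_toFinset.2 h))]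
    simp

/-- The error of the estimated reward of an action of the good set, as the sum of a weighted sum of
reward noise and a weighted sum of privacy noise. -/
theorem Choices.Admissible.exists_error_weights (hS : S.Admissible B 𝒜 T) (hT : 2 ≤ T) {i : ℕ}
    (hi : 1 ≤ i) {s : LearnerState d} (hs : S.Reachable s) (θ : Act d) {α : Act d}
    (hα : α ∈ s.good) :
    ∃ c : Act d → ℝ, (∀ a ∈ S.core i s.good, |c a| ≤ 2 * d / growth T ^ i) ∧
      ∑ k ∈ Finset.range (S.pulls i s.good).length, c ((S.pulls i s.good).getD k 0) ^ 2 ≤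
        2 * d / growth T ^ i ∧
      ∀ rew z, ⟪α, S.estimate T rew z i s⟫ - ⟪α, θ⟫ =
        ∑ k ∈ Finset.range (S.pulls i s.good).length, c ((S.pulls i s.good).getD k 0) *
          (rew (s.played.length + k) - ⟪θ, (S.pulls i s.good).getD k 0⟫) +
        ∑ a ∈ S.core i s.good, c a * z (s.played.length + (S.pulls i s.good).length) a := by
  classical
  obtain ⟨c, h1, h2, h3, h4⟩ := leastSquares_weights
    (div_nonneg (by positivity) (pow_nonneg (growth_pos hT).le i))
    (hS.core_subset hi hs.good_subset hs.good_nonempty)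
    (fun α hα y => hS.inner_sq_le hT hi hs.good_subset hs.good_nonempty hα y) hα
  set l := S.pulls i s.good with hl
  set C := S.core i s.good with hC
  have hlC : ∀ a ∈ l, a ∈ C := fun a ha =>
    hS.mem_core_of_mem_pulls hi hs.good_subset hs.good_nonempty ha
  have hcount : ∀ a ∈ C, l.count a = S.numPulls T i s.good a := fun a ha => by
    convert hS.count_pulls hi hs.good_subset hs.good_nonempty ha
  have hget : ∀ k : Fin l.length, l.getD k 0 = l[k] := fun k => List.getD_eq_getElem _ _ k.2
  refine ⟨c, h1, ?_, fun rew z => ?_⟩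
  · rw [Finset.sum_range fun k => c (l.getD k 0) ^ 2]
    simp only [hget]
    rw [sum_getElem_eq_sum_count hlC hcount fun a => c a ^ 2]
    exact h2
  · rw [Choices.estimate, h3, h4 θ, Finset.sum_range fun k => c (l.getD k 0) *
      (rew (s.played.length + k) - ⟪θ, l.getD k 0⟫)]
    simp only [hget, mul_sub, Finset.sum_sub_distrib]
    have e1 : ∑ k : Fin l.length, c l[k] * ⟪θ, l[k]⟫ =
        ∑ a ∈ C, (S.numPulls T i s.good a : ℝ) * c a * ⟪a, θ⟫ := by
      rw [sum_getElem_eq_sum_count hlC hcount fun a => c a * ⟪θ, a⟫]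
      refine Finset.sum_congr rfl fun a _ => ?_
      rw [real_inner_comm]; ring
    have e2 : ∑ k : Fin l.length, c l[k] * rew (s.played.length + k) =
        ∑ a ∈ C, c a * ∑ k : Fin l.length, if l[k] = a then rew (s.played.length + k) else 0 := by
      simp only [Finset.mul_sum]
      rw [Finset.sum_comm]
      refine Finset.sum_congr rfl fun k _ => ?_
      have hk : l[k] ∈ C := hlC _ (List.getElem_mem _)
      rw [Finset.sum_eq_single_of_mem _ hk]
      · simp
      · intro a _ ha
        rw [if_neg (Ne.symm ha), mul_zero]
    rw [e1, e2]
    have e3 : ∑ a ∈ C, privSum rew z s.played.length l a * c a =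
        ∑ a ∈ C, c a * (∑ k : Fin l.length, if l[k] = a then rew (s.played.length + k) else 0) +
        ∑ a ∈ C, c a * z (s.played.length + l.length) a := by
      rw [← Finset.sum_add_distrib]
      refine Finset.sum_congr rfl fun a _ => ?_
      unfold privSum
      rw [mul_comm, mul_add]
    rw [e3]; ring

theorem Choices.played_prefix (S : Choices d) (rew : ℕ → ℝ) (z : ℕ → Act d → ℝ) {j k : ℕ}
    (h : j ≤ k) :
    (S.stateAfter T B b rew z j).played <+: (S.stateAfter T B b rew z k).played := by
  induction k, h using Nat.le_induction with
  | base => exact List.prefix_rfl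
  | succ k _ ih => exact ih.trans (List.prefix_append _ _)

theorem measurable_history_reward {Ω : Type*} [MeasurableSpace Ω] {r : Fin T → Ω → ℝ}
    {z : ℕ → Act d → Ω → ℝ} {t : ℕ} {I : Set ℕ} {k : Fin T} (hk : (k : ℕ) < t) :
    Measurable[history r z t I] (r k) := by
  refine (comap_measurable (r k)).mono ?_ le_rfl
  exact (le_iSup (fun s : {s : Fin T // (s : ℕ) < t} =>
    MeasurableSpace.comap (r s) inferInstance) ⟨k, hk⟩).trans le_sup_left

theorem measurable_history_noise {Ω : Type*} [MeasurableSpace Ω] {r : Fin T → Ω → ℝ}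
    {z : ℕ → Act d → Ω → ℝ} {t s : ℕ} {I : Set ℕ} (hs : s ∈ I) (a : Act d) :
    Measurable[history r z t I] (z s a) := by
  refine (comap_measurable (z s a)).mono ?_ le_rfl
  exact (le_iSup (fun p : {p : ℕ × Act d // p.1 ∈ I} =>
    MeasurableSpace.comap (z p.1.1 p.1.2) inferInstance) ⟨(s, a), hs⟩).trans le_sup_right

theorem history_le {Ω : Type*} [mΩ : MeasurableSpace Ω] {r : Fin T → Ω → ℝ}
    {z : ℕ → Act d → Ω → ℝ} (hr : ∀ t, Measurable (r t)) (hz : ∀ t a, Measurable (z t a)) (t : ℕ)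
    (I : Set ℕ) : history r z t I ≤ mΩ :=
  sup_le (iSup_le fun s => (hr s).comap_le) (iSup_le fun _ => (hz _ _).comap_le)

/-- The probability that the learner is in the state `s` after `j` batches and that the estimate of
the next batch is then inaccurate. In a fixed state the pulls of the next batch are fixed, so that the
error is a linear combination, with fixed weights, of reward noise and privacy noise. -/
theorem Choices.Admissible.measure_state_inter_inaccurate_le (hS : S.Admissible B 𝒜 T)
    (h𝒜 : 𝒜.Nonempty) (h𝒜1 : ∀ a ∈ 𝒜, ‖a‖ ≤ 1) (hT : 2 ≤ T) (hd : 1 ≤ d) (hb : 0 < b)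
    (hlog : 2 * Real.log T ≤ (T : ℝ) ^ (0.025 : ℝ)) {θ : Act d} (hθ : ‖θ‖ ≤ 1)
    {Ω : Type*} [MeasurableSpace Ω] {P : Measure Ω} [IsProbabilityMeasure P]
    {z : ℕ → Act d → Ω → ℝ} {r : Fin T → Ω → ℝ} {act : Fin T → Ω → Act d}
    (hz : IsLaplaceNoise P b z)
    (hact : ∀ t ω, act t ω = S.play T B b (fun s => r s ω) (fun s a => z s a ω) t)
    (hbandit : IsLinearBandit P θ r z act) {j : ℕ} (hj : j < numBatches T) {s : LearnerState d}
    (hs : S.Reachable s) (hend : s.played.length + (S.pulls (j + 1) s.good).length ≤ T) :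
    P.real ({ω | S.stateAfter T B b (fun k => if h : k < T then r ⟨k, h⟩ ω else 0)
        (fun s a => z s a ω) j = s} ∩
      {ω | ∃ α ∈ s.good, confWidth d T B b (j + 1) s.good <
        |⟪α, S.estimate T (fun k => if h : k < T then r ⟨k, h⟩ ω else 0)
          (fun s a => z s a ω) (j + 1) s⟫ - ⟪α, θ⟫|}) ≤
    P.real {ω | S.stateAfter T B b (fun k => if h : k < T then r ⟨k, h⟩ ω else 0)
        (fun s a => z s a ω) j = s} * (1 / (2 * (T : ℝ) ^ 2) + 1 / (2 * T * Real.log T)) := by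
  set rew : ℕ → Ω → ℝ := fun k ω => if h : k < T then r ⟨k, h⟩ ω else 0 with hrew
  set E : Set Ω := {ω | S.stateAfter T B b (fun k => rew k ω) (fun s a => z s a ω) j = s} with hE
  set A := s.good with hA
  set l := S.pulls (j + 1) A with hl
  set t₀ := s.played.length with ht₀
  set K : ℝ := 2 * d / growth T ^ (j + 1) with hK
  set L := Real.log (4 * A.card * (T : ℝ) ^ 2) with hL
  have hq := pow_pos (growth_pos hT) (j + 1)
  have hd' : (1 : ℝ) ≤ d := by exact_mod_cast hd
  have hKpos : 0 < K := by positivity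
  have hT' : (2 : ℝ) ≤ T := by exact_mod_cast hT
  have hcA : (1 : ℝ) ≤ A.card := by exact_mod_cast hs.good_nonempty.card_pos
  have hL0 : 0 ≤ L := Real.log_nonneg (by nlinarith [sq_nonneg (T : ℝ)])
  have hl0 : 0 < l.length := hS.length_pulls_pos hT (by omega) hs.good_subset hs.good_nonempty
  have hw := fun α (hα : α ∈ A) => hS.exists_error_weights hT (i := j + 1) (by omega) hs θ hα
  choose! c hc1 hc2 hc3 using hw
  set β := Real.sqrt (4 * d / growth T ^ (j + 1) * L) with hβ
  have hβ2 : β ^ 2 = 2 * K * L := by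
    rw [hβ, Real.sq_sqrt (by positivity), hK]; ring
  set X : ℕ → Ω → ℝ := fun k ω => rew (t₀ + k) ω - ⟪θ, l.getD k 0⟫ with hX
  -- failure because of the reward noise, with either sign, and because of the privacy noise
  set F1 : Act d → Set Ω := fun α =>
    {ω | β ≤ ∑ k ∈ Finset.range l.length, c α (l.getD k 0) * X k ω} with hF1
  set F2 : Act d → Set Ω := fun α =>
    {ω | β ≤ ∑ k ∈ Finset.range l.length, -c α (l.getD k 0) * X k ω} with hF2
  set F3 : Set Ω := {ω | ∃ α ∈ A, K * b * (B * d + L) ≤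
    |∑ a ∈ S.core (j + 1) A, c α a * z (t₀ + l.length) a ω|} with hF3
  have hcover : E ∩ {ω | ∃ α ∈ A, confWidth d T B b (j + 1) A <
        |⟪α, S.estimate T (fun k => rew k ω) (fun s a => z s a ω) (j + 1) s⟫ - ⟪α, θ⟫|} ⊆
      (⋃ α ∈ A, ((E ∩ F1 α) ∪ (E ∩ F2 α))) ∪ (E ∩ F3) := by
    rintro ω ⟨hωE, α, hα, hlt⟩
    by_cases h3 : ω ∈ F3
    · exact Or.inr ⟨hωE, h3⟩
    left
    simp only [Set.mem_iUnion]
    refine ⟨α, hα, ?_⟩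
    rw [hc3 α hα] at hlt
    have h3' : |∑ a ∈ S.core (j + 1) A, c α a * z (t₀ + l.length) a ω| <
        K * b * (B * d + L) := by
      by_contra! hcon
      exact h3 ⟨α, hα, hcon⟩
    have hγ : confWidth d T B b (j + 1) A = β + K * b * (B * d + L) := by
      rw [confWidth, hβ, hK]
      ring
    rw [hγ] at hlt
    have habs := abs_add_le (∑ k ∈ Finset.range l.length, c α (l.getD k 0) * X k ω)
      (∑ a ∈ S.core (j + 1) A, c α a * z (t₀ + l.length) a ω)
    have hgt : β < |∑ k ∈ Finset.range l.length, c α (l.getD k 0) * X k ω| := by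
      have := hlt.trans_le habs
      linarith
    rcases lt_abs.1 hgt with h | h
    · exact Or.inl ⟨hωE, h.le⟩
    · refine Or.inr ⟨hωE, ?_⟩
      simp only [hF2, Set.mem_ofPred_eq, neg_mul, Finset.sum_neg_distrib]
      exact h.le
  -- measurability with respect to the histories
  have hrewm : ∀ {m : MeasurableSpace Ω} (k : ℕ), (∀ h : k < T, Measurable[m] (r ⟨k, h⟩)) →
      Measurable[m] (rew k) := fun k h => measurable_extend h
  have hEm : ∀ (k : ℕ) (I : Set ℕ), (∀ s ≤ t₀, s ∈ I) →
      MeasurableSet[history r z (t₀ + k) I] E := fun k I hI =>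
    @Choices.Admissible.measurableSet_stateAfter_eq _ _ _ _ _ _ hS h𝒜 hT hb.le _
      (history r z (t₀ + k) I) rew z t₀
      (fun k' hk' => @hrewm (history r z (t₀ + k) I) k' fun h =>
        measurable_history_reward (by simp only; omega))
      (fun s hs a => measurable_history_noise (hI s hs) a) j s le_rfl
  -- the reward noise
  set η : ℕ → Ω → ℝ := fun k ω =>
    if h : t₀ + k < T then r ⟨t₀ + k, h⟩ ω - ⟪θ, act ⟨t₀ + k, h⟩ ω⟫ else 0 with hη
  have hactm : ∀ t, Measurable (act t) := fun t U hU => by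
    have := hS.measurableSet_play h𝒜 hT hb.le hbandit.measurable hz.1 {f | f t ∈ U}
    convert this using 1
    ext ω
    simp only [Set.mem_preimage, hact t ω]
    rfl
  have hact1 : ∀ t ω, ‖act t ω‖ ≤ 1 := fun t ω => by
    rw [hact t ω]
    exact h𝒜1 _ (hS.net_spec.1 (hS.play_mem_net h𝒜 hT hb.le _ _ t))
  have hηm : ∀ k < l.length, Measurable (η k) := fun k hk => by
    have h : t₀ + k < T := by omega
    simp only [hη, dif_pos h]
    exact (hbandit.measurable _).sub (Measurable.const_inner (hactm _))
  have hηb : ∀ k < l.length, ∀ᵐ ω ∂P, |η k ω| ≤ 2 := fun k hk => by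
    have h : t₀ + k < T := by omega
    filter_upwards [hbandit.bounded ⟨t₀ + k, h⟩] with ω hω
    simp only [hη, dif_pos h]
    have h1 : |⟪θ, act ⟨t₀ + k, h⟩ ω⟫| ≤ 1 := (abs_real_inner_le_norm _ _).trans
      (mul_le_one₀ hθ (norm_nonneg _) (hact1 _ _))
    calc _ ≤ |r ⟨t₀ + k, h⟩ ω| + |⟪θ, act ⟨t₀ + k, h⟩ ω⟫| := abs_sub _ _
      _ ≤ 2 := by linarith
  have hXη : ∀ k < l.length, ∀ ω ∈ E, X k ω = η k ω := fun k hk ω hω => by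
    have h : t₀ + k < T := by omega
    have hωE : S.stateAfter T B b (fun k => rew k ω) (fun s a => z s a ω) j = s := hω
    have hactk : act ⟨t₀ + k, h⟩ ω = l.getD k 0 := by
      rw [hact]
      show (S.stateAfter T B b (fun k => rew k ω) (fun s a => z s a ω) (numBatches T)).played.getD
        (t₀ + k) _ = _
      have hpre := S.played_prefix (T := T) (B := B) (b := b) (fun k => rew k ω)
        (fun s a => z s a ω) (show j + 1 ≤ numBatches T by omega)
      have hplayed : (S.stateAfter T B b (fun k => rew k ω) (fun s a => z s a ω) (j + 1)).played =
          s.played ++ l := by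
        rw [hl, hA, ← hωE]; rfl
      rw [hplayed] at hpre
      obtain ⟨l', hl'⟩ := hpre
      rw [← hl', List.getD_append _ _ _ _ (by rw [List.length_append]; omega),
        List.getD_append_right _ _ _ _ (by omega), List.getD_eq_getElem _ _ (by omega),
        List.getD_eq_getElem _ _ (by omega)]
      congr 1
      omega
    simp only [hX, hη, dif_pos h, hrew, hactk]
  have hXm : ∀ k, ∀ i < k, Measurable[history r z (t₀ + k) (Set.Iic (t₀ + k))] (X i) :=
    fun k i hi => by
      refine Measurable.sub_const (m := history r z (t₀ + k) (Set.Iic (t₀ + k))) ?_ _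
      exact hrewm (t₀ + i) fun h => measurable_history_reward (by simp only; omega)
  have hsub : ∀ k < l.length, ∀ x : ℝ,
      P[fun ω => Real.exp (x * η k ω) | history r z (t₀ + k) (Set.Iic (t₀ + k))] ≤ᵐ[P]
        fun _ => Real.exp (x ^ 2 / 2) := fun k hk x => by
    have h : t₀ + k < T := by omega
    have := hbandit.subgaussian ⟨t₀ + k, h⟩ x
    simp only [hη, dif_pos h]
    exact this
  have hsg : ∀ w : ℕ → ℝ, ∑ k ∈ Finset.range l.length, w k ^ 2 ≤ K →
      P.real (E ∩ {ω | β ≤ ∑ k ∈ Finset.range l.length, w k * X k ω}) ≤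
        P.real E * Real.exp (-L) := fun w hw => by
    have h := measure_inter_sum_ge_le (P := P)
      (m := fun k => history r z (t₀ + k) (Set.Iic (t₀ + k)))
      (fun k => history_le hbandit.measurable hz.1 _ _)
      (fun k => hEm k _ fun s hs => by simp only [Set.mem_Iic]; omega) hXm hXη hηm hηb hsub w
      (β := β) hKpos (Real.sqrt_nonneg _) hw
    have e : β ^ 2 / (2 * K) = L := by rw [hβ2]; field_simp
    rwa [e] at h
  have hexpL : Real.exp (-L) = (4 * A.card * (T : ℝ) ^ 2)⁻¹ := by
    rw [Real.exp_neg, Real.exp_log (by positivity)]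
  have hP12 : P.real (⋃ α ∈ A, ((E ∩ F1 α) ∪ (E ∩ F2 α))) ≤ P.real E * (1 / (2 * (T : ℝ) ^ 2)) := by
    refine (measureReal_biUnion_finset_le _ _).trans ?_
    calc ∑ α ∈ A, P.real ((E ∩ F1 α) ∪ (E ∩ F2 α)) ≤ ∑ α ∈ A, 2 * (P.real E * Real.exp (-L)) := by
          refine Finset.sum_le_sum fun α hα => (measureReal_union_le _ _).trans ?_
          have h1 := hsg (fun k => c α (l.getD k 0)) (hc2 α hα)
          have h2 := hsg (fun k => -c α (l.getD k 0)) (by simpa only [neg_sq] using hc2 α hα)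
          simp only [hF1, hF2]
          linarith
      _ = _ := by
          rw [Finset.sum_const, nsmul_eq_mul, hexpL]
          field_simp; ring
  -- the privacy noise is independent of the past
  have hP3 : P.real (E ∩ F3) ≤ P.real E * (1 / (2 * T * Real.log T)) := by
    have hindep := hbandit.noise_indep (t₀ + l.length) hend
    have hF3m' : ∀ m : MeasurableSpace Ω, (∀ a, Measurable[m] (z (t₀ + l.length) a)) →
        MeasurableSet[m] F3 := fun m hm => by
      have : F3 = ⋃ α ∈ A, {ω | K * b * (B * d + L) ≤
          |∑ a ∈ S.core (j + 1) A, c α a * z (t₀ + l.length) a ω|} := by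
        ext ω; simp [hF3]
      rw [this]
      exact Finset.measurableSet_biUnion _ fun α _ => measurableSet_le measurable_const
        (Finset.measurable_sum _ fun a _ => (hm a).const_mul _).abs
    have hF3m := hF3m' (⨆ a, MeasurableSpace.comap (z (t₀ + l.length) a) inferInstance) fun a =>
      (comap_measurable _).mono (le_iSup (fun a =>
        MeasurableSpace.comap (z (t₀ + l.length) a) inferInstance) a) le_rfl
    have hmul := (Indep_iff _ _ _).1 hindep F3 E hF3m
      (hEm l.length _ fun s hs => by simp only [Set.mem_Iio]; omega)
    have hreal : P.real (E ∩ F3) = P.real E * P.real F3 := by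
      rw [Set.inter_comm, measureReal_def, hmul, ENNReal.toReal_mul, mul_comm]; rfl
    rw [hreal]
    refine mul_le_mul_of_nonneg_left ?_ measureReal_nonneg
    have hB1 := hS.one_le h𝒜
    refine laplace_uniform_tail hb (fun a => hz.1 _ a) (fun a => hz.2.1 _ a) ?_
      (S.core (j + 1) A) A hs.good_nonempty hKpos hc1 (by positivity) ?_ hT hlog
    · exact hz.2.2.precomp (g := fun a => (t₀ + l.length, a)) fun a a' h => by simpa using h
    · refine (hS.core_spec (j + 1) (by omega) A hs.good_subset hs.good_nonempty).2.1.trans ?_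
      have : max 1 (spanDim A) ≤ d := max_le hd (spanDim_le A)
      gcongr
  calc _ ≤ P.real ((⋃ α ∈ A, ((E ∩ F1 α) ∪ (E ∩ F2 α))) ∪ (E ∩ F3)) :=
        measureReal_mono hcover (measure_ne_top _ _)
    _ ≤ _ := (measureReal_union_le _ _).trans (by rw [mul_add]; exact add_le_add hP12 hP3)

end BatchEstimate

/-! ### Elimination and the regret on the good event -/

section GoodEvent

variable {d T : ℕ} {B b : ℝ} {𝒜 : Set (Act d)} {S : Choices d}

/-- The probability that a batch ends by round `T` with an inaccurate estimate: the sum of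
`Choices.Admissible.measure_state_inter_inaccurate_le` over the states before the batch. -/
theorem Choices.Admissible.measure_inaccurate_batch_le (hS : S.Admissible B 𝒜 T)
    (h𝒜 : 𝒜.Nonempty) (h𝒜1 : ∀ a ∈ 𝒜, ‖a‖ ≤ 1) (hT : 2 ≤ T) (hd : 1 ≤ d) (hb : 0 < b)
    (hlog : 2 * Real.log T ≤ (T : ℝ) ^ (0.025 : ℝ)) {θ : Act d} (hθ : ‖θ‖ ≤ 1)
    {Ω : Type*} [MeasurableSpace Ω] {P : Measure Ω} [IsProbabilityMeasure P]
    {z : ℕ → Act d → Ω → ℝ} {r : Fin T → Ω → ℝ} {act : Fin T → Ω → Act d}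
    (hz : IsLaplaceNoise P b z)
    (hact : ∀ t ω, act t ω = S.play T B b (fun s => r s ω) (fun s a => z s a ω) t)
    (hbandit : IsLinearBandit P θ r z act) {j : ℕ} (hj : j < numBatches T)
    (st : Ω → LearnerState d)
    (hst : st = fun ω => S.stateAfter T B b (fun k => if h : k < T then r ⟨k, h⟩ ω else 0)
      (fun s a => z s a ω) j) :
    P.real {ω | (st ω).played.length + (S.pulls (j + 1) (st ω).good).length ≤ T ∧
      ∃ α ∈ (st ω).good, confWidth d T B b (j + 1) (st ω).good <
        |⟪α, S.estimate T (fun k => if h : k < T then r ⟨k, h⟩ ω else 0)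
          (fun s a => z s a ω) (j + 1) (st ω)⟫ - ⟪α, θ⟫|} ≤
    1 / (2 * (T : ℝ) ^ 2) + 1 / (2 * T * Real.log T) := by
  set p : ℝ := 1 / (2 * (T : ℝ) ^ 2) + 1 / (2 * T * Real.log T) with hp
  have hT' : (2 : ℝ) ≤ T := by exact_mod_cast hT
  have hlT : 0 < Real.log T := Real.log_pos (by linarith)
  have hp0 : 0 ≤ p := by positivity
  set R := {s : LearnerState d | S.Reachable s ∧
    s.played.length + (S.pulls (j + 1) s.good).length ≤ T} with hR
  have hRc : R.Countable := S.countable_reachable.mono fun s hs => hs.1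
  have : Countable R := hRc.to_subtype
  set E : LearnerState d → Set Ω := fun s => {ω | st ω = s} with hE
  set Bad : LearnerState d → Set Ω := fun s => {ω | ∃ α ∈ s.good, confWidth d T B b (j + 1) s.good <
        |⟪α, S.estimate T (fun k => if h : k < T then r ⟨k, h⟩ ω else 0)
          (fun s a => z s a ω) (j + 1) s⟫ - ⟪α, θ⟫|} with hBad
  have hEm : ∀ s, MeasurableSet (E s) := fun s => by
    simp only [hE, hst]
    exact hS.measurableSet_stateAfter_eq h𝒜 hT hb.le (t := s.played.length)
      (rew := fun k ω => if h : k < T then r ⟨k, h⟩ ω else 0)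
      (fun k _ => measurable_extend fun h => hbandit.measurable _) (fun s _ a => hz.1 s a) j le_rfl
  have hdisj : Pairwise (Function.onFun Disjoint fun s : R => E s) := by
    intro s s' hss
    rw [Function.onFun, Set.disjoint_left]
    rintro ω h1 h2
    exact hss (Subtype.ext (h1.symm.trans h2))
  have hsub : {ω | (st ω).played.length + (S.pulls (j + 1) (st ω).good).length ≤ T ∧
      ω ∈ Bad (st ω)} ⊆ ⋃ s : R, E s ∩ Bad s := by
    rintro ω ⟨h1, h2⟩
    have hreach : S.Reachable (st ω) := by
      rw [hst]; exact hS.reachable_stateAfter h𝒜 hT hb.le _ _ j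
    exact Set.mem_iUnion.2 ⟨⟨st ω, hreach, h1⟩, rfl, h2⟩
  have hone : ∀ s : R, P (E s ∩ Bad s) ≤ P (E s) * ENNReal.ofReal p := fun s => by
    have h := hS.measure_state_inter_inaccurate_le h𝒜 h𝒜1 hT hd hb hlog hθ hz hact hbandit hj s.2.1
      s.2.2
    simp only [hE, hst, hBad]
    rw [← ofReal_measureReal, ← ofReal_measureReal, ← ENNReal.ofReal_mul measureReal_nonneg]
    exact ENNReal.ofReal_le_ofReal h
  have hfin : P {ω | (st ω).played.length + (S.pulls (j + 1) (st ω).good).length ≤ T ∧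
      ω ∈ Bad (st ω)} ≤ ENNReal.ofReal p := by
    calc _ ≤ ∑' s : R, P (E s ∩ Bad s) := (measure_mono hsub).trans (measure_iUnion_le _)
      _ ≤ ∑' s : R, P (E s) * ENNReal.ofReal p := ENNReal.tsum_le_tsum hone
      _ = P (⋃ s : R, E s) * ENNReal.ofReal p := by
          rw [ENNReal.tsum_mul_right, measure_iUnion hdisj fun s => hEm s]
      _ ≤ 1 * ENNReal.ofReal p := by gcongr; exact prob_le_one
      _ = _ := one_mul _
  exact ENNReal.toReal_le_of_le_ofReal hp0 hfin

theorem numBatches_le {T : ℕ} (hT : 1 ≤ Real.log T) : (numBatches T : ℝ) ≤ Real.log T - 1 :=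
  Nat.floor_le (by linarith)

/-- With probability at least `1 - 1 / T`, the estimates of all batches that end by round `T` are
accurate. -/
theorem Choices.Admissible.measure_accurate_ge (hS : S.Admissible B 𝒜 T)
    (h𝒜 : 𝒜.Nonempty) (h𝒜1 : ∀ a ∈ 𝒜, ‖a‖ ≤ 1) (hT : 2 ≤ T) (hlT : 1 ≤ Real.log T) (hd : 1 ≤ d)
    (hb : 0 < b) (hlog : 2 * Real.log T ≤ (T : ℝ) ^ (0.025 : ℝ)) {θ : Act d} (hθ : ‖θ‖ ≤ 1)
    {Ω : Type*} [MeasurableSpace Ω] {P : Measure Ω} [IsProbabilityMeasure P]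
    {z : ℕ → Act d → Ω → ℝ} {r : Fin T → Ω → ℝ} {act : Fin T → Ω → Act d}
    (hz : IsLaplaceNoise P b z)
    (hact : ∀ t ω, act t ω = S.play T B b (fun s => r s ω) (fun s a => z s a ω) t)
    (hbandit : IsLinearBandit P θ r z act) (st : ℕ → Ω → LearnerState d)
    (hst : st = fun j ω => S.stateAfter T B b (fun k => if h : k < T then r ⟨k, h⟩ ω else 0)
      (fun s a => z s a ω) j) :
    1 - 1 / (T : ℝ) ≤ P.real {ω | ∀ j < numBatches T, (st (j + 1) ω).played.length ≤ T →
      ∀ α ∈ (st j ω).good,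
        |⟪α, S.estimate T (fun k => if h : k < T then r ⟨k, h⟩ ω else 0)
          (fun s a => z s a ω) (j + 1) (st j ω)⟫ - ⟪α, θ⟫| ≤
        confWidth d T B b (j + 1) (st j ω).good} := by
  set G := {ω | ∀ j < numBatches T, (st (j + 1) ω).played.length ≤ T →
      ∀ α ∈ (st j ω).good,
        |⟪α, S.estimate T (fun k => if h : k < T then r ⟨k, h⟩ ω else 0)
          (fun s a => z s a ω) (j + 1) (st j ω)⟫ - ⟪α, θ⟫| ≤
        confWidth d T B b (j + 1) (st j ω).good} with hG
  have hT' : (2 : ℝ) ≤ T := by exact_mod_cast hT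
  have hbad : P.real Gᶜ ≤ 1 / T := by
    have hsub : Gᶜ ⊆ ⋃ j ∈ Finset.range (numBatches T),
        {ω | (st j ω).played.length + (S.pulls (j + 1) (st j ω).good).length ≤ T ∧
          ∃ α ∈ (st j ω).good, confWidth d T B b (j + 1) (st j ω).good <
          |⟪α, S.estimate T (fun k => if h : k < T then r ⟨k, h⟩ ω else 0)
            (fun s a => z s a ω) (j + 1) (st j ω)⟫ - ⟪α, θ⟫|} := by
      intro ω hω
      simp only [hG, Set.mem_compl_iff, Set.mem_ofPred_eq, not_forall, not_le] at hω
      obtain ⟨j, hj, hlen, α, hα, hlt⟩ := hω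
      simp only [Set.mem_iUnion, Finset.mem_range]
      refine ⟨j, hj, ?_, α, hα, hlt⟩
      rw [hst] at hlen ⊢
      rwa [← S.length_played_succ]
    have hlT2 : Real.log T ≤ T := Real.log_le_self (by positivity)
    calc P.real Gᶜ ≤ ∑ j ∈ Finset.range (numBatches T),
          (1 / (2 * (T : ℝ) ^ 2) + 1 / (2 * T * Real.log T)) := by
          refine (measureReal_mono hsub (measure_ne_top _ _)).trans
            ((measureReal_biUnion_finset_le _ _).trans ?_)
          exact Finset.sum_le_sum fun j hj => hS.measure_inaccurate_batch_le h𝒜 h𝒜1 hT hd hb hlog hθ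
            hz hact hbandit (Finset.mem_range.1 hj) (st j) (by rw [hst])
      _ = numBatches T * (1 / (2 * (T : ℝ) ^ 2) + 1 / (2 * T * Real.log T)) := by
          rw [Finset.sum_const, Finset.card_range, nsmul_eq_mul]
      _ ≤ Real.log T * (1 / (2 * (T : ℝ) ^ 2) + 1 / (2 * T * Real.log T)) := by
          have := numBatches_le hlT
          gcongr
          linarith
      _ = Real.log T / T * (1 / (2 * T)) + 1 / (2 * T) := by field_simp
      _ ≤ 1 * (1 / (2 * T)) + 1 / (2 * T) := by
          gcongr
          exact (div_le_one (by linarith)).2 hlT2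
      _ = 1 / T := by field_simp; ring
  have h1 : 1 ≤ P.real G + P.real Gᶜ := by
    have := measureReal_union_le (μ := P) G Gᶜ
    rwa [Set.union_compl_self, probReal_univ] at this
  linarith

end GoodEvent

section Elimination

variable {d T : ℕ} {B b : ℝ} {𝒜 : Set (Act d)} {S : Choices d}

theorem confWidth_mono (hT : 2 ≤ T) (hb : 0 ≤ b) {i : ℕ} {A A' : Finset (Act d)} (hA : A.Nonempty)
    (h : A ⊆ A') : confWidth d T B b i A ≤ confWidth d T B b i A' := by
  have hq := pow_pos (growth_pos hT) i
  have hT' : (2 : ℝ) ≤ T := by exact_mod_cast hT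
  have hc : (1 : ℝ) ≤ A.card := by exact_mod_cast hA.card_pos
  have hc' : (A.card : ℝ) ≤ A'.card := by exact_mod_cast Finset.card_le_card h
  have hlog : Real.log (4 * A.card * (T : ℝ) ^ 2) ≤ Real.log (4 * A'.card * (T : ℝ) ^ 2) := by
    apply Real.log_le_log (by positivity)
    gcongr
  unfold confWidth
  gcongr

/-- A bound on the gaps of the actions of batch `i + 1`, in terms of the width of batch `i`, taken
with the net `N` for the good set. It is `2` for the first batch. -/
noncomputable def gapBound (d T : ℕ) (B b : ℝ) (N : Finset (Act d)) (i : ℕ) : ℝ :=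
  if i = 0 then 2 else min 2 (4 * confWidth d T B b i N)

theorem gapBound_nonneg (hT : 2 ≤ T) (hB : 0 ≤ B) (hb : 0 ≤ b) {N : Finset (Act d)}
    (hN : N.Nonempty) (i : ℕ) : 0 ≤ gapBound d T B b N i := by
  have := confWidth_nonneg (d := d) (i := i) hT hB hb hN
  unfold gapBound
  split_ifs
  · norm_num
  · exact le_min (by norm_num) (by linarith)

/-- The sum over `T` rounds that play the list `l`, cut off after `T` elements, and then `x`. -/
theorem sum_range_getD_le {α : Type*} {f : α → ℝ} {c : ℝ} (hc : 0 ≤ c) (x : α) (l : List α) (T : ℕ)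
    (h : l.length < T → f x ≤ c) :
    ∑ t ∈ Finset.range T, f (l.getD t x) ≤ ((l.take T).map f).sum + T * c := by
  induction l generalizing T with
  | nil =>
    rcases Nat.eq_zero_or_pos T with rfl | hT
    · simp
    · simpa using mul_le_mul_of_nonneg_left (h hT) (Nat.cast_nonneg T)
  | cons a l ih =>
    rcases T with _ | T
    · simp
    · rw [Finset.sum_range_succ']
      have := ih T fun hlt => h (by simpa using hlt)
      simp only [List.getD_cons_succ, List.getD_cons_zero, List.take_succ_cons, List.map_cons,
        List.sum_cons]
      push_cast
      linarith

/-- If the estimates are accurate, then an optimal action of the net is never eliminated, and the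
surviving actions are close to optimal. -/
theorem Choices.Admissible.good_of_accurate (hS : S.Admissible B 𝒜 T) (h𝒜 : 𝒜.Nonempty)
    (hT : 2 ≤ T) (hb : 0 ≤ b) {θ : Act d} {rew : ℕ → ℝ} {z : ℕ → Act d → ℝ} {a₀ : Act d}
    (ha₀ : a₀ ∈ S.net)
    (hacc : ∀ j < numBatches T, (S.stateAfter T B b rew z (j + 1)).played.length ≤ T →
      ∀ α ∈ (S.stateAfter T B b rew z j).good,
        |⟪α, S.estimate T rew z (j + 1) (S.stateAfter T B b rew z j)⟫ - ⟪α, θ⟫| ≤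
        confWidth d T B b (j + 1) (S.stateAfter T B b rew z j).good)
    (hmax : ∀ a ∈ S.net, ⟪a, θ⟫ ≤ ⟪a₀, θ⟫) {j : ℕ} (hj : j ≤ numBatches T)
    (hlen : (S.stateAfter T B b rew z j).played.length ≤ T) :
    a₀ ∈ (S.stateAfter T B b rew z j).good ∧ (1 ≤ j →
      (∀ a ∈ (S.stateAfter T B b rew z j).good,
        ⟪a₀, θ⟫ - ⟪a, θ⟫ ≤ 4 * confWidth d T B b j S.net) ∧
      ∀ a ∈ (S.stateAfter T B b rew z j).best,
        ⟪a₀, θ⟫ - ⟪a, θ⟫ ≤ 2 * confWidth d T B b j S.net) := by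
  classical
  induction j with
  | zero => exact ⟨ha₀, fun h => by omega⟩
  | succ j ih =>
    obtain ⟨hmem, -⟩ := ih (by omega) ((S.length_played_le_succ rew z j).trans hlen)
    have hacc' := hacc j (by omega) hlen
    have hreach := hS.reachable_stateAfter h𝒜 hT hb rew z j
    have hγ := confWidth_mono (d := d) (B := B) (i := j + 1) hT hb hreach.good_nonempty
      hreach.good_subset
    set s := S.stateAfter T B b rew z j with hs
    set γ := confWidth d T B b (j + 1) s.good with hγdef
    set e := S.estimate T rew z (j + 1) s with he
    have hgood : ∀ a, a ∈ (S.stateAfter T B b rew z (j + 1)).good ↔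
        a ∈ s.good ∧ ∀ α ∈ s.good, ⟪α, e⟫ - 2 * γ ≤ ⟪a, e⟫ := fun a => Finset.mem_filter
    have hbest : ∀ a, a ∈ (S.stateAfter T B b rew z (j + 1)).best ↔
        a ∈ s.good ∧ ∀ α ∈ s.good, ⟪α, e⟫ ≤ ⟪a, e⟫ := fun a => Finset.mem_filter
    have h0 := abs_le.1 (hacc' a₀ hmem)
    refine ⟨(hgood _).2 ⟨hmem, fun α hα => ?_⟩, fun _ => ⟨fun a ha => ?_, fun a ha => ?_⟩⟩
    · have h1 := abs_le.1 (hacc' α hα)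
      have h2 := hmax α (hreach.good_subset hα)
      linarith [h1.2, h0.1]
    · obtain ⟨ha1, ha2⟩ := (hgood a).1 ha
      have h1 := abs_le.1 (hacc' a ha1)
      have h2 := ha2 a₀ hmem
      linarith [h1.2, h0.1]
    · obtain ⟨ha1, ha2⟩ := (hbest a).1 ha
      have h1 := abs_le.1 (hacc' a ha1)
      have h2 := ha2 a₀ hmem
      linarith [h1.2, h0.1]

/-- The sum of the gaps of the rounds that belong to the first `j` batches. -/
theorem Choices.Admissible.sum_gaps_le (hS : S.Admissible B 𝒜 T) (h𝒜 : 𝒜.Nonempty)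
    (hT : 2 ≤ T) (hd : 1 ≤ d) (hb : 0 ≤ b) {θ : Act d} {rew : ℕ → ℝ} {z : ℕ → Act d → ℝ} {a₀ : Act d}
    (ha₀ : a₀ ∈ S.net)
    (hacc : ∀ j < numBatches T, (S.stateAfter T B b rew z (j + 1)).played.length ≤ T →
      ∀ α ∈ (S.stateAfter T B b rew z j).good,
        |⟪α, S.estimate T rew z (j + 1) (S.stateAfter T B b rew z j)⟫ - ⟪α, θ⟫| ≤
        confWidth d T B b (j + 1) (S.stateAfter T B b rew z j).good)
    (hmax : ∀ a ∈ S.net, ⟪a, θ⟫ ≤ ⟪a₀, θ⟫) (h2 : ∀ a ∈ S.net, ⟪a₀, θ⟫ - ⟪a, θ⟫ ≤ 2) {j : ℕ}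
    (hj : j ≤ numBatches T) :
    (((S.stateAfter T B b rew z j).played.take T).map fun a => ⟪a₀, θ⟫ - ⟪a, θ⟫).sum ≤
      ∑ i ∈ Finset.range j, (growth T ^ (i + 1) + B * d) * gapBound d T B b S.net i := by
  have hB := hS.one_le h𝒜
  induction j with
  | zero => simp [Choices.stateAfter]
  | succ j ih =>
    have ih := ih (by omega)
    have hreach := hS.reachable_stateAfter h𝒜 hT hb rew z j
    set s := S.stateAfter T B b rew z j with hs
    have hplayed : (S.stateAfter T B b rew z (j + 1)).played =
      s.played ++ S.pulls (j + 1) s.good := rfl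
    have hg := gapBound_nonneg (d := d) (B := B) hT (by linarith) hb (hS.net_nonempty h𝒜) j
    have hq := pow_pos (growth_pos hT) (j + 1)
    rw [hplayed, List.take_append, List.map_append, List.sum_append, Finset.sum_range_succ]
    refine add_le_add ih ?_
    -- a batch that starts after round `T` does not contribute
    rcases le_or_gt s.played.length T with hlen | hlen
    · have hgap : ∀ a ∈ s.good, ⟪a₀, θ⟫ - ⟪a, θ⟫ ≤ gapBound d T B b S.net j := by
        intro a ha
        unfold gapBound
        split_ifs with h0
        · exact h2 a (hreach.good_subset ha)
        · refine le_min (h2 a (hreach.good_subset ha)) ?_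
          exact ((hS.good_of_accurate h𝒜 hT hb ha₀ hacc hmax (by omega : j ≤ numBatches T) hlen).2
            (by omega)).1 a ha
      have h1 := List.sum_le_card_nsmul
        (((S.pulls (j + 1) s.good).take (T - s.played.length)).map fun a => ⟪a₀, θ⟫ - ⟪a, θ⟫)
        (gapBound d T B b S.net j) (by
          intro x hx
          obtain ⟨a, ha, rfl⟩ := List.mem_map.1 hx
          exact hgap a (hS.core_subset (by omega) hreach.good_subset hreach.good_nonempty
            (hS.mem_core_of_mem_pulls (by omega) hreach.good_subset hreach.good_nonempty
              (List.mem_of_mem_take ha))))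
      refine h1.trans ?_
      rw [nsmul_eq_mul]
      refine mul_le_mul_of_nonneg_right ?_ hg
      have h3 := hS.length_pulls_le hT (i := j + 1) (by omega) hreach.good_subset
        hreach.good_nonempty
      have h4 : ((max 1 (spanDim s.good) : ℕ) : ℝ) ≤ d := by
        exact_mod_cast max_le hd (spanDim_le s.good)
      rw [List.length_map]
      have h5 : (((S.pulls (j + 1) s.good).take (T - s.played.length)).length : ℝ) ≤
          (S.pulls (j + 1) s.good).length := by
        exact_mod_cast List.length_take_le' _ _
      calc _ ≤ _ := h5
        _ ≤ _ := h3
        _ ≤ _ := by gcongr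
    · have : T - s.played.length = 0 := by omega
      rw [this]
      simp only [List.take_zero, List.map_nil, List.sum_nil]
      positivity

/-- The regret of a run with accurate estimates, as a sum over the batches and the remaining rounds.
The term `1` is the price of the net. -/
theorem Choices.Admissible.regret_le (hS : S.Admissible B 𝒜 T) (h𝒜 : 𝒜.Nonempty)
    (h𝒜1 : ∀ a ∈ 𝒜, ‖a‖ ≤ 1) (hT : 2 ≤ T) (hK : 1 ≤ numBatches T) (hd : 1 ≤ d) (hb : 0 ≤ b)
    {θ : Act d} (hθ : ‖θ‖ ≤ 1) {R : Fin T → ℝ} {rew : ℕ → ℝ} {z : ℕ → Act d → ℝ}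
    (hrew : rew = fun k => if h : k < T then R ⟨k, h⟩ else 0)
    (hacc : ∀ j < numBatches T, (S.stateAfter T B b rew z (j + 1)).played.length ≤ T →
      ∀ α ∈ (S.stateAfter T B b rew z j).good,
        |⟪α, S.estimate T rew z (j + 1) (S.stateAfter T B b rew z j)⟫ - ⟪α, θ⟫| ≤
        confWidth d T B b (j + 1) (S.stateAfter T B b rew z j).good) :
    regret 𝒜 θ (S.play T B b R z) ≤ 1 + (∑ i ∈ Finset.range (numBatches T),
      (growth T ^ (i + 1) + B * d) * gapBound d T B b S.net i +
      T * (2 * confWidth d T B b (numBatches T) S.net)) := by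
  have hB := hS.one_le h𝒜
  have hT' : (2 : ℝ) ≤ T := by exact_mod_cast hT
  obtain ⟨a₀, ha₀, hmax⟩ := S.net.exists_max_image (fun a => ⟪a, θ⟫) (hS.net_nonempty h𝒜)
  have hnorm : ∀ a ∈ 𝒜, |⟪a, θ⟫| ≤ 1 := fun a ha => (abs_real_inner_le_norm _ _).trans
    (mul_le_one₀ (h𝒜1 a ha) (norm_nonneg _) hθ)
  have h2 : ∀ a ∈ S.net, ⟪a₀, θ⟫ - ⟪a, θ⟫ ≤ 2 := fun a ha => by
    have h1 := abs_le.1 (hnorm a (hS.net_spec.1 ha))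
    have h3 := abs_le.1 (hnorm a₀ (hS.net_spec.1 ha₀))
    linarith [h1.1, h3.2]
  have hsup : sSup ((fun a => ⟪θ, a⟫) '' 𝒜) ≤ ⟪a₀, θ⟫ + 1 / T := by
    apply csSup_le (h𝒜.image _)
    rintro _ ⟨a, ha, rfl⟩
    obtain ⟨a', ha', hdist⟩ := hS.net_spec.2.1 a ha
    have h1 : ⟪θ, a⟫ = ⟪a', θ⟫ - ⟪a' - a, θ⟫ := by
      rw [inner_sub_left, real_inner_comm]; ring
    have h3 : |⟪a' - a, θ⟫| ≤ 1 / T := by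
      refine (abs_real_inner_le_norm _ _).trans ?_
      calc ‖a' - a‖ * ‖θ‖ ≤ ‖a' - a‖ * 1 := by gcongr
        _ ≤ _ := by rw [mul_one]; exact hdist
    have h4 := hmax a' ha'
    simp only at h4 ⊢
    rw [h1]
    linarith [(abs_le.1 h3).1]
  set K := numBatches T with hKdef
  set s := S.stateAfter T B b rew z K with hs
  have hplay : ∀ t : Fin T, S.play T B b R z t = s.played.getD t (S.tie s.best) := fun t => by
    rw [hs, hrew]; rfl
  have hγ := confWidth_nonneg (d := d) (i := K) hT (by linarith : 0 ≤ B) hb (hS.net_nonempty h𝒜)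
  have hsum : ∑ t : Fin T, (⟪a₀, θ⟫ - ⟪S.play T B b R z t, θ⟫) ≤
      ((s.played.take T).map fun a => ⟪a₀, θ⟫ - ⟪a, θ⟫).sum +
        T * (2 * confWidth d T B b K S.net) := by
    simp only [hplay]
    rw [← Finset.sum_range fun t => ⟪a₀, θ⟫ - ⟪s.played.getD t (S.tie s.best), θ⟫]
    refine sum_range_getD_le (f := fun a => ⟪a₀, θ⟫ - ⟪a, θ⟫) (by positivity) _ _ _ fun hlt => ?_
    exact ((hS.good_of_accurate h𝒜 hT hb ha₀ hacc hmax le_rfl hlt.le).2 hK).2 _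
      (hS.tie_mem h𝒜 hT hb rew z K)
  have hgaps := hS.sum_gaps_le h𝒜 hT hd hb ha₀ hacc hmax h2 (le_refl K)
  have hreg : regret 𝒜 θ (S.play T B b R z) ≤
      1 + ∑ t : Fin T, (⟪a₀, θ⟫ - ⟪S.play T B b R z t, θ⟫) := by
    rw [regret, Finset.sum_sub_distrib]
    have e1 : ∑ t : Fin T, ⟪S.play T B b R z t, θ⟫ = ∑ t : Fin T, ⟪θ, S.play T B b R z t⟫ :=
      Finset.sum_congr rfl fun t _ => real_inner_comm _ _
    rw [e1]
    simp only [Finset.sum_const, Finset.card_univ, Fintype.card_fin, nsmul_eq_mul]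
    have h5 := mul_le_mul_of_nonneg_left hsup (by positivity : (0 : ℝ) ≤ T)
    have h6 : (T : ℝ) * (⟪a₀, θ⟫ + 1 / T) = T * ⟪a₀, θ⟫ + 1 := by field_simp
    linarith
  linarith

/-- The trivial bound on the regret. -/
theorem Choices.Admissible.regret_le_two_mul (hS : S.Admissible B 𝒜 T) (h𝒜 : 𝒜.Nonempty)
    (h𝒜1 : ∀ a ∈ 𝒜, ‖a‖ ≤ 1) (hT : 2 ≤ T) (hb : 0 ≤ b)
    {θ : Act d} (hθ : ‖θ‖ ≤ 1) (R : Fin T → ℝ) (z : ℕ → Act d → ℝ) :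
    regret 𝒜 θ (S.play T B b R z) ≤ 2 * T := by
  have hnorm : ∀ a ∈ 𝒜, |⟪θ, a⟫| ≤ 1 := fun a ha => (abs_real_inner_le_norm _ _).trans
    (mul_le_one₀ hθ (norm_nonneg _) (h𝒜1 a ha))
  have hsup : sSup ((fun a => ⟪θ, a⟫) '' 𝒜) ≤ 1 := by
    apply csSup_le (h𝒜.image _)
    rintro _ ⟨a, ha, rfl⟩
    exact (abs_le.1 (hnorm a ha)).2
  have hsum : ∑ t : Fin T, (-1 : ℝ) ≤ ∑ t : Fin T, ⟪θ, S.play T B b R z t⟫ :=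
    Finset.sum_le_sum fun t _ =>
      (abs_le.1 (hnorm _ (hS.net_spec.1 (hS.play_mem_net h𝒜 hT hb R z t)))).1
  simp only [Finset.sum_const, Finset.card_univ, Fintype.card_fin, nsmul_eq_mul] at hsum
  rw [regret]
  have := mul_le_mul_of_nonneg_left hsup (by positivity : (0 : ℝ) ≤ T)
  linarith

end Elimination

/-! ### Asymptotics -/

section Numerics

theorem log_growth {T : ℕ} (hT : 2 ≤ T) :
    Real.log (growth T) = 1 / Real.log T * (Real.log 2 + Real.log T) := by
  have hT' : (2 : ℝ) ≤ T := by exact_mod_cast hT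
  rw [growth, Real.log_rpow (by positivity), Real.log_mul (by norm_num) (by positivity)]

theorem one_le_log_growth {T : ℕ} (hT : 2 ≤ T) : 1 ≤ Real.log (growth T) := by
  have hT' : (2 : ℝ) ≤ T := by exact_mod_cast hT
  have hl : 0 < Real.log T := Real.log_pos (by linarith)
  have h2 : 0 ≤ Real.log 2 := Real.log_nonneg (by norm_num)
  rw [log_growth hT, one_div, inv_mul_eq_div, le_div_iff₀ hl]
  linarith

theorem exp_one_le_growth {T : ℕ} (hT : 2 ≤ T) : Real.exp 1 ≤ growth T :=
  (Real.le_log_iff_exp_le (growth_pos hT)).1 (one_le_log_growth hT)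

theorem growth_le_six {T : ℕ} (hT : 2 ≤ T) (hl : 1 ≤ Real.log T) : growth T ≤ 6 := by
  have h2 : Real.log (growth T) ≤ Real.log 2 + 1 := by
    rw [log_growth hT, mul_add, one_div, inv_mul_cancel₀ (by linarith)]
    have h3 : (Real.log T)⁻¹ ≤ 1 := inv_le_one_of_one_le₀ hl
    have : 0 ≤ Real.log 2 := Real.log_nonneg (by norm_num)
    nlinarith
  have h3 : growth T ≤ Real.exp (Real.log 2 + 1) :=
    (Real.log_le_iff_le_exp (growth_pos hT)).1 h2
  rw [Real.exp_add, Real.exp_log (by norm_num)] at h3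
  have := Real.exp_one_lt_d9
  linarith

theorem growth_pow_numBatches_le {T : ℕ} (hT : 2 ≤ T) (hl : 1 ≤ Real.log T) :
    growth T ^ numBatches T ≤ 2 * T := by
  have hT' : (2 : ℝ) ≤ T := by exact_mod_cast hT
  rw [← Real.log_le_log_iff (pow_pos (growth_pos hT) _) (by positivity), Real.log_pow,
    Real.log_mul (by norm_num) (by positivity)]
  have h1 := numBatches_le hl
  have h2 : Real.log (growth T) * Real.log T = Real.log 2 + Real.log T := by
    rw [log_growth hT]; field_simp
  have h3 := one_le_log_growth hT
  nlinarith

theorem le_growth_pow_numBatches {T : ℕ} (hT : 2 ≤ T) :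
    (T : ℝ) ≤ 9 * growth T ^ numBatches T := by
  have hT' : (2 : ℝ) ≤ T := by exact_mod_cast hT
  have h1 : Real.log T - 2 ≤ numBatches T := by
    have := Nat.lt_floor_add_one (Real.log T - 1)
    have e : (numBatches T : ℝ) = (⌊Real.log T - 1⌋₊ : ℝ) := rfl
    linarith
  have h2 : Real.exp (numBatches T) ≤ growth T ^ numBatches T := by
    rw [← mul_one (numBatches T : ℝ), Real.exp_nat_mul]
    exact pow_le_pow_left₀ (Real.exp_pos 1).le (exp_one_le_growth hT) _
  have h3 : (T : ℝ) = Real.exp (Real.log T - 2) * Real.exp 1 ^ 2 := by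
    rw [← Real.exp_nat_mul, ← Real.exp_add]
    norm_num
    rw [Real.exp_log (by linarith)]
  have h4 : Real.exp 1 ^ 2 ≤ 9 := by
    have := Real.exp_one_lt_d9
    have h0 := Real.exp_pos 1
    nlinarith
  rw [h3]
  calc Real.exp (Real.log T - 2) * Real.exp 1 ^ 2 ≤ growth T ^ numBatches T * 9 := by
        exact mul_le_mul ((Real.exp_le_exp.2 h1).trans h2) h4 (by positivity)
          (pow_nonneg (growth_pos hT).le _)
    _ = _ := mul_comm _ _

theorem sum_pow_le_three_mul {x : ℝ} (hx : 3 / 2 ≤ x) (n : ℕ) :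
    ∑ i ∈ Finset.range n, x ^ (i + 1) ≤ 3 * x ^ n := by
  induction n with
  | zero => simp
  | succ n ih =>
    rw [Finset.sum_range_succ]
    have : 0 < x ^ n := by positivity
    rw [pow_succ]
    nlinarith

theorem log_card_net_le {d T : ℕ} (hd : 1 ≤ d) (hT : 8 ≤ T) {N : Finset (Act d)}
    (hN0 : N.Nonempty) (hN : (N.card : ℝ) ≤ (3 / (1 / (T : ℝ))) ^ d + d) :
    Real.log (4 * N.card * (T : ℝ) ^ 2) ≤ 5 * d * Real.log T := by
  have hT' : (8 : ℝ) ≤ T := by exact_mod_cast hT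
  have hd' : (1 : ℝ) ≤ d := by exact_mod_cast hd
  have hl : 0 ≤ Real.log T := Real.log_nonneg (by linarith)
  have hc : (1 : ℝ) ≤ N.card := by exact_mod_cast hN0.card_pos
  have h1 : (3 / (1 / (T : ℝ))) ^ d ≤ ((T : ℝ) ^ 2) ^ d := by
    apply pow_le_pow_left₀ (by positivity)
    rw [one_div, div_inv_eq_mul]
    nlinarith
  have h2 : (d : ℝ) ≤ ((T : ℝ) ^ 2) ^ d := by
    have : d < 2 ^ d := Nat.lt_two_pow_self
    calc (d : ℝ) ≤ 2 ^ d := by exact_mod_cast this.le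
      _ ≤ _ := pow_le_pow_left₀ (by norm_num) (by nlinarith) _
  have h3 : 4 * N.card * (T : ℝ) ^ 2 ≤ (T : ℝ) ^ (2 * d + 3) := by
    calc 4 * N.card * (T : ℝ) ^ 2 ≤ 4 * (((T : ℝ) ^ 2) ^ d + ((T : ℝ) ^ 2) ^ d) * (T : ℝ) ^ 2 := by
          gcongr
          linarith
      _ = 8 * ((T : ℝ) ^ 2) ^ d * (T : ℝ) ^ 2 := by ring
      _ ≤ T * ((T : ℝ) ^ 2) ^ d * (T : ℝ) ^ 2 := by gcongr
      _ = _ := by rw [← pow_mul]; ring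
  calc Real.log (4 * N.card * (T : ℝ) ^ 2) ≤ Real.log ((T : ℝ) ^ (2 * d + 3)) :=
        Real.log_le_log (by positivity) h3
    _ = (2 * d + 3) * Real.log T := by rw [Real.log_pow]; push_cast; ring
    _ ≤ _ := by gcongr; linarith

/-- The sum over the batches in `Choices.Admissible.regret_le`. The square root parts of the widths
give a geometric sum, and each noise part contributes the same amount. -/
theorem sum_gapBound_le {d T : ℕ} {B b : ℝ} (hd : 1 ≤ d) (hB : 0 ≤ B) (hb : 0 ≤ b) (hT : 8 ≤ T)
    (hl : 2 ≤ Real.log T) {N : Finset (Act d)}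
    (hN0 : N.Nonempty) (hN : (N.card : ℝ) ≤ (3 / (1 / (T : ℝ))) ^ d + d) :
    ∑ i ∈ Finset.range (numBatches T), (growth T ^ (i + 1) + B * d) * gapBound d T B b N i +
      T * (2 * confWidth d T B b (numBatches T) N) ≤
    12 + 2 * B * d * Real.log T + 24 * (21 * (d * Real.sqrt (T * Real.log T)) +
      Real.log T * ((2 * B * d ^ 2 + 10 * d ^ 2 * Real.log T) * b)) := by
  set q := growth T with hq
  set K := numBatches T with hK
  set L := Real.log (4 * N.card * (T : ℝ) ^ 2) with hL
  set D := (2 * B * (d : ℝ) ^ 2 + 2 * d * L) * b with hD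
  set G : ℕ → ℝ := fun i => confWidth d T B b i N with hG
  have hT2 : 2 ≤ T := by omega
  have hT' : (8 : ℝ) ≤ T := by exact_mod_cast hT
  have hd' : (1 : ℝ) ≤ d := by exact_mod_cast hd
  have hc : (1 : ℝ) ≤ N.card := by exact_mod_cast hN0.card_pos
  have hL0 : 0 ≤ L := Real.log_nonneg (by nlinarith [sq_nonneg (T : ℝ)])
  have hL5 : L ≤ 5 * d * Real.log T := log_card_net_le hd hT hN0 hN
  have hqpos : 0 < q := growth_pos hT2
  have hq6 : q ≤ 6 := growth_le_six hT2 (by linarith)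
  have hG0 : ∀ i, 0 ≤ G i := fun i => confWidth_nonneg hT2 hB hb hN0
  have hK1 : 1 ≤ K := Nat.le_floor (by push_cast; linarith)
  have hKl : (K : ℝ) ≤ Real.log T - 1 := numBatches_le (by linarith)
  have hD0 : 0 ≤ D := by positivity
  -- the contribution of one width
  have hqG : ∀ i, q ^ i * G i = Real.sqrt (4 * d * L) * Real.sqrt q ^ i + D := fun i => by
    have hqi : 0 < q ^ i := by positivity
    have h1 : Real.sqrt q ^ i = Real.sqrt (q ^ i) := by
      rw [Real.sqrt_eq_rpow, Real.sqrt_eq_rpow, ← Real.rpow_natCast, ← Real.rpow_natCast,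
        ← Real.rpow_mul hqpos.le, ← Real.rpow_mul hqpos.le, mul_comm]
    have h2 : Real.sqrt (4 * d / q ^ i * L) = Real.sqrt (4 * d * L) / Real.sqrt (q ^ i) := by
      rw [← Real.sqrt_div (by positivity)]; congr 1; ring
    simp only [hG, confWidth]
    rw [← hq, ← hL, h1, h2, mul_add]
    congr 1
    · have h3 := Real.mul_self_sqrt hqi.le
      rw [mul_div_assoc', div_eq_iff (Real.sqrt_pos.2 hqi).ne']
      linear_combination (-Real.sqrt (4 * d * L)) * h3
    · rw [hD]; field_simp
  have hx : 3 / 2 ≤ Real.sqrt q := by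
    apply Real.le_sqrt_of_sq_le
    have := exp_one_le_growth hT2
    have := Real.exp_one_gt_d9
    norm_num; linarith
  have hsumG : ∑ i ∈ Finset.range K, q ^ (i + 1) * G (i + 1) ≤
      21 * (d * Real.sqrt (T * Real.log T)) +
        Real.log T * ((2 * B * d ^ 2 + 10 * d ^ 2 * Real.log T) * b) := by
    simp only [hqG]
    rw [Finset.sum_add_distrib, ← Finset.mul_sum, Finset.sum_const, Finset.card_range, nsmul_eq_mul]
    refine add_le_add ?_ ?_
    · have h1 : Real.sqrt q ^ K ≤ Real.sqrt (2 * T) := by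
        apply Real.le_sqrt_of_sq_le
        rw [← pow_mul, mul_comm, pow_mul, Real.sq_sqrt hqpos.le]
        exact growth_pow_numBatches_le hT2 (by linarith)
      calc Real.sqrt (4 * d * L) * ∑ i ∈ Finset.range K, Real.sqrt q ^ (i + 1)
          ≤ Real.sqrt (4 * d * (5 * d * Real.log T)) * (3 * Real.sqrt (2 * T)) := by
            gcongr
            exact (sum_pow_le_three_mul hx K).trans (by gcongr)
        _ = 3 * Real.sqrt (4 * d * (5 * d * Real.log T) * (2 * T)) := by
            rw [Real.sqrt_mul (by positivity) (2 * (T : ℝ))]; ring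
        _ ≤ 3 * Real.sqrt ((7 * d) ^ 2 * (T * Real.log T)) := by
            refine mul_le_mul_of_nonneg_left (Real.sqrt_le_sqrt ?_) (by norm_num)
            have : 0 ≤ (d : ℝ) ^ 2 * (T * Real.log T) := by positivity
            nlinarith
        _ = _ := by
            rw [Real.sqrt_mul (by positivity), Real.sqrt_sq (by positivity)]; ring
    · have : D ≤ (2 * B * d ^ 2 + 10 * d ^ 2 * Real.log T) * b := by
        rw [hD]
        apply mul_le_mul_of_nonneg_right _ hb
        nlinarith
      gcongr
      linarith
  -- the batches
  have hbatch : ∑ i ∈ Finset.range K, (q ^ (i + 1) + B * d) * gapBound d T B b N i ≤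
      2 * q + 2 * B * d * K + 4 * q * ∑ i ∈ Finset.range (K - 1), q ^ (i + 1) * G (i + 1) := by
    obtain ⟨k, hk⟩ : ∃ k, K = k + 1 := ⟨K - 1, by omega⟩
    rw [hk, Finset.sum_range_succ', Nat.add_sub_cancel]
    have h0 : gapBound d T B b N 0 = 2 := by simp [gapBound]
    have h1 : ∀ i, (q ^ (i + 1 + 1) + B * d) * gapBound d T B b N (i + 1) ≤
        4 * q * (q ^ (i + 1) * G (i + 1)) + 2 * B * d := fun i => by
      have e : gapBound d T B b N (i + 1) = min 2 (4 * G (i + 1)) := by simp [gapBound, hG]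
      rw [e, add_mul]
      refine add_le_add ?_ ?_
      · calc q ^ (i + 1 + 1) * min 2 (4 * G (i + 1)) ≤ q ^ (i + 1 + 1) * (4 * G (i + 1)) := by
              gcongr; exact min_le_right _ _
          _ = _ := by ring
      · calc B * d * min 2 (4 * G (i + 1)) ≤ B * d * 2 := by gcongr; exact min_le_left _ _
          _ = _ := by ring
    calc _ ≤ ∑ i ∈ Finset.range k, (4 * q * (q ^ (i + 1) * G (i + 1)) + 2 * B * d) +
          (q ^ (0 + 1) + B * d) * 2 := by
          rw [h0]
          gcongr with i _
          exact h1 i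
      _ = _ := by
          rw [Finset.sum_add_distrib, ← Finset.mul_sum, Finset.sum_const, Finset.card_range,
            nsmul_eq_mul]
          push_cast; ring
  have hlast : T * (2 * G K) ≤ 18 * (q ^ K * G K) := by
    have h1 := le_growth_pow_numBatches hT2
    have h2 := mul_le_mul_of_nonneg_right h1 (hG0 K)
    rw [← hq, ← hK] at h2
    linarith
  have hsplit : ∑ i ∈ Finset.range K, q ^ (i + 1) * G (i + 1) =
      ∑ i ∈ Finset.range (K - 1), q ^ (i + 1) * G (i + 1) + q ^ K * G K := by
    obtain ⟨k, hk⟩ : ∃ k, K = k + 1 := ⟨K - 1, by omega⟩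
    rw [hk, Finset.sum_range_succ, Nat.add_sub_cancel]
  set W := ∑ i ∈ Finset.range (K - 1), q ^ (i + 1) * G (i + 1) with hW
  have hW0 : 0 ≤ W := Finset.sum_nonneg fun i _ => mul_nonneg (by positivity) (hG0 _)
  have hlast0 : 0 ≤ q ^ K * G K := mul_nonneg (by positivity) (hG0 _)
  have h5 : 4 * q * W ≤ 24 * W := by nlinarith
  have h6 : 2 * B * d * K ≤ 2 * B * d * Real.log T := by gcongr; linarith
  have h7 : T * (2 * confWidth d T B b K N) = T * (2 * G K) := rfl
  rw [h7]
  linarith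

end Numerics

theorem theorem1 :
    -- the algorithm is well defined: nets and core sets of the required sizes exist
    (∃ B₀ : ℝ, ∀ B ≥ B₀, ∀ (d : ℕ) (𝒜 : Set (Act d)), 𝒜.Nonempty → (∀ a ∈ 𝒜, ‖a‖ ≤ 1) →
      ∀ T : ℕ, 2 ≤ T → ∃ S : Choices d, S.Admissible B 𝒜 T) ∧
    -- privacy and regret; `Δ` bounds the change of one reward and the noise is `Lap(Δ/ε)`
    ∀ B : ℝ, ∃ C : ℝ, ∀ (d : ℕ) (𝒜 : Set (Act d)), 𝒜.Nonempty → (∀ a ∈ 𝒜, ‖a‖ ≤ 1) →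
      ∀ T : ℕ, 2 ≤ T → ∀ ε : ℝ, 0 < ε → ∀ Δ : ℝ, 0 < Δ → Δ ≤ 2 →
      ∀ S : Choices d, S.Admissible B 𝒜 T →
        (∀ (Ω : Type*) [MeasurableSpace Ω] (P : Measure Ω) [IsProbabilityMeasure P]
          (z : ℕ → Act d → Ω → ℝ), IsLaplaceNoise P (Δ / ε) z →
          IsDP P (fun R ω => S.play T B (Δ / ε) R (fun t a => z t a ω)) Δ ε 0) ∧
        (∀ (θ : Act d), ‖θ‖ ≤ 1 →
          ∀ (Ω : Type*) [MeasurableSpace Ω] (P : Measure Ω) [IsProbabilityMeasure P]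
            (z : ℕ → Act d → Ω → ℝ) (r : Fin T → Ω → ℝ) (act : Fin T → Ω → Act d),
            IsLaplaceNoise P (Δ / ε) z →
            (∀ t ω, act t ω = S.play T B (Δ / ε) (fun s => r s ω) (fun s a => z s a ω) t) →
            IsLinearBandit P θ r z act →
            1 - 1 / (T : ℝ) ≤ P.real {ω | regret 𝒜 θ (fun t => act t ω) ≤
              C * (d * Real.sqrt (T * Real.log T) +
                (d : ℝ) ^ 2 * Real.log T ^ 2 / ε)}) := by
  refine ⟨⟨12, fun B hB d 𝒜 _ h𝒜1 T hT => exists_admissible hB h𝒜1 hT⟩, fun B => ?_⟩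
  -- the threshold for `T` from which on the noise events are rare enough
  obtain ⟨T₀, hT₀⟩ : ∃ T₀ : ℕ, ∀ T : ℕ, T₀ ≤ T → 2 * Real.log T ≤ (T : ℝ) ^ (0.025 : ℝ) := by
    have h := (isLittleO_log_rpow_atTop (r := 0.025) (by norm_num)).bound
      (c := 1 / 2) (by norm_num)
    have h2 := tendsto_natCast_atTop_atTop (R := ℝ) |>.eventually h
    obtain ⟨T₀, h3⟩ := Filter.eventually_atTop.1 h2
    refine ⟨T₀, fun T hT => ?_⟩
    have h4 := h3 T hT
    rw [Real.norm_eq_abs, Real.norm_of_nonneg (by positivity)] at h4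
    have := le_abs_self (Real.log T)
    linarith
  refine ⟨2 * (T₀ + 9) + 1000 + 200 * |B|, fun d 𝒜 h𝒜 h𝒜1 T hT ε hε Δ hΔ hΔ2 S hS =>
    ⟨fun Ω _ P _ z hz => hS.isDP h𝒜 hT hε hΔ P hz,
      fun θ hθ Ω _ P _ z r act hz hact hbandit => ?_⟩⟩
  have hb : 0 < Δ / ε := by positivity
  have hT' : (2 : ℝ) ≤ T := by exact_mod_cast hT
  have hactω : ∀ ω, (fun t => act t ω) =
      S.play T B (Δ / ε) (fun s => r s ω) (fun s a => z s a ω) := fun ω => funext fun t => hact t ω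
  have hl0 : 0 < Real.log T := Real.log_pos (by linarith)
  have hall : ∀ X : ℝ, (∀ ω, regret 𝒜 θ (fun t => act t ω) ≤ X) →
      1 - 1 / (T : ℝ) ≤ P.real {ω | regret 𝒜 θ (fun t => act t ω) ≤ X} := fun X h => by
    have : {ω | regret 𝒜 θ (fun t => act t ω) ≤ X} = Set.univ := Set.eq_univ_of_forall h
    rw [this, probReal_univ]
    have : 0 ≤ 1 / (T : ℝ) := by positivity
    linarith
  rcases Nat.eq_zero_or_pos d with rfl | hd
  · -- in dimension `0` all rewards have mean `0`
    refine hall _ fun ω => ?_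
    have hz0 : ∀ x : Act 0, ⟪θ, x⟫ = 0 := fun x => by
      rw [Subsingleton.elim x 0, inner_zero_right]
    have : regret 𝒜 θ (fun t => act t ω) = 0 := by
      simp only [regret, hz0, Finset.sum_const_zero, h𝒜.image_const, csSup_singleton]
      simp
    rw [this]
    simp
  have hd' : (1 : ℝ) ≤ d := by exact_mod_cast hd
  set M := Real.sqrt (T * Real.log T) with hM
  have hM1 : 1 ≤ M := by
    apply Real.le_sqrt_of_sq_le
    have h1 : Real.log 2 ≤ Real.log T := Real.log_le_log (by norm_num) hT'
    have := Real.log_two_gt_d9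
    nlinarith
  have hN0 : 0 ≤ (d : ℝ) ^ 2 * Real.log T ^ 2 / ε := by positivity
  have hdM : M ≤ d * M := by nlinarith
  by_cases hbig : T₀ + 9 ≤ T
  swap
  · -- for small `T` the regret is at most `2 T`, a constant
    refine hall _ fun ω => ?_
    rw [hactω]
    refine (hS.regret_le_two_mul h𝒜 h𝒜1 hT hb.le hθ _ _).trans ?_
    have h1 : (T : ℝ) ≤ T₀ + 9 := by exact_mod_cast (not_le.1 hbig).le
    have h2 : (1 : ℝ) ≤ d * M + (d : ℝ) ^ 2 * Real.log T ^ 2 / ε := by linarith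
    have h3 : (0 : ℝ) ≤ 2 * (T₀ + 9) + 1000 + 200 * |B| := by positivity
    calc 2 * (T : ℝ) ≤ (2 * (T₀ + 9) + 1000 + 200 * |B|) * 1 := by
          have := abs_nonneg B; linarith
      _ ≤ _ := mul_le_mul_of_nonneg_left h2 h3
  have hT9 : (9 : ℝ) ≤ T := by exact_mod_cast (by omega : 9 ≤ T)
  have hl2 : 2 ≤ Real.log T := by
    rw [Real.le_log_iff_exp_le (by linarith)]
    have h1 : Real.exp 2 = Real.exp 1 ^ 2 := by rw [← Real.exp_nat_mul]; norm_num
    have h2 := Real.exp_one_lt_d9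
    have h3 := Real.exp_pos 1
    rw [h1]
    nlinarith
  have hK : 1 ≤ numBatches T := Nat.le_floor (by push_cast; linarith)
  have hB1 := hS.one_le h𝒜
  refine (hS.measure_accurate_ge h𝒜 h𝒜1 hT (by linarith) hd hb (hT₀ T (by omega)) hθ hz hact hbandit
    _ rfl).trans (measureReal_mono (fun ω hω => ?_) (measure_ne_top _ _))
  have h1 := hS.regret_le (R := fun s => r s ω) (z := fun s a => z s a ω) h𝒜 h𝒜1 hT hK hd hb.le hθ rfl hω
  have h2 := sum_gapBound_le hd (by linarith : (0 : ℝ) ≤ B) hb.le (by omega) hl2 (hS.net_nonempty h𝒜)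
    hS.net_spec.2.2.2
  show regret 𝒜 θ (fun t => act t ω) ≤ _
  rw [hactω]
  refine (h1.trans (add_le_add le_rfl h2)).trans ?_
  rw [abs_of_nonneg (by linarith : 0 ≤ B), ← hM]
  have hlM : Real.log T ≤ M := by
    apply Real.le_sqrt_of_sq_le
    have := Real.log_le_self (by positivity : (0 : ℝ) ≤ T)
    nlinarith
  have hnoise : Real.log T * ((2 * B * d ^ 2 + 10 * d ^ 2 * Real.log T) * (Δ / ε)) ≤
      (2 * B + 20) * ((d : ℝ) ^ 2 * Real.log T ^ 2 / ε) := by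
    have h3 : Δ / ε ≤ 2 / ε := by gcongr
    calc _ ≤ Real.log T * ((2 * B * d ^ 2 + 10 * d ^ 2 * Real.log T) * (2 / ε)) := by gcongr
      _ = (2 * B * 2 * Real.log T + 20 * Real.log T ^ 2) * ((d : ℝ) ^ 2 / ε) := by ring
      _ ≤ (2 * B * Real.log T ^ 2 + 20 * Real.log T ^ 2) * ((d : ℝ) ^ 2 / ε) := by
          have : 2 * Real.log T ≤ Real.log T ^ 2 := by nlinarith
          have : 2 * B * (2 * Real.log T) ≤ 2 * B * Real.log T ^ 2 := by gcongr
          exact mul_le_mul_of_nonneg_right (by linarith) (by positivity)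
      _ = _ := by ring
  have hBd : 2 * B * d * Real.log T ≤ 2 * B * (d * M) := by
    calc 2 * B * d * Real.log T ≤ 2 * B * d * M := by gcongr
      _ = _ := by ring
  have e1 : 1 ≤ d * M := by linarith
  have hT00 : (0 : ℝ) ≤ T₀ := by positivity
  have hdM0 : 0 ≤ d * M := by linarith
  have p1 : 0 ≤ B * (d * M) := by positivity
  have p2 : 0 ≤ B * ((d : ℝ) ^ 2 * Real.log T ^ 2 / ε) := by positivity
  have p3 : 0 ≤ T₀ * (d * M) := by positivity
  have p4 : 0 ≤ T₀ * ((d : ℝ) ^ 2 * Real.log T ^ 2 / ε) := by positivity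
  nlinarith
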